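/- **Setting.** Let $\mathcal U$ be a finite set with $n\ge 1$ elements and let $f:2^{\mathcal U}\to\mathbb R_{\ge 0}$ be submodular (not necessarily monotone), accessed through a value oracle. Let $\mathcal I$ be either the size constraint $\{S:|S|\le k\}$ with $k\ge 1$, or the family of independent sets of a matroid on $\mathcal U$ of rank $k\ge 1$. Let $O$ maximize $f$ over $\mathcal I$, and assume $f(O)>0$. Write $\Delta(x\mid S)=f(S\cup\{x\})-f(S)$. Let $0<\varepsilon\le 10/9$ and $\ell=\lceil 10/(9\varepsilon)\rceil$ (so $\ell=10/(9\varepsilon)$ when that is an integer); under the size constraint assume $\ell\mid k$. Let $Z_0\in\mathcal I$ with $f(Z_0)\ge\alpha_0 f(O)$ for a constant $\alpha_0>0$, and let $t\in[0,1]$. The ground set is extended by sufficiently many ($3k$ suffice) dummy elements, which have zero marginal gain to every set; a set is feasible in the extended ground set if its non-dummy part is in $\mathcal I$ and it has at most $k$ elements in total, and it is a basis if moreover it has exactly $k$ elements. Dummies are removed from the output. All ties and unspecified choices below may be resolved by any fixed rule. **FastLS.** Start with $Z=Z_0$, padded with dummies to $k$ elements. While there are $a\in Z$, $e\notin Z$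 such that $Z-a+e$ is feasible and $\Delta(e\mid Z)-\Delta(a\mid Z-a)\ge\frac{\varepsilon}{k}f(Z)$, replace $Z$ by $Z-a+e$ for such a pair. Return $Z$. **GuidedIG-S$(Z,G)$** (size constraint). Let $a_1,\dots,a_\ell$ be $\ell$ elements outside $G\cup Z$ with the largest marginal gains to $G$. For each $u=0,\dots,\ell$ independently, set $A_{u,l}=G+a_l$ ($1\le l\le\ell$) if $u=0$ and $A_{u,l}=G+a_u$ ($1\le l\le\ell$) if $u\ge1$; then, $k/\ell-1$ times, for $i=1,\dots,\ell$ in turn add to $A_{u,i}$ an element of largest marginal gain to $A_{u,i}$ among those outside $Z\cup\bigcup_l A_{u,l}$. The candidates are the $\ell(\ell+1)$ sets $A_{u,i}$. **GuidedIG-M$(Z,G)$** (matroid constraint, $G$ a basis). Start with $A=A_1=\dots=A_\ell=\emptyset$; $k$ times, choose $j\in\{1,\dots,\ell\}$ and $x\notin G\cup A\cup Z$ with $A+x$ feasible such that $\Delta(x\mid G\cup A_j)$ is maximal, and add $x$ to $A$ and to $A_j$. Then choose a bijection $\sigma:G\to A$ such that $(G\cup A_j)\setminus\sigma^{-1}(A_j)$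 is a basis for every $j$. The candidates are these $\ell$ sets. **The algorithm.** Let $Z$ be the output of FastLS. Let $A_0=\emptyset$ (under the matroid constraint, $A_0$ is a basis that consists of dummies). For $i=1,\dots,\ell$, let $A_i$ be a candidate, chosen uniformly at random by its index and independently of the earlier choices, of GuidedIG-S (size constraint) or GuidedIG-M (matroid constraint), called with $(Z,A_{i-1})$ if $i\le t\ell$ and with $(\emptyset,A_{i-1})$ otherwise. Return the set $A^*$ of larger value among $Z$ and $A_\ell$. **Theorem.** The algorithm is well defined and terminates, its output $A^*$ is always in $\mathcal I$, and: 1. Under the size constraint with $t=0.372$, there is an event $E$ of probability $(\ell+1)^{-\ell}$ with $\mathbb E[f(A^*)\mid E]\ge(0.385-\varepsilon)f(O)$. 2. Under the matroid constraint with $t=0.559$, $\mathbb E[f(A^*)]\ge(0.305-\varepsilon)f(O)$. 3. In both cases the algorithm can be implemented such that each of its runs makes at most $C\,kn/\varepsilon$ oracle queries, where $C$ depends only on $\alpha_0$. -/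

import Mathlib

open Finset
open scoped BigOperators

universe u

namespace SubmodMax

section OracleModel

/-- Deterministic programs with access to a value oracle `f : Finset α → ℝ`.  The oracle is the only
way in which a program can learn anything about `f`: a node `ask Q next` queries the value of each of
the sets in `Q` and continues with the answers.  All other computation is free.  Randomized
algorithms are families of such programs indexed by the (uniformly random) coin tosses. -/
inductive QueryProg (α : Type u) (β : Type u) : Type u
  | ret (b : β) : QueryProg α β
  | ask (Q : Finset (Finset α)) (next : (Finset α → ℝ) → QueryProg α β) : QueryProg α β

namespace QueryProg

variable {α β γ : Type u}

/-- Sequential composition. -/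
def bind : QueryProg α β → (β → QueryProg α γ) → QueryProg α γ
  | ret b, g => g b
  | ask Q next, g => ask Q (fun v => (next v).bind g)

instance : Monad (QueryProg α) where
  pure := ret
  bind := bind

open Classical in
/-- What the program is told after asking for the sets in `Q`: their values, and nothing about any
other set. -/
noncomputable def answers (f : Finset α → ℝ) (Q : Finset (Finset α)) : Finset α → ℝ :=
  fun S => if S ∈ Q then f S else 0

/-- The result of a program run with oracle `f`. -/
noncomputable def run (f : Finset α → ℝ) : QueryProg α β → β
  | ret b => b
  | ask Q next => run f (next (answers f Q))

/-- The number of oracle queries (counted with repetition) made in the run with oracle `f`. -/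
noncomputable def queries (f : Finset α → ℝ) : QueryProg α β → ℕ
  | ret _ => 0
  | ask Q next => Q.card + queries f (next (answers f Q))

end QueryProg

end OracleModel

section Instances

/-- A submodular set function. -/
def IsSubmodular {α : Type u} [DecidableEq α] (f : Finset α → ℝ) : Prop :=
  ∀ A B : Finset α, f (A ∪ B) + f (A ∩ B) ≤ f A + f B

/-- `O` maximizes `f` over the feasible sets `I`. -/
def IsOptimal {α : Type u} (f : Finset α → ℝ) (I : Finset α → Prop) (O : Finset α) : Prop :=
  I O ∧ ∀ S, I S → f S ≤ f O

/-- The size constraint. -/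
def SizeFeasible {α : Type u} (k : ℕ) (S : Finset α) : Prop := S.card ≤ k

/-- The matroid constraint. -/
def MatroidFeasible {α : Type u} (M : Matroid α) (S : Finset α) : Prop := M.Indep (S : Set α)

/-- The ground set `α` extended by a pool of dummy elements `Sum.inr i`.  A set `S : Finset (Ext α k)`
has the value `f S.toLeft`, so that dummy elements have zero marginal gain.  The pool is as large as
is needed for three pairwise disjoint sets of `k` dummies. -/
abbrev Ext (α : Type u) (k : ℕ) : Type u := α ⊕ Fin (3 * k)

/-- Feasibility in the extended ground set: the non-dummy part is feasible, and there are at most `k`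
elements in total. -/
def ExtFeasible {α : Type u} (I : Finset α → Prop) (k : ℕ) (S : Finset (Ext α k)) : Prop :=
  I S.toLeft ∧ S.card ≤ k

/-- Bases in the extended ground set: the feasible sets with `k` elements. -/
def ExtBasis {α : Type u} (I : Finset α → Prop) (k : ℕ) (S : Finset (Ext α k)) : Prop :=
  I S.toLeft ∧ S.card = k

/-- `S`, padded with dummy elements up to size `k` (if `S` has at most `k` elements). -/
def pad {α : Type u} (k : ℕ) (S : Finset α) : Finset (Ext α k) :=
  S.disjSum (univ.filter fun i : Fin (3 * k) => (i : ℕ) < k - S.card)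

end Instances

section Choices

/-! The pseudocode leaves some choices open (which of several maximizers, which improving swap, which
bijection).  They are made by selection rules, about which nothing is known but the following. -/

/-- `r` selects some element from every nonempty finite set. -/
def IsChoice {β : Type u} (r : Finset β → β) : Prop :=
  ∀ s : Finset β, s.Nonempty → r s ∈ s

/-- `r` selects a maximizer of `g` over every nonempty finite set. -/
def IsArgmax {β : Type u} (r : Finset β → (β → ℝ) → β) : Prop :=
  ∀ (s : Finset β) (g : β → ℝ), s.Nonempty → r s g ∈ s ∧ ∀ y ∈ s, g y ≤ g (r s g)

/-- `r` lists, in some order, `ℓ` elements with the largest values of `g` in any finite set with at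
least `ℓ` elements. -/
def IsTop {β : Type u} (ℓ : ℕ) (r : Finset β → (β → ℝ) → Fin ℓ → β) : Prop :=
  ∀ (s : Finset β) (g : β → ℝ), ℓ ≤ s.card →
    Function.Injective (r s g) ∧ (∀ l, r s g l ∈ s) ∧
      ∀ x ∈ s, (∀ l, r s g l ≠ x) → ∀ l, g x ≤ g (r s g l)

variable {α : Type u} [DecidableEq α]

/-- `τ` (the inverse of the bijection `σ : G → A`, where `A` is the union of the sets `P j`) is such
that each `(G ∪ P j) \ τ(P j)` is a basis. -/
def IsExchange (I : Finset α → Prop) (k ℓ : ℕ) (G : Finset (Ext α k))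
    (P : Fin ℓ → Finset (Ext α k)) (τ : Ext α k → Ext α k) : Prop :=
  Set.BijOn τ (univ.biUnion P : Finset (Ext α k)) G ∧
    ∀ j, ExtBasis I k ((G ∪ P j) \ (P j).image τ)

/-- `r` selects an exchange map wherever there is one. -/
def SelectsExchange (I : Finset α → Prop) (k ℓ : ℕ)
    (r : Finset (Ext α k) → (Fin ℓ → Finset (Ext α k)) → Ext α k → Ext α k) : Prop :=
  ∀ G P, (∃ τ, IsExchange I k ℓ G P τ) → IsExchange I k ℓ G P (r G P)

end Choices

section Algorithms

variable {α : Type u} [Fintype α] [DecidableEq α]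

/-- The marginal gains of all elements to the set `S`. -/
noncomputable def gains {k : ℕ} (S : Finset (Ext α k)) : QueryProg α (Ext α k → ℝ) :=
  .ask (insert S.toLeft (univ.image fun x : α => insert x S.toLeft))
    fun v => .ret fun x => v (insert x S).toLeft - v S.toLeft

open Classical in
/-- The improving swaps of the local search at the set `Z`, computed from the values `v`: the pairs
`(a, e)` with `a ∈ Z`, `e ∉ Z` such that `Z - a + e` is feasible and the gain of `e` to `Z` minus the
gain of `a` to `Z - a` is at least `ε / k` times the value of `Z`. -/
noncomputable def improvingSwaps (I : Finset α → Prop) (k : ℕ) (ε : ℝ) (Z : Finset (Ext α k))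
    (v : Finset α → ℝ) : Finset (Ext α k × Ext α k) :=
  univ.filter fun p =>
    p.1 ∈ Z ∧ p.2 ∉ Z ∧ ExtFeasible I k (insert p.2 (Z.erase p.1)) ∧
      ε / k * v Z.toLeft ≤
        (v (insert p.2 Z).toLeft - v Z.toLeft) - (v Z.toLeft - v (Z.erase p.1).toLeft)

open Classical in
/-- Fast local search from `Z`: as long as there is an improving swap, make one.  The number in front
of `Z` is a cap on the iterations of the while loop; the result is `none` if the cap is reached
before the loop ends, and otherwise it does not depend on the cap. -/
noncomputable def fastLS (I : Finset α → Prop) (k : ℕ) (ε : ℝ)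
    (swap : Finset (Ext α k × Ext α k) → Ext α k × Ext α k) :
    ℕ → Finset (Ext α k) → QueryProg α (Option (Finset (Ext α k)))
  | 0, _ => .ret none
  | N + 1, Z =>
    .ask (insert Z.toLeft ((univ.image fun x : α => insert x Z.toLeft) ∪
        univ.image fun x : α => Z.toLeft.erase x))
      fun v =>
        if (improvingSwaps I k ε Z v).Nonempty then
          fastLS I k ε swap N
            (insert (swap (improvingSwaps I k ε Z v)).2
              (Z.erase (swap (improvingSwaps I k ε Z v)).1))
        else .ret (some Z)

/-- One step of interlaced greedy: the `i`-th set gets the element of largest gain to it which is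
outside `Z` and outside of all `ℓ` sets. -/
noncomputable def interlaceStep {k ℓ : ℕ} (Z : Finset (Ext α k))
    (argmax : Finset (Ext α k) → (Ext α k → ℝ) → Ext α k)
    (A : Fin ℓ → Finset (Ext α k)) (i : Fin ℓ) : QueryProg α (Fin ℓ → Finset (Ext α k)) := do
  let g ← gains (A i)
  return Function.update A i (insert (argmax ((univ \ Z) \ univ.biUnion A) g) (A i))

/-- `m` rounds of interlaced greedy, in each of which the sets `1, …, ℓ` get one element each. -/
noncomputable def interlaceRounds {k ℓ : ℕ} (Z : Finset (Ext α k))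
    (argmax : Finset (Ext α k) → (Ext α k → ℝ) → Ext α k) :
    ℕ → (Fin ℓ → Finset (Ext α k)) → QueryProg α (Fin ℓ → Finset (Ext α k))
  | 0, A => return A
  | m + 1, A => do
    let A' ← (List.finRange ℓ).foldlM (interlaceStep Z argmax) A
    interlaceRounds Z argmax m A'

/-- Guided interlaced greedy for the size constraint, with guidance set `Z` and starting set `G`.
The output is the set number `c = (u, i)` of the `(ℓ + 1) * ℓ` candidate sets, where `u = none` stands
for the branch in which the set number `l` starts with the top element number `l`, and `u = some m`
for the branch in which all sets start with the top element number `m`.  As the branches do not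
interact, only the branch of the wanted set is executed. -/
noncomputable def guidedIGS (k ℓ : ℕ)
    (top : Finset (Ext α k) → (Ext α k → ℝ) → Fin ℓ → Ext α k)
    (argmax : Finset (Ext α k) → (Ext α k → ℝ) → Ext α k)
    (Z G : Finset (Ext α k)) (c : Option (Fin ℓ) × Fin ℓ) :
    QueryProg α (Finset (Ext α k)) := do
  let g ← gains G
  let a := top (univ \ (G ∪ Z)) g
  let A ← interlaceRounds Z argmax (k / ℓ - 1) fun l => insert (a (c.1.getD l)) G
  return A c.2

open Classical in
/-- The loop of guided interlaced greedy for a matroid constraint: `m` further elements are added to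
`A` and to the part `P j` of `A` for which the gain to `G ∪ P j` is largest.  The table `T` holds the
current gains `T j x` of `x` to `G ∪ P j`; after each step only the row of the part that has changed
is computed anew. -/
noncomputable def matroidRounds (I : Finset α → Prop) (k ℓ : ℕ)
    (argmax : Finset (Fin ℓ × Ext α k) → (Fin ℓ × Ext α k → ℝ) → Fin ℓ × Ext α k)
    (Z G : Finset (Ext α k)) :
    ℕ → Finset (Ext α k) → (Fin ℓ → Finset (Ext α k)) → (Fin ℓ → Ext α k → ℝ) →
      QueryProg α (Fin ℓ → Finset (Ext α k))
  | 0, _, P, _ => return P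
  | m + 1, A, P, T => do
    let X := univ.filter fun x => x ∉ G ∪ A ∪ Z ∧ ExtFeasible I k (insert x A)
    let p := argmax (univ ×ˢ X) fun q => T q.1 q.2
    let P' := Function.update P p.1 (insert p.2 (P p.1))
    let g ← gains (G ∪ P' p.1)
    matroidRounds I k ℓ argmax Z G m (insert p.2 A) P' (Function.update T p.1 g)

/-- Guided interlaced greedy for a matroid constraint, with guidance set `Z` and starting basis `G`.
The output is the set number `c` of the `ℓ` candidate sets. -/
noncomputable def guidedIGM (I : Finset α → Prop) (k ℓ : ℕ)
    (argmax : Finset (Fin ℓ × Ext α k) → (Fin ℓ × Ext α k → ℝ) → Fin ℓ × Ext α k)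
    (exch : Finset (Ext α k) → (Fin ℓ → Finset (Ext α k)) → Ext α k → Ext α k)
    (Z G : Finset (Ext α k)) (c : Fin ℓ) : QueryProg α (Finset (Ext α k)) := do
  let g ← gains G
  let P ← matroidRounds I k ℓ argmax Z G k ∅ (fun _ => ∅) (fun _ => g)
  return (G ∪ P c) \ (P c).image (exch G P)

open Classical in
/-- The guidance set in iteration number `i + 1` of `ℓ`: this is `Z` up to the switch time `t`, and
afterwards the empty set. -/
noncomputable def guidance {k : ℕ} (t : ℝ) (ℓ : ℕ) (Z : Finset (Ext α k)) (i : Fin ℓ) :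
    Finset (Ext α k) :=
  if ((i : ℕ) : ℝ) + 1 ≤ t * ℓ then Z else ∅

open Classical in
/-- The better one of two sets, without its dummy elements. -/
noncomputable def better {k : ℕ} (Z A : Finset (Ext α k)) : QueryProg α (Option (Finset α)) :=
  .ask {Z.toLeft, A.toLeft} fun v =>
    .ret (some (if v A.toLeft ≤ v Z.toLeft then Z.toLeft else A.toLeft))

/-- The randomized algorithm under the size constraint: `ω i` is the uniformly random index of the
set taken from the candidates of the `i`-th call of guided interlaced greedy. -/
noncomputable def sizeAlg (k : ℕ) (t ε : ℝ) (ℓ : ℕ)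
    (swap : Finset (Ext α k × Ext α k) → Ext α k × Ext α k)
    (top : Finset (Ext α k) → (Ext α k → ℝ) → Fin ℓ → Ext α k)
    (argmax : Finset (Ext α k) → (Ext α k → ℝ) → Ext α k)
    (Z₀ : Finset α) (N : ℕ) (ω : Fin ℓ → Option (Fin ℓ) × Fin ℓ) :
    QueryProg α (Option (Finset α)) := do
  match ← fastLS (SizeFeasible k) k ε swap N (pad k Z₀) with
  | none => return none
  | some Z =>
    let A ← (List.finRange ℓ).foldlM
      (fun A i => guidedIGS k ℓ top argmax (guidance t ℓ Z i) A (ω i)) ∅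
    better Z A

/-- The randomized algorithm under a matroid constraint of rank `k`: `ω i` is the uniformly random
index of the set taken from the candidates of the `i`-th call of guided interlaced greedy.  The
iterates are bases, and the first one consists of dummy elements only. -/
noncomputable def matroidAlg (M : Matroid α) (k : ℕ) (t ε : ℝ) (ℓ : ℕ)
    (swap : Finset (Ext α k × Ext α k) → Ext α k × Ext α k)
    (argmax : Finset (Fin ℓ × Ext α k) → (Fin ℓ × Ext α k → ℝ) → Fin ℓ × Ext α k)
    (exch : Finset (Ext α k) → (Fin ℓ → Finset (Ext α k)) → Ext α k → Ext α k)
    (Z₀ : Finset α) (N : ℕ) (ω : Fin ℓ → Fin ℓ) :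
    QueryProg α (Option (Finset α)) := do
  match ← fastLS (MatroidFeasible M) k ε swap N (pad k Z₀) with
  | none => return none
  | some Z =>
    let A ← (List.finRange ℓ).foldlM
      (fun A i => guidedIGM (MatroidFeasible M) k ℓ argmax exch (guidance t ℓ Z i) A (ω i))
      (pad k ∅)
    better Z A

end Algorithms

end SubmodMax

namespace SubmodMax

/-! ### Evaluation and query counts of oracle programs -/

section Oracle

variable {α β γ δ : Type u} (f : Finset α → ℝ)

namespace QueryProg

/-! Local search and greedy cover each other's bad cases. Let V = f(O), let Z be the local optimum,
and put I = f(O ∩ Z), U = f(O ∪ Z). Basis exchange pairs the elements that a feasible set adds to Z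
with elements of Z that they may replace. As no such swap is improving, summing over the pairs gives
I + U ≤ (2 + ε) f(Z), and likewise I ≤ (1 + ε) f(Z) (`IsLocalOpt.value_union_add_inter_le`,
`IsLocalOpt.value_inter_le`). So either Z is already good enough, or I and U are small compared with
V, and then a greedy process that at first keeps away from Z does well.

One call of guided interlaced greedy from G has two properties. Gain: the candidates gain enough
that ℓ times the gain pays for adding O \ Z. The greedy maximizers are charged for the elements of O
\ Z that were still available. Spread: the candidates add sets that are pairwise disjoint outside
the set X they are compared with. So for a random candidate B, the mean of f(X ∪ B) is at least (1 -
1/ℓ) f(X ∪ G) by submodularity and nonnegativity. Under a matroid constraint the gain holds before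
the exchange. The exchanged parts partition G, so undoing them costs on average at most a 1/ℓ share
of the loss from removing all of G. This turns the spread factor into 1 - 2/ℓ, with f(X)/ℓ returned
(`guidedIGM_spec`).

Under the size constraint the gain needs the right branch, which depends on O and on the current
iterate (`exists_guidedIGS_branch`). Whatever the history, a random index hits that branch with
probability 1/(ℓ + 1), so the history-dependent guesses are all right with probability (ℓ + 1)^(-ℓ).
Conditioned on this, the choices within the branches are still uniform and independent
(`exists_coupling`).

While the iterate A avoids Z, submodularity gives f((O \ Z) ∪ A) ≥ V - I - U + f(O ∪ Z ∪ A). At the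
switch it gives f(O ∪ A) ≥ V - U + f(O ∪ Z ∪ A). Taking means yields linear recurrences for the
expected values of A, O ∪ A and O ∪ Z ∪ A. Their solution (`size_recurrence_bound`,
`matroid_recurrence_bound`) is a bound that is linear in V, I and U. The constants 0.385 and 0.305
come from inserting the local search bounds. This is checked value by value for ℓ < 20 and through
estimates of the exponential for ℓ ≥ 20.

For the query count, each swap multiplies f(Z) by at least 1 + ε/k, starting from α₀ V, so O(k / (ε
α₀)) iterations suffice. The ℓ = O(1/ε) greedy calls need O(kn) queries each. -/

@[simp] theorem run_ret (b : β) : (ret b : QueryProg α β).run f = b := rfl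

@[simp] theorem queries_ret (b : β) : (ret b : QueryProg α β).queries f = 0 := rfl

@[simp] theorem run_pure (b : β) : (pure b : QueryProg α β).run f = b := rfl

@[simp] theorem queries_pure (b : β) : (pure b : QueryProg α β).queries f = 0 := rfl

@[simp] theorem run_ask (Q : Finset (Finset α)) (next : (Finset α → ℝ) → QueryProg α β) :
    (ask Q next).run f = (next (answers f Q)).run f := rfl

@[simp] theorem queries_ask (Q : Finset (Finset α)) (next : (Finset α → ℝ) → QueryProg α β) :
    (ask Q next).queries f = Q.card + (next (answers f Q)).queries f := rfl

@[simp] theorem run_bind (p : QueryProg α β) (g : β → QueryProg α γ) :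
    (p >>= g).run f = (g (p.run f)).run f := by
  change (QueryProg.bind p g).run f = _
  induction p with
  | ret b => rfl
  | ask Q next ih => exact ih _

@[simp] theorem queries_bind (p : QueryProg α β) (g : β → QueryProg α γ) :
    (p >>= g).queries f = p.queries f + (g (p.run f)).queries f := by
  change (QueryProg.bind p g).queries f = _
  induction p with
  | ret b => simp [QueryProg.bind]
  | ask Q next ih =>
    have := ih (answers f Q)
    simp only [QueryProg.bind, queries_ask, run_ask]
    omega

theorem run_foldlM {ι : Type*} (step : β → ι → QueryProg α β) (l : List ι) (b : β) :
    (l.foldlM step b).run f = l.foldl (fun b i => (step b i).run f) b := by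
  induction l generalizing b with
  | nil => rfl
  | cons i l ih => simp [List.foldlM_cons, ih]

theorem queries_foldlM_le {ι : Type*} (step : β → ι → QueryProg α β) (c : ℕ)
    (h : ∀ b i, (step b i).queries f ≤ c) (l : List ι) (b : β) :
    (l.foldlM step b).queries f ≤ l.length * c := by
  induction l generalizing b with
  | nil => simp
  | cons i l ih =>
    simp only [List.foldlM_cons, queries_bind, List.length_cons]
    have h1 := h b i
    have h2 := ih ((step b i).run f)
    nlinarith

theorem answers_of_mem {Q : Finset (Finset α)} {S : Finset α} (h : S ∈ Q) :
    answers f Q S = f S := by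
  simp [answers, h]

end QueryProg

end Oracle

/-! ### Submodular set functions -/

section SetFunctions

variable {E : Type u} [DecidableEq E]

/-- The marginal gain of `x` to `S`. -/
def marg (F : Finset E → ℝ) (S : Finset E) (x : E) : ℝ := F (insert x S) - F S

theorem marg_of_mem (F : Finset E → ℝ) {S : Finset E} {x : E} (h : x ∈ S) : marg F S x = 0 := by
  simp [marg, insert_eq_of_mem h]

/-- Diminishing returns. -/
theorem IsSubmodular.marg_anti {F : Finset E → ℝ} (hF : IsSubmodular F) {S T : Finset E}
    (hST : S ⊆ T) {x : E} (hx : x ∉ T) : marg F T x ≤ marg F S x := by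
  have h := hF (insert x S) T
  have h1 : insert x S ∪ T = insert x T := by
    rw [insert_union, union_eq_right.2 hST]
  have h2 : insert x S ∩ T = S := by
    rw [insert_inter_of_notMem hx, inter_eq_left.2 hST]
  rw [h1, h2] at h
  simp only [marg]
  linarith

/-- An element of `T` has gain 0 to `T`, which may exceed a negative gain to `S`; a nonnegative
bound survives this case. Greedy maximizers have nonnegative gain thanks to the dummies, so the
charging arguments use this form. -/
theorem IsSubmodular.marg_le_of_nonneg {F : Finset E → ℝ} (hF : IsSubmodular F) {S T : Finset E}
    (hST : S ⊆ T) {x : E} {c : ℝ} (h0 : 0 ≤ c) (h : marg F S x ≤ c) : marg F T x ≤ c := by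
  by_cases hx : x ∈ T
  · rwa [marg_of_mem F hx]
  · exact (hF.marg_anti hST hx).trans h

/-- The gain of a set is at most the sum of the gains of its elements. -/
theorem IsSubmodular.sub_le_sum_marg {F : Finset E → ℝ} (hF : IsSubmodular F) (S R : Finset E) :
    F (R ∪ S) - F S ≤ ∑ o ∈ R, marg F S o := by
  induction R using Finset.induction_on with
  | empty => simp
  | insert a R ha ih =>
    rw [sum_insert ha, insert_union]
    have : F (insert a (R ∪ S)) - F (R ∪ S) ≤ marg F S a := by
      by_cases h : a ∈ R ∪ S
      · rw [insert_eq_of_mem h]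
        rcases mem_union.1 h with h | h
        · exact absurd h ha
        · simp [marg_of_mem F h]
      · exact hF.marg_anti subset_union_right h
    linarith

/-- The losses by removing single elements add up to at most the loss by removing all of them. -/
theorem IsSubmodular.sum_erase_le {F : Finset E → ℝ} (hF : IsSubmodular F) (S R : Finset E)
    (hR : R ⊆ S) : ∑ a ∈ R, (F S - F (S.erase a)) ≤ F S - F (S \ R) := by
  induction R using Finset.induction_on with
  | empty => simp
  | insert a R ha ih =>
    rw [sum_insert ha]
    have haS : a ∈ S := hR (mem_insert_self _ _)
    have ih := ih fun x hx => hR (mem_insert_of_mem hx)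
    have h := hF (S.erase a) (S \ R)
    have h1 : S.erase a ∪ S \ R = S := by
      ext x; simp only [mem_union, mem_erase, mem_sdiff]
      by_cases hxa : x = a
      · subst hxa; tauto
      · tauto
    have h2 : S.erase a ∩ (S \ R) = S \ insert a R := by
      ext x; simp only [mem_inter, mem_erase, mem_sdiff, mem_insert]; tauto
    rw [h1, h2] at h
    linarith

/-- Submodularity merges the sets `X ∪ D i` one at a time. As the `D i` meet only inside `X`, every
merge leaves exactly `X` as the intersection. -/
theorem IsSubmodular.sum_union_ge {F : Finset E → ℝ} (hF : IsSubmodular F) {ι : Type*}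
    (X : Finset E) (D : ι → Finset E) (s : Finset ι)
    (hD : ∀ i ∈ s, ∀ j ∈ s, i ≠ j → D i ∩ D j ⊆ X) :
    ((s.card : ℝ) - 1) * F X + F (X ∪ s.biUnion D) ≤ ∑ j ∈ s, F (X ∪ D j) := by
  classical
  induction s using Finset.induction_on with
  | empty => simp
  | insert a s ha ih =>
    rw [sum_insert ha, card_insert_of_notMem ha, biUnion_insert]
    have ih := ih fun i hi j hj => hD i (mem_insert_of_mem hi) j (mem_insert_of_mem hj)
    have h := hF (X ∪ D a) (X ∪ s.biUnion D)
    have h1 : (X ∪ D a) ∪ (X ∪ s.biUnion D) = X ∪ (D a ∪ s.biUnion D) := by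
      ext x; simp only [mem_union]; tauto
    have h2 : (X ∪ D a) ∩ (X ∪ s.biUnion D) = X := by
      rw [← union_inter_distrib_left, union_eq_left]
      intro x hx
      obtain ⟨hx1, hx2⟩ := mem_inter.1 hx
      obtain ⟨j, hj, hxj⟩ := mem_biUnion.1 hx2
      exact hD a (mem_insert_self _ _) j (mem_insert_of_mem hj) (fun e => ha (e ▸ hj))
        (mem_inter.2 ⟨hx1, hxj⟩)
    rw [h1, h2] at h
    push_cast
    linarith

/-- The source of the spreading factor 1 - 1/ℓ: for a random `j`, adding `D j` to `X` destroys on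
average at most the fraction 1/ℓ of the value. -/
theorem IsSubmodular.sum_union_ge' {F : Finset E → ℝ} (hF : IsSubmodular F) (h0 : ∀ S, 0 ≤ F S)
    {ℓ : ℕ} (X : Finset E) (D : Fin ℓ → Finset E) (hD : ∀ i j, i ≠ j → D i ∩ D j ⊆ X) :
    ((ℓ : ℝ) - 1) * F X ≤ ∑ j, F (X ∪ D j) := by
  have h := hF.sum_union_ge X D univ fun i _ j _ => hD i j
  have := h0 (X ∪ univ.biUnion D)
  simp only [card_univ, Fintype.card_fin] at h
  linarith

theorem IsSubmodular.sdiff {F : Finset E → ℝ} (hF : IsSubmodular F) (Y : Finset E) :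
    IsSubmodular fun S => F (Y \ S) := by
  intro A B
  have h := hF (Y \ A) (Y \ B)
  have h1 : Y \ A ∪ Y \ B = Y \ (A ∩ B) := by
    ext; simp only [mem_union, mem_inter, mem_sdiff]; tauto
  have h2 : Y \ A ∩ (Y \ B) = Y \ (A ∪ B) := by
    ext; simp only [mem_union, mem_inter, mem_sdiff]; tauto
  rw [h1, h2] at h
  simp only
  linarith

/-- Removing disjoint sets one at a time loses in total at most what removing all of them together
loses. It is the previous estimate for the submodular function `S ↦ F (Y \ S)`. -/
theorem IsSubmodular.sum_sdiff_ge {F : Finset E → ℝ} (hF : IsSubmodular F)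
    {ℓ : ℕ} (Y : Finset E) (C : Fin ℓ → Finset E) (hC : ∀ i j, i ≠ j → Disjoint (C i) (C j)) :
    ((ℓ : ℝ) - 1) * F Y + F (Y \ univ.biUnion C) ≤ ∑ j, F (Y \ C j) := by
  have h := (hF.sdiff Y).sum_union_ge ∅ C univ fun i _ j _ hij => by
    rw [(disjoint_iff_inter_eq_empty).1 (hC i j hij)]
  simpa using h

end SetFunctions

/-! ### Set functions on the ground set with dummies -/

section Extension

variable {α : Type u} [DecidableEq α]

/-- The extension of a set function to the ground set with dummy elements. -/
def dummyExt {k : ℕ} (f : Finset α → ℝ) (S : Finset (Ext α k)) : ℝ := f S.toLeft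

theorem IsSubmodular.dummyExt {k : ℕ} {f : Finset α → ℝ} (hf : IsSubmodular f) :
    IsSubmodular (dummyExt (k := k) f) := by
  intro A B
  simpa [SubmodMax.dummyExt, toLeft_union, toLeft_inter] using hf A.toLeft B.toLeft

theorem marg_dummy {k : ℕ} (f : Finset α → ℝ) (S : Finset (Ext α k)) (i : Fin (3 * k)) :
    marg (dummyExt f) S (Sum.inr i) = 0 := by
  simp [marg, dummyExt]

/-- Outside of fewer than `3 * k` elements, there is a dummy. -/
theorem exists_dummy {k : ℕ} (S : Finset (Ext α k)) (h : S.card < 3 * k) :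
    ∃ i : Fin (3 * k), Sum.inr i ∉ S := by
  by_contra! hall
  have : (univ.map ⟨Sum.inr, Sum.inr_injective⟩ : Finset (Ext α k)) ⊆ S := by
    intro x hx
    obtain ⟨i, -, rfl⟩ := mem_map.1 hx
    exact hall i
  have := card_le_card this
  simp at this
  omega

variable [Fintype α]

theorem run_gains {k : ℕ} (f : Finset α → ℝ) (S : Finset (Ext α k)) :
    (gains S).run f = marg (dummyExt f) S := by
  funext x
  simp only [gains, QueryProg.run_ask, QueryProg.run_ret, marg, dummyExt]
  rw [QueryProg.answers_of_mem f (mem_insert_self _ _), QueryProg.answers_of_mem]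
  rcases x with x | x <;> simp

theorem queries_gains_le {k : ℕ} (f : Finset α → ℝ) (S : Finset (Ext α k)) :
    (gains S).queries f ≤ Fintype.card α + 1 := by
  simp only [gains, QueryProg.queries_ask, QueryProg.queries_ret, add_zero]
  refine (card_insert_le _ _).trans (Nat.succ_le_succ ?_)
  exact card_image_le.trans_eq card_univ

end Extension

/-! ### Matroid rank, matroid partition and multiple basis exchange -/

section Matroids

variable {E : Type u} [DecidableEq E]

/-- The axioms of the independent sets of a matroid, for finite sets. -/
structure IsIndepSystem (J : Finset E → Prop) : Prop where
  empty : J ∅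
  subset : ∀ ⦃S T⦄, J T → S ⊆ T → J S
  augment : ∀ ⦃S T⦄, J S → J T → S.card < T.card → ∃ e ∈ T, e ∉ S ∧ J (insert e S)

/-- The ranks are taken in ℤ because the partition theorem is applied to dual rank functions and
contracts them, both of which involve subtraction. -/
theorem IsIndepSystem.exists_rank {J : Finset E → Prop} (hJ : IsIndepSystem J) :
    ∃ r : Finset E → ℤ,
      (∀ S T, r (S ∪ T) + r (S ∩ T) ≤ r S + r T) ∧ (∀ S T, S ⊆ T → r S ≤ r T) ∧
      (∀ e S, r (insert e S) ≤ r S + 1) ∧ (∀ S, J S ↔ r S = S.card) ∧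
      ∀ S, ∃ T ⊆ S, J T ∧ r S = T.card := by
  set M := (IndepMatroid.ofFinset Set.univ J hJ.empty hJ.subset hJ.augment
    fun _ _ => Set.subset_univ _).matroid with hM
  have hI : ∀ S : Finset E, M.Indep (S : Set E) ↔ J S := fun S => by
    rw [hM, IndepMatroid.matroid_Indep, IndepMatroid.ofFinset_indep]
  have hfin : ∀ S : Finset E, ((M.eRk (S : Set E)).toNat : ℕ∞) = M.eRk (S : Set E) := fun S =>
    ENat.natCast_toNat (ne_top_of_le_ne_top (Set.encard_ne_top_iff.2 S.finite_toSet)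
      (M.eRk_le_encard _))
  have hcard : ∀ S : Finset E, (S : Set E).encard = (S.card : ℕ∞) := fun S =>
    Set.encard_coe_eq_coe_finsetCard S
  refine ⟨fun S => ((M.eRk (S : Set E)).toNat : ℤ), fun S T => ?_, fun S T h => ?_,
    fun e S => ?_, fun S => ?_, fun S => ?_⟩
  · have h := M.eRk_inter_add_eRk_union_le (S : Set E) (T : Set E)
    rw [← coe_inter, ← coe_union, ← hfin, ← hfin S, ← hfin T, ← hfin (S ∪ T)] at h
    beta_reduce
    norm_cast at h ⊢
    omega
  · have h : M.eRk (S : Set E) ≤ M.eRk (T : Set E) := M.eRk_mono (coe_subset.2 h)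
    rw [← hfin, ← hfin T] at h
    beta_reduce
    exact_mod_cast h
  · have h := M.eRk_insert_le_add_one e (S : Set E)
    rw [← coe_insert, ← hfin, ← hfin S] at h
    beta_reduce
    exact_mod_cast h
  · rw [← hI, Matroid.indep_iff_eRk_eq_encard_of_finite S.finite_toSet, ← hfin, hcard]
    beta_reduce
    norm_cast
  · have h : M.eRk (S : Set E) ≤ M.eRk (S : Set E) := le_rfl
    nth_rewrite 1 [← hfin] at h
    obtain ⟨T, hTS, hT, hc⟩ := Matroid.le_eRk_iff.1 h
    lift T to Finset E using S.finite_toSet.subset hTS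
    refine ⟨T, coe_subset.1 hTS, (hI T).1 hT, ?_⟩
    rw [hcard] at hc
    beta_reduce
    norm_cast at hc ⊢
    exact hc.symm

/-- A set can be partitioned into parts which are full with respect to given matroid rank functions
if the ranks of each of its subsets add up to at least the size of the subset. -/
theorem exists_partition_of_card_le_sum_rank {ι : Type*} [Fintype ι]
    [DecidableEq ι] [Nonempty ι] (S : Finset E) (r : ι → Finset E → ℤ)
    (hsub : ∀ j U V, r j (U ∪ V) + r j (U ∩ V) ≤ r j U + r j V)
    (hmono : ∀ j e U, r j U ≤ r j (insert e U))
    (hunit : ∀ j e U, r j (insert e U) ≤ r j U + 1)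
    (h0 : ∀ j, r j ∅ = 0) (hS : ∀ U ⊆ S, (U.card : ℤ) ≤ ∑ j, r j U) :
    ∃ c : E → ι, ∀ j, ((S.filter (c · = j)).card : ℤ) ≤ r j (S.filter (c · = j)) := by
  induction S using Finset.induction_on generalizing r with
  | empty =>
    exact ⟨fun _ => Classical.arbitrary ι, fun j => by simp [h0]⟩
  | insert e S he ih =>
    -- Some part `j` can receive `e`: the rank condition must survive the contraction of `e` in the
    -- `j`-th matroid. Otherwise each `j` has a tight set `W j` whose `j`-span contains `e`.
    have key : ∃ j, ∀ U ⊆ S, (U.card : ℤ) + 1 ≤ ∑ i, r i U + (r j (insert e U) - r j U) := by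
      by_contra! hcon
      choose W hWS hW using hcon
      have htight : ∀ j, ∑ i, r i (W j) ≤ (W j).card ∧ r j (insert e (W j)) ≤ r j (W j) := by
        intro j
        have h1 := hW j
        have h2 := hS (W j) ((hWS j).trans (subset_insert _ _))
        have h3 := hmono j e (W j)
        constructor <;> linarith
      -- Uncrossing: by submodularity of the ranks, and the rank condition for the intersection, a
      -- union of tight sets is tight.
      have hunion : univ.sup W ⊆ S ∧ ∑ i, r i (univ.sup W) ≤ (univ.sup W).card := by
        refine Finset.sup_induction (p := fun U => U ⊆ S ∧ ∑ i, r i U ≤ U.card)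
          ⟨empty_subset _, ?_⟩ ?_ fun j _ => ⟨hWS j, (htight j).1⟩
        · simp [h0]
        · rintro U ⟨hU, hU'⟩ V ⟨hV, hV'⟩
          refine ⟨union_subset hU hV, ?_⟩
          have h1 : ∑ i, (r i (U ∪ V) + r i (U ∩ V)) ≤ ∑ i, (r i U + r i V) :=
            sum_le_sum fun i _ => hsub i U V
          rw [sum_add_distrib, sum_add_distrib] at h1
          have h2 := hS (U ∩ V) ((inter_subset_left.trans hU).trans (subset_insert _ _))
          have h3 := card_union_add_card_inter U V
          simp only [sup_eq_union]
          zify at h3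
          linarith
      obtain ⟨hT, hT'⟩ := hunion
      set T := univ.sup W with hTdef
      have hspan : ∀ j, r j (insert e T) ≤ r j T := by
        intro j
        have hWT : W j ⊆ T := le_sup (f := W) (mem_univ j)
        have h := hsub j (insert e (W j)) T
        have h1 : insert e (W j) ∪ T = insert e T := by rw [insert_union, union_eq_right.2 hWT]
        have h2 : insert e (W j) ∩ T = W j := by
          rw [insert_inter_of_notMem fun h => he (hT h), inter_eq_left.2 hWT]
        rw [h1, h2] at h
        have := (htight j).2
        linarith
      -- `T` is tight and spans `e` in every matroid, so `insert e T` has too small a total rank.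
      have h1 := hS (insert e T) (insert_subset_insert _ hT)
      rw [card_insert_of_notMem fun h => he (hT h)] at h1
      have h2 : ∑ i, r i (insert e T) ≤ ∑ i, r i T := sum_le_sum fun i _ => hspan i
      push_cast at h1
      linarith
    obtain ⟨j, hj⟩ := key
    have hr1 : r j {e} = 1 := by
      have h1 := hj ∅ (empty_subset _)
      have h2 := hunit j e ∅
      simp [h0] at h1 h2
      linarith
    -- Contraction of `e` in the matroid `j`; the other matroids stay unchanged.
    obtain ⟨c, hc⟩ := ih (fun i U => if i = j then r j (insert e U) - 1 else r i U)
      (by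
        intro i U V
        by_cases hij : i = j
        · simp only [hij, if_true]
          have h := hsub j (insert e U) (insert e V)
          rw [← insert_union_distrib, ← insert_inter_distrib] at h
          linarith
        · simp only [hij, if_false]
          exact hsub i U V)
      (by
        intro i x U
        by_cases hij : i = j
        · simp only [hij, if_true]
          rw [insert_comm]
          linarith [hmono j x (insert e U)]
        · simp only [hij, if_false]
          exact hmono i x U)
      (by
        intro i x U
        by_cases hij : i = j
        · simp only [hij, if_true]
          rw [insert_comm]
          linarith [hunit j x (insert e U)]
        · simp only [hij, if_false]
          exact hunit i x U)
      (by
        intro i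
        by_cases hij : i = j
        · simp [hij, hr1]
        · simp [hij, h0])
      (by
        intro U hU
        have h1 := hj U hU
        have h2 : ∑ i, (if i = j then r j (insert e U) - 1 else r i U)
            = ∑ i, r i U + (r j (insert e U) - r j U) - 1 := by
          have : ∀ i, (if i = j then r j (insert e U) - 1 else r i U)
              = r i U + if i = j then r j (insert e U) - 1 - r j U else 0 := by
            intro i
            by_cases hij : i = j
            · subst hij; simp
            · simp [hij]
          simp only [this, sum_add_distrib, sum_ite_eq', mem_univ, if_true]
          ring
        rw [h2]
        linarith)
    refine ⟨Function.update c e j, fun i => ?_⟩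
    have hupd : S.filter (Function.update c e j · = i) = S.filter (c · = i) := by
      refine filter_congr fun x hx => ?_
      rw [Function.update_of_ne (by rintro rfl; exact he hx)]
    rw [filter_insert, Function.update_self, hupd]
    have hci := hc i
    by_cases hij : i = j
    · subst hij
      simp only [if_true] at hci ⊢
      rw [card_insert_of_notMem fun h => he (mem_filter.1 h).1]
      push_cast
      linarith
    · simp only [hij, if_false, Ne.symm hij] at hci ⊢
      exact hci

/-- Multiple exchange between two bases `G` and `B` (Greene and Magnanti): for each partition of
`B \ G` there is a bijection to `G \ B` such that each of its parts can be exchanged for its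
image. -/
theorem IsIndepSystem.exists_multiple_exchange {J : Finset E → Prop} (hJ : IsIndepSystem J) {k : ℕ}
    (hk : ∀ S, J S → S.card ≤ k) {G B : Finset E} (hG : J G) (hB : J B) (hGk : G.card = k)
    (hBk : B.card = k) {ι : Type*} [Fintype ι] [DecidableEq ι] [Nonempty ι] (P : ι → Finset E)
    (hP : ∀ i j, i ≠ j → Disjoint (P i) (P j)) (hPB : univ.biUnion P = B \ G) :
    ∃ τ : E → E, Set.BijOn τ (B \ G : Finset E) (G \ B : Finset E) ∧
      ∀ j, J ((G ∪ P j) \ (P j).image τ) ∧ ((G ∪ P j) \ (P j).image τ).card = k := by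
  obtain ⟨rk, hsub, hmono, hunit, hind, hbasis⟩ := hJ.exists_rank
  have hle : ∀ S, rk S ≤ k := fun S => by
    obtain ⟨T, -, hT, h⟩ := hbasis S
    rw [h]
    exact_mod_cast hk T hT
  have hcard : ∀ S, rk S ≤ S.card := fun S => by
    obtain ⟨T, hTS, hT, h⟩ := hbasis S
    rw [h]
    exact_mod_cast card_le_card hTS
  have hPsub : ∀ j, P j ⊆ B \ G := fun j => hPB ▸ subset_biUnion_of_mem P (mem_univ j)
  have hfull : ∀ S, G ⊆ S → rk S = k := fun S h => by
    refine le_antisymm (hle S) ?_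
    rw [← hGk, ← (hind G).1 hG]
    exact hmono _ _ h
  have hone : ∀ S e, e ∈ S → rk S ≤ rk (S.erase e) + 1 := fun S e he => by
    have := hunit e (S.erase e)
    rwa [insert_erase he] at this
  -- the rank of what is left of `G`
  have hsum : ∀ (U : Finset E) (s : Finset ι),
      rk (G \ U ∪ s.biUnion P) + ((s.card : ℤ) - 1) * rk (G \ U)
        ≤ ∑ j ∈ s, rk (P j ∪ G \ U) := by
    intro U s
    induction s using Finset.induction_on with
    | empty => simp
    | insert a s ha ih =>
      rw [sum_insert ha, card_insert_of_notMem ha, biUnion_insert]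
      have h := hsub (P a ∪ G \ U) (G \ U ∪ s.biUnion P)
      have h1 : P a ∪ G \ U ∪ (G \ U ∪ s.biUnion P) = G \ U ∪ (P a ∪ s.biUnion P) := by
        ext x; simp only [mem_union]; tauto
      have h2 := hmono (G \ U) ((P a ∪ G \ U) ∩ (G \ U ∪ s.biUnion P))
        (subset_inter subset_union_right subset_union_left)
      rw [h1] at h
      push_cast
      linarith
  -- These are dual rank functions: a part `C` is full for the index `j` exactly if `P j ∪ G \ C`
  -- still has rank `k`. So the partition splits `G \ B` into sets that may be given up in return
  -- for the sets `P j`. The rank condition is `hsum`, since `G \ U` together with `B \ G` contains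
  -- `B`.
  obtain ⟨c, hc⟩ := exists_partition_of_card_le_sum_rank (G \ B)
    (fun j U => (U.card : ℤ) + rk (P j ∪ G \ U) - k)
    (by
      intro j U V
      have h := hsub (P j ∪ G \ U) (P j ∪ G \ V)
      have h1 : P j ∪ G \ U ∪ (P j ∪ G \ V) = P j ∪ G \ (U ∩ V) := by
        ext x; simp only [mem_union, mem_sdiff, mem_inter]; tauto
      have h2 : (P j ∪ G \ U) ∩ (P j ∪ G \ V) = P j ∪ G \ (U ∪ V) := by
        ext x; simp only [mem_union, mem_sdiff, mem_inter]; tauto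
      rw [h1, h2] at h
      have h3 := card_union_add_card_inter U V
      zify at h3
      linarith)
    (by
      intro j e U
      by_cases he : e ∈ U
      · rw [insert_eq_of_mem he]
      · rw [card_insert_of_notMem he]
        have h1 : P j ∪ G \ U ⊆ insert e (P j ∪ G \ insert e U) := by
          intro x
          simp only [mem_union, mem_sdiff, mem_insert]
          tauto
        have h2 := hmono _ _ h1
        have h3 := hunit e (P j ∪ G \ insert e U)
        push_cast
        linarith)
    (by
      intro j e U
      have h1 := card_insert_le e U
      have h2 := hmono (P j ∪ G \ insert e U) (P j ∪ G \ U)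
        (union_subset_union_right (sdiff_subset_sdiff subset_rfl (subset_insert _ _)))
      zify at h1
      linarith)
    (by
      intro j
      simp [hfull (P j ∪ G) subset_union_right])
    (by
      intro U hU
      have hUG : U ⊆ G := hU.trans sdiff_subset
      have h1 := hsum U univ
      rw [hPB] at h1
      have h2 : rk (G \ U) = k - U.card := by
        rw [(hind _).1 (hJ.subset hG sdiff_subset), card_sdiff_of_subset hUG, hGk,
          Nat.cast_sub (hGk ▸ card_le_card hUG)]
      have h3 : rk (G \ U ∪ B \ G) = k := by
        refine le_antisymm (hle _) ?_
        rw [← hBk, ← (hind B).1 hB]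
        refine hmono _ _ fun x hx => ?_
        have : x ∈ U → x ∉ B := fun h => (mem_sdiff.1 (hU h)).2
        simp only [mem_union, mem_sdiff]
        tauto
      rw [h2, h3] at h1
      simp only [sum_sub_distrib, sum_add_distrib, sum_const, nsmul_eq_mul]
      have h4 : ((univ : Finset ι).card : ℤ) * U.card + ((univ : Finset ι).card - 1) * (k - U.card)
          = (univ : Finset ι).card * k - k + U.card := by ring
      linarith)
  set C : ι → Finset E := fun j => (G \ B).filter (c · = j) with hC
  have hCsub : ∀ j, C j ⊆ G \ B := fun j => filter_subset _ _
  have hCdisj : ∀ i j, i ≠ j → Disjoint (C i) (C j) := fun i j hij =>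
    disjoint_filter.2 fun x _ h1 h2 => hij (h1.symm.trans h2)
  have hrank : ∀ j, (k : ℤ) ≤ rk (P j ∪ G \ C j) := fun j => by
    have := hc j
    simp only at this
    linarith
  have hdisj : ∀ j, Disjoint (P j) (G \ C j) := fun j =>
    disjoint_left.2 fun x hx hx' => (mem_sdiff.1 (hPsub j hx)).2 (mem_sdiff.1 hx').1
  have hcardPC : ∀ j, (P j ∪ G \ C j).card = (P j).card + (k - (C j).card) := fun j => by
    rw [card_union_of_disjoint (hdisj j), card_sdiff_of_subset ((hCsub j).trans sdiff_subset), hGk]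
  have hCk : ∀ j, (C j).card ≤ k := fun j => hGk ▸ card_le_card ((hCsub j).trans sdiff_subset)
  -- Rank `k` needs at least `k` elements, so no more is removed than is added. Both families have
  -- the same total size, so equality holds for each part, and a set of `k` elements with rank `k`
  -- is a basis.
  have hCP : ∀ j, (C j).card ≤ (P j).card := fun j => by
    have h1 := hrank j
    have h2 := hcard (P j ∪ G \ C j)
    have h3 := hcardPC j
    have h4 := hCk j
    zify at h3
    push_cast [h4] at h3
    zify
    linarith
  have htotal : ∑ j, (C j).card = ∑ j, (P j).card := by
    rw [← card_biUnion fun i _ j _ hij => hP i j hij, hPB, hC,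
      ← card_eq_sum_card_fiberwise (f := c) (t := univ) (by simp)]
    have h1 := card_sdiff_add_card_inter G B
    have h2 := card_sdiff_add_card_inter B G
    rw [inter_comm B G] at h2
    omega
  have hCPeq : ∀ j, (C j).card = (P j).card := fun j =>
    (sum_eq_sum_iff_of_le fun i _ => hCP i).1 htotal j (mem_univ j)
  have hbij : ∀ j, ∃ g : E → E, Set.BijOn g (P j) (C j) := fun j => by
    obtain ⟨e⟩ : Nonempty (P j ≃ C j) := ⟨Finset.equivOfCardEq (hCPeq j).symm⟩
    refine ⟨fun x => if h : x ∈ P j then (e ⟨x, h⟩ : E) else x, fun x hx => ?_, ?_, ?_⟩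
    · have hx : x ∈ P j := hx
      simp [hx]
    · intro x hx y hy hxy
      have hx : x ∈ P j := hx
      have hy : y ∈ P j := hy
      simp only [hx, hy, dif_pos] at hxy
      simpa using e.injective (Subtype.ext hxy)
    · intro y hy
      refine ⟨e.symm ⟨y, hy⟩, (e.symm ⟨y, hy⟩).2, ?_⟩
      simp
  choose g hg using hbij
  have hmem : ∀ x ∈ B \ G, ∃ j, x ∈ P j := fun x hx => by
    rw [← hPB] at hx
    simpa using hx
  classical
  set τ : E → E := fun x => if h : ∃ j, x ∈ P j then g h.choose x else x with hτ
  have hτg : ∀ j, ∀ x ∈ P j, τ x = g j x := by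
    intro j x hx
    have hex : ∃ j, x ∈ P j := ⟨j, hx⟩
    have : hex.choose = j := by
      by_contra hne
      exact disjoint_left.1 (hP _ _ hne) hex.choose_spec hx
    simp only [hτ, hex, dif_pos]
    rw [this]
  have himage : ∀ j, (P j).image τ = C j := by
    intro j
    rw [image_congr fun x hx => hτg j x hx]
    exact coe_injective (by rw [coe_image, (hg j).image_eq])
  refine ⟨τ, ⟨fun x hx => ?_, ?_, ?_⟩, fun j => ?_⟩
  · obtain ⟨j, hj⟩ := hmem x hx
    rw [hτg j x hj]
    exact hCsub j ((hg j).mapsTo hj)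
  · intro x hx y hy hxy
    obtain ⟨i, hi⟩ := hmem x hx
    obtain ⟨j, hj⟩ := hmem y hy
    rw [hτg i x hi, hτg j y hj] at hxy
    by_cases hij : i = j
    · subst hij
      exact (hg i).injOn hi hj hxy
    · have h1 : g i x ∈ C i := (hg i).mapsTo hi
      have h2 : g j y ∈ C j := (hg j).mapsTo hj
      rw [← hxy] at h2
      exact absurd h2 (disjoint_left.1 (hCdisj i j hij) h1)
  · intro y hy
    have hy : y ∈ G \ B := hy
    have hyC : y ∈ C (c y) := mem_filter.2 ⟨hy, rfl⟩
    obtain ⟨x, hx, hxy⟩ := (hg (c y)).surjOn hyC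
    exact ⟨x, hPsub _ hx, by rw [hτg _ x hx, hxy]⟩
  · have hset : (G ∪ P j) \ (P j).image τ = P j ∪ G \ C j := by
      rw [himage]
      ext x
      have h1 : x ∈ P j → x ∉ C j := fun h h' =>
        (mem_sdiff.1 (hPsub j h)).2 (mem_sdiff.1 (hCsub j h')).1
      simp only [mem_union, mem_sdiff]
      tauto
    have hk' : (P j ∪ G \ C j).card = k := by
      rw [hcardPC, hCPeq]
      have := hCk j
      have := hCPeq j
      omega
    rw [hset]
    refine ⟨(hind _).2 ?_, hk'⟩
    rw [hk']
    exact le_antisymm (hle _) (hrank j)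

end Matroids

/-! ### Feasibility with dummies is a matroid -/

section Extension

variable {α : Type u}

/-- For augmentation, a dummy of `T` outside `S` can always be added. If there is none, `T` has more
proper elements than `S`, and augmentation for `I` applies. -/
theorem IsIndepSystem.extFeasible [DecidableEq α] {I : Finset α → Prop} (hI : IsIndepSystem I)
    (k : ℕ) :
    IsIndepSystem (ExtFeasible (α := α) I k) where
  empty := ⟨by rw [show (∅ : Finset (Ext α k)).toLeft = ∅ by ext; simp]; exact hI.empty, by simp⟩
  subset S T hT hST := ⟨hI.subset hT.1 (toLeft_subset_toLeft hST), (card_le_card hST).trans hT.2⟩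
  augment S T hS hT hlt := by
    by_cases h : T.toRight ⊆ S.toRight
    · have h1 := card_le_card h
      have h2 := S.card_toLeft_add_card_toRight
      have h3 := T.card_toLeft_add_card_toRight
      obtain ⟨e, heT, heS, he⟩ := hI.augment hS.1 hT.1 (by omega)
      refine ⟨Sum.inl e, mem_toLeft.1 heT, fun h => heS (mem_toLeft.2 h), by simpa using he, ?_⟩
      exact (card_insert_le _ _).trans (hlt.trans_le hT.2)
    · obtain ⟨i, hiT, hiS⟩ := not_subset.1 h
      refine ⟨Sum.inr i, mem_toRight.1 hiT, fun h => hiS (mem_toRight.2 h), by simpa using hS.1, ?_⟩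
      exact (card_insert_le _ _).trans (hlt.trans_le hT.2)

theorem isIndepSystem_sizeFeasible [DecidableEq α] (k : ℕ) :
    IsIndepSystem (SizeFeasible (α := α) k) where
  empty := Nat.zero_le _
  subset _ _ hT hST := (card_le_card hST).trans hT
  augment S T hS hT hlt := by
    obtain ⟨e, heT, heS⟩ := exists_mem_notMem_of_card_lt_card hlt
    exact ⟨e, heT, heS, (card_insert_le _ _).trans (hlt.trans_le hT)⟩

theorem isIndepSystem_matroidFeasible [DecidableEq α] (M : Matroid α) :
    IsIndepSystem (MatroidFeasible M) where
  empty := by simp [MatroidFeasible]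
  subset _ _ hT hST := hT.subset (coe_subset.2 hST)
  augment S T hS hT hlt := by
    obtain ⟨e, he, h⟩ := hS.exists_insert_of_encard_lt hT (by simpa using hlt)
    exact ⟨e, he.1, he.2, by simpa [MatroidFeasible] using h⟩

theorem MatroidFeasible.card_le {M : Matroid α} {k : ℕ} (hM : M.eRank = k) {S : Finset α}
    (hS : MatroidFeasible M S) : S.card ≤ k := by
  have h := Matroid.Indep.encard_le_eRank hS
  rw [hM, Set.encard_coe_eq_coe_finsetCard] at h
  exact_mod_cast h

theorem extBasis_pad {I : Finset α → Prop} {k : ℕ} {S : Finset α} (hS : I S) (hk : S.card ≤ k) :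
    ExtBasis I k (pad k S) := by
  refine ⟨by simpa [pad] using hS, ?_⟩
  rw [pad, card_disjSum]
  have h : (univ.filter fun i : Fin (3 * k) => (i : ℕ) < k - S.card).card = k - S.card := by
    rw [Fin.card_filter_val_lt]
    omega
  omega

theorem ExtBasis.feasible {I : Finset α → Prop} {k : ℕ} {S : Finset (Ext α k)}
    (h : ExtBasis I k S) : ExtFeasible I k S := ⟨h.1, h.2.le⟩

end Extension

/-! ### Local search: termination and quality of local optima -/

section LocalSearch

variable {α : Type u} [Fintype α] [DecidableEq α]

/-- The sets whose values are queried in an iteration of the local search. -/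
def swapQueries {k : ℕ} (Z : Finset (Ext α k)) : Finset (Finset α) :=
  insert Z.toLeft ((univ.image fun x : α => insert x Z.toLeft) ∪
    univ.image fun x : α => Z.toLeft.erase x)

theorem card_swapQueries_le {k : ℕ} (Z : Finset (Ext α k)) :
    (swapQueries Z).card ≤ 2 * Fintype.card α + 1 := by
  refine (card_insert_le _ _).trans (Nat.succ_le_succ ((card_union_le _ _).trans ?_))
  rw [two_mul]
  exact Nat.add_le_add (card_image_le.trans_eq card_univ) (card_image_le.trans_eq card_univ)

theorem toLeft_insert_mem_swapQueries {k : ℕ} (Z : Finset (Ext α k)) (e : Ext α k) :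
    (insert e Z).toLeft ∈ swapQueries Z := by
  rcases e with e | e <;> simp [swapQueries]

theorem toLeft_erase_mem_swapQueries {k : ℕ} (Z : Finset (Ext α k)) (a : Ext α k) :
    (Z.erase a).toLeft ∈ swapQueries Z := by
  rcases a with a | a
  · have : (Z.erase (Sum.inl a)).toLeft = Z.toLeft.erase a := by
      ext x; simp
    simp [swapQueries, this]
  · have : (Z.erase (Sum.inr a)).toLeft = Z.toLeft := by
      ext x; simp
    simp [swapQueries, this]

theorem mem_improvingSwaps {I : Finset α → Prop} {k : ℕ} {ε : ℝ} {f : Finset α → ℝ}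
    {Z : Finset (Ext α k)} {p : Ext α k × Ext α k} :
    p ∈ improvingSwaps I k ε Z (QueryProg.answers f (swapQueries Z)) ↔
      p.1 ∈ Z ∧ p.2 ∉ Z ∧ ExtFeasible I k (insert p.2 (Z.erase p.1)) ∧
        ε / k * dummyExt f Z ≤
          marg (dummyExt f) Z p.2 - (dummyExt f Z - dummyExt f (Z.erase p.1)) := by
  have hZ : Z.toLeft ∈ swapQueries Z := mem_insert_self _ _
  simp only [improvingSwaps, mem_filter, mem_univ, true_and, marg, dummyExt]
  rw [QueryProg.answers_of_mem f hZ,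
    QueryProg.answers_of_mem f (toLeft_insert_mem_swapQueries Z p.2),
    QueryProg.answers_of_mem f (toLeft_erase_mem_swapQueries Z p.1)]

/-- `Z` is a basis which the local search does not improve any more. -/
def IsLocalOpt (I : Finset α → Prop) (k : ℕ) (ε : ℝ) (f : Finset α → ℝ)
    (Z : Finset (Ext α k)) : Prop :=
  ExtBasis I k Z ∧ improvingSwaps I k ε Z (QueryProg.answers f (swapQueries Z)) = ∅

/-- The improvement test uses the gain of `e` to `Z`. The true change of value involves its gain to
`Z - a`, which is at least as large by submodularity, so each accepted swap gains the factor 1 +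
ε/k. -/
theorem ExtBasis.swap {I : Finset α → Prop} {k : ℕ} {ε : ℝ} {f : Finset α → ℝ}
    (hf : IsSubmodular f) {Z : Finset (Ext α k)} (hZ : ExtBasis I k Z) {p : Ext α k × Ext α k}
    (hp : p ∈ improvingSwaps I k ε Z (QueryProg.answers f (swapQueries Z))) :
    ExtBasis I k (insert p.2 (Z.erase p.1)) ∧
      (1 + ε / k) * dummyExt f Z ≤ dummyExt f (insert p.2 (Z.erase p.1)) := by
  obtain ⟨h1, h2, h3, h4⟩ := mem_improvingSwaps.1 hp
  refine ⟨⟨h3.1, ?_⟩, ?_⟩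
  · rw [card_insert_of_notMem fun h => h2 (mem_of_mem_erase h), card_erase_of_mem h1, hZ.2]
    have := card_pos.2 ⟨_, h1⟩
    rw [hZ.2] at this
    omega
  · have := hf.dummyExt.marg_anti (erase_subset p.1 Z) h2
    simp only [marg] at this h4
    linarith

/-- The hypothesis `hN` says that `N` further improvements would push the value above the maximum
`V`. Each swap uses up one factor 1 + ε/k, so the search must stop before the cap. -/
theorem fastLS_terminates {I : Finset α → Prop} {k : ℕ} {ε : ℝ} {f : Finset α → ℝ}
    (hf : IsSubmodular f) (hε : 0 ≤ ε) {swap : Finset (Ext α k × Ext α k) → Ext α k × Ext α k}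
    (hswap : IsChoice swap) {V : ℝ} (hV : ∀ S, I S → f S ≤ V) (N : ℕ) (Z : Finset (Ext α k))
    (hZ : ExtBasis I k Z) (hN : V < (1 + ε / k) ^ N * dummyExt f Z) :
    ∃ Z', (fastLS I k ε swap N Z).run f = some Z' ∧ IsLocalOpt I k ε f Z' ∧
      (fastLS I k ε swap N Z).queries f ≤ N * (2 * Fintype.card α + 1) := by
  induction N generalizing Z with
  | zero =>
    have := hV _ hZ.1
    rw [pow_zero, one_mul] at hN
    exact absurd this (not_le.2 hN)
  | succ N ih =>
    change ∃ Z', QueryProg.run f (QueryProg.ask (swapQueries Z) _) = some Z' ∧ _ ∧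
      QueryProg.queries f (QueryProg.ask (swapQueries Z) _) ≤ _
    rw [QueryProg.run_ask, QueryProg.queries_ask]
    have hcard := card_swapQueries_le Z
    by_cases hne : (improvingSwaps I k ε Z (QueryProg.answers f (swapQueries Z))).Nonempty
    · rw [if_pos hne]
      obtain ⟨hb, hval⟩ := hZ.swap hf (hswap _ hne)
      obtain ⟨Z', h1, h2, h3⟩ := ih _ hb (by
        refine hN.trans_le ?_
        rw [pow_succ, mul_assoc]
        exact mul_le_mul_of_nonneg_left hval (by positivity))
      exact ⟨Z', h1, h2, by linarith [Nat.succ_mul N (2 * Fintype.card α + 1)]⟩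
    · rw [if_neg hne]
      refine ⟨Z, rfl, ⟨hZ, not_nonempty_iff_eq_empty.1 hne⟩, ?_⟩
      rw [QueryProg.queries_ret]
      linarith [Nat.succ_mul N (2 * Fintype.card α + 1), Nat.zero_le (N * (2 * Fintype.card α + 1))]

/-- Exchange `B`, the padded `X`, against `Z`: each `e ∈ B \ Z` may replace its own `τ e ∈ Z \ B`,
and no such swap is improving. Summed up, the gains bound f(Z ∪ X) - f(Z) from above, the losses add
up to at most f(Z) - f(Z ∩ X), and the at most `k` thresholds total at most ε f(Z). -/
theorem IsLocalOpt.value_union_add_inter_le {I : Finset α → Prop} (hI : IsIndepSystem I) {k : ℕ}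
    (hk : 0 < k) (hIk : ∀ S, I S → S.card ≤ k) {ε : ℝ} (hε : 0 ≤ ε) {f : Finset α → ℝ}
    (hf0 : ∀ S, 0 ≤ f S) (hf : IsSubmodular f) {Z : Finset (Ext α k)}
    (hZ : IsLocalOpt I k ε f Z) {X : Finset α} (hX : I X) :
    f (Z.toLeft ∪ X) + f (Z.toLeft ∩ X) ≤ (2 + ε) * f Z.toLeft := by
  set B := pad k X with hB
  have hBb : ExtBasis I k B := extBasis_pad hX (hIk X hX)
  have hBX : B.toLeft = X := by simp [hB, pad]
  have hF := hf.dummyExt (k := k)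
  have : Nonempty (Ext α k) := ⟨Sum.inr ⟨0, by omega⟩⟩
  -- Multiple exchange for the partition of `B \ Z` into singletons, indexed by all elements with
  -- empty parts outside `B \ Z`.
  obtain ⟨τ, hτ, hexch⟩ := (hI.extFeasible k).exists_multiple_exchange (k := k) (fun S hS => hS.2)
    hZ.1.feasible hBb.feasible hZ.1.2 hBb.2 (fun e => if e ∈ B \ Z then {e} else ∅)
    (by
      intro i j hij
      by_cases hi : i ∈ B \ Z
      · by_cases hj : j ∈ B \ Z
        · simpa [hi, hj] using hij
        · simp only [hj, if_false, disjoint_empty_right]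
      · simp only [hi, if_false, disjoint_empty_left])
    (by ext x; simp only [mem_biUnion, mem_univ, true_and]
        constructor
        · rintro ⟨e, he⟩
          split_ifs at he with h
          · rwa [mem_singleton.1 he]
          · simp at he
        · intro h
          exact ⟨x, by rw [if_pos h]; exact mem_singleton_self x⟩)
  have hstep : ∀ e ∈ B \ Z, marg (dummyExt f) Z e ≤
      (dummyExt f Z - dummyExt f (Z.erase (τ e))) + ε / k * dummyExt f Z := by
    intro e he
    have h1 := (hexch e).1
    rw [if_pos he, image_singleton] at h1
    have hτe : τ e ∈ Z := (mem_sdiff.1 (hτ.mapsTo he)).1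
    have heZ : e ∉ Z := (mem_sdiff.1 he).2
    have hset : (Z ∪ {e}) \ {τ e} = insert e (Z.erase (τ e)) := by
      ext x
      simp only [mem_sdiff, mem_union, mem_singleton, mem_insert, mem_erase]
      constructor
      · tauto
      · rintro (rfl | h)
        · exact ⟨Or.inr rfl, fun h => heZ (h ▸ hτe)⟩
        · tauto
    rw [hset] at h1
    by_contra! hcon
    have hmem : (τ e, e) ∈ improvingSwaps I k ε Z (QueryProg.answers f (swapQueries Z)) :=
      mem_improvingSwaps.2 ⟨hτe, heZ, h1, by simp only; linarith⟩
    rw [hZ.2] at hmem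
    exact notMem_empty _ hmem
  have hsum := sum_le_sum hstep
  rw [sum_add_distrib, sum_const, nsmul_eq_mul] at hsum
  have h1 := hF.sub_le_sum_marg Z (B \ Z)
  rw [sdiff_union_self_eq_union] at h1
  have h2 : ∑ e ∈ B \ Z, (dummyExt f Z - dummyExt f (Z.erase (τ e)))
      = ∑ a ∈ Z \ B, (dummyExt f Z - dummyExt f (Z.erase a)) :=
    sum_nbij τ (fun e he => hτ.mapsTo he) hτ.injOn hτ.surjOn fun _ _ => rfl
  have h3 := hF.sum_erase_le Z (Z \ B) sdiff_subset
  rw [sdiff_sdiff_right_self, inf_eq_inter] at h3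
  have h4 : ((B \ Z).card : ℝ) * (ε / k * dummyExt f Z) ≤ ε * dummyExt f Z := by
    have hkR : (0 : ℝ) < k := by exact_mod_cast hk
    have hc : ((B \ Z).card : ℝ) ≤ k := by
      exact_mod_cast hBb.2 ▸ card_le_card (sdiff_subset (s := B) (t := Z))
    have h0 : 0 ≤ ε / k * dummyExt f Z := mul_nonneg (by positivity) (hf0 _)
    calc ((B \ Z).card : ℝ) * (ε / k * dummyExt f Z) ≤ k * (ε / k * dummyExt f Z) :=
          mul_le_mul_of_nonneg_right hc h0
      _ = ε * dummyExt f Z := by field_simp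
  have h5 : dummyExt f (B ∪ Z) = f (Z.toLeft ∪ X) := by
    rw [dummyExt, toLeft_union, hBX, union_comm]
  have h6 : dummyExt f (Z ∩ B) = f (Z.toLeft ∩ X) := by
    rw [dummyExt, toLeft_inter, hBX]
  have h7 : dummyExt f Z = f Z.toLeft := rfl
  rw [← h5, ← h6, ← h7]
  linarith

/-- The subset Z ∩ X of Z is feasible as well, and its union with Z is Z. -/
theorem IsLocalOpt.value_inter_le {I : Finset α → Prop} (hI : IsIndepSystem I) {k : ℕ}
    (hk : 0 < k) (hIk : ∀ S, I S → S.card ≤ k) {ε : ℝ} (hε : 0 ≤ ε) {f : Finset α → ℝ}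
    (hf0 : ∀ S, 0 ≤ f S) (hf : IsSubmodular f) {Z : Finset (Ext α k)}
    (hZ : IsLocalOpt I k ε f Z) (X : Finset α) :
    f (Z.toLeft ∩ X) ≤ (1 + ε) * f Z.toLeft := by
  have h := hZ.value_union_add_inter_le hI hk hIk hε hf0 hf
    (hI.subset hZ.1.1 (inter_subset_left (s₂ := X)))
  rw [union_eq_left.2 inter_subset_left, ← inter_assoc, inter_self] at h
  linarith

end LocalSearch

/-! ### Guided interlaced greedy for the size constraint -/

section Interlace

variable {α : Type u} [Fintype α] [DecidableEq α]

/-- Every set of a family gets `c` new elements, outside of `Z` and of all sets of the family. -/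
def Grows {E : Type u} [DecidableEq E] {ℓ : ℕ} (Z : Finset E) (c : ℕ) (A A' : Fin ℓ → Finset E) :
    Prop :=
  ∃ D : Fin ℓ → Finset E, (∀ l, A' l = A l ∪ D l) ∧ (∀ i j, i ≠ j → Disjoint (D i) (D j)) ∧
    (∀ l, Disjoint (D l) Z) ∧ (∀ l l', Disjoint (D l) (A l')) ∧ ∀ l, (D l).card = c

theorem Grows.refl {E : Type u} [DecidableEq E] {ℓ : ℕ} (Z : Finset E) (A : Fin ℓ → Finset E) :
    Grows Z 0 A A :=
  ⟨fun _ => ∅, by simp, by simp, by simp, by simp, by simp⟩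

theorem Grows.trans {E : Type u} [DecidableEq E] {ℓ : ℕ} {Z : Finset E} {c d : ℕ}
    {A B C : Fin ℓ → Finset E} (h1 : Grows Z c A B) (h2 : Grows Z d B C) : Grows Z (c + d) A C := by
  obtain ⟨D, hD, hDD, hDZ, hDA, hDc⟩ := h1
  obtain ⟨D', hD', hDD', hDZ', hDA', hDc'⟩ := h2
  have hDA'' : ∀ l l', Disjoint (D' l) (A l') ∧ Disjoint (D' l) (D l') := fun l l' => by
    have := hDA' l l'
    rwa [hD, disjoint_union_right] at this
  refine ⟨fun l => D l ∪ D' l, fun l => by rw [hD', hD, union_assoc], fun i j hij => ?_,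
    fun l => disjoint_union_left.2 ⟨hDZ l, hDZ' l⟩,
    fun l l' => disjoint_union_left.2 ⟨hDA l l', (hDA'' l l').1⟩, fun l => ?_⟩
  · simp only [disjoint_union_left, disjoint_union_right]
    exact ⟨⟨hDD i j hij, (hDA'' i j).2⟩, (hDA'' j i).2.symm, hDD' i j hij⟩
  · rw [card_union_of_disjoint (hDA'' l l).2.symm, hDc, hDc']

variable {k ℓ : ℕ} (f : Finset α → ℝ) (Z : Finset (Ext α k))
  (argmax : Finset (Ext α k) → (Ext α k → ℝ) → Ext α k)

theorem run_interlaceStep (A : Fin ℓ → Finset (Ext α k)) (i : Fin ℓ) :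
    (interlaceStep Z argmax A i).run f = Function.update A i
      (insert (argmax ((univ \ Z) \ univ.biUnion A) (marg (dummyExt f) (A i))) (A i)) := by
  simp [interlaceStep, run_gains]

theorem queries_interlaceStep_le (A : Fin ℓ → Finset (Ext α k)) (i : Fin ℓ) :
    (interlaceStep Z argmax A i).queries f ≤ Fintype.card α + 1 := by
  simpa [interlaceStep] using queries_gains_le f (A i)

theorem queries_interlaceRounds_le (m : ℕ) (A : Fin ℓ → Finset (Ext α k)) :
    (interlaceRounds Z argmax m A).queries f ≤ m * (ℓ * (Fintype.card α + 1)) := by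
  induction m generalizing A with
  | zero => simp [interlaceRounds]
  | succ m ih =>
    simp only [interlaceRounds, QueryProg.queries_bind]
    have h1 := QueryProg.queries_foldlM_le f (interlaceStep Z argmax) _
      (queries_interlaceStep_le f Z argmax) (List.finRange ℓ) A
    have h2 := ih (((List.finRange ℓ).foldlM (interlaceStep Z argmax) A).run f)
    rw [List.length_finRange] at h1
    linarith [Nat.succ_mul m (ℓ * (Fintype.card α + 1))]

variable {argmax}

/-- One round, with the list of sets still to be served generalized for the induction. The last
clause compares only with elements outside all final sets of the round: these were available at each
step, so every set preferred its own new element to them. The cardinality hypothesis leaves a dummy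
available at each step, whence the gains are nonnegative. -/
theorem interlace_sweep (hmax : IsArgmax argmax) (L : List (Fin ℓ)) (hL : L.Nodup)
    (A : Fin ℓ → Finset (Ext α k)) (hcard : Z.card + (univ.biUnion A).card + L.length ≤ 3 * k) :
    ∃ (A' : Fin ℓ → Finset (Ext α k)) (x : Fin ℓ → Ext α k),
      (L.foldlM (interlaceStep Z argmax) A).run f = A' ∧
      (∀ l ∈ L, A' l = insert (x l) (A l)) ∧ (∀ l, l ∉ L → A' l = A l) ∧
      (∀ l ∈ L, x l ∉ Z ∧ ∀ l', x l ∉ A l') ∧ (∀ l ∈ L, ∀ l' ∈ L, x l = x l' → l = l') ∧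
      (∀ l ∈ L, 0 ≤ marg (dummyExt f) (A l) (x l)) ∧
      ∀ l ∈ L, ∀ o, o ∉ Z → (∀ l', o ∉ A' l') →
        marg (dummyExt f) (A l) o ≤ marg (dummyExt f) (A l) (x l) := by
  induction L generalizing A with
  | nil => exact ⟨A, fun l => argmax ∅ 0, rfl, by simp, by simp, by simp, by simp, by simp, by simp⟩
  | cons i L ih =>
    obtain ⟨hiL, hL⟩ := List.nodup_cons.1 hL
    rw [List.length_cons] at hcard
    rw [List.foldlM_cons, QueryProg.run_bind, run_interlaceStep]
    set avail := (univ \ Z) \ univ.biUnion A with havail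
    have hav : ∀ o, o ∈ avail ↔ o ∉ Z ∧ ∀ l, o ∉ A l := fun o => by simp [havail]
    obtain ⟨d, hd⟩ := exists_dummy (Z ∪ univ.biUnion A)
      ((card_union_le _ _).trans_lt (by omega))
    have hdav : Sum.inr d ∈ avail := by
      rw [hav]
      simpa using hd
    obtain ⟨hxav, hxmax⟩ := hmax avail (marg (dummyExt f) (A i)) ⟨_, hdav⟩
    set xi := argmax avail (marg (dummyExt f) (A i)) with hxi
    obtain ⟨hxZ, hxA⟩ := (hav xi).1 hxav
    set A1 := Function.update A i (insert xi (A i)) with hA1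
    have hA1i : A1 i = insert xi (A i) := by simp [hA1]
    have hA1l : ∀ l, l ≠ i → A1 l = A l := fun l hl => by simp [hA1, hl]
    have hsub : ∀ l, A l ⊆ A1 l := fun l => by
      by_cases hl : l = i
      · subst hl; rw [hA1i]; exact subset_insert _ _
      · rw [hA1l l hl]
    have hunion : univ.biUnion A1 ⊆ insert xi (univ.biUnion A) := by
      intro o ho
      obtain ⟨l, -, hol⟩ := mem_biUnion.1 ho
      by_cases hl : l = i
      · subst hl
        rw [hA1i] at hol
        rcases mem_insert.1 hol with h | h
        · exact mem_insert.2 (Or.inl h)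
        · exact mem_insert_of_mem (mem_biUnion.2 ⟨l, mem_univ _, h⟩)
      · rw [hA1l l hl] at hol
        exact mem_insert_of_mem (mem_biUnion.2 ⟨l, mem_univ _, hol⟩)
    have hc1 := (card_le_card hunion).trans (card_insert_le _ _)
    obtain ⟨A', x, hrun, h1, h2, h3, h4, h5, h6⟩ := ih hL A1 (by omega)
    have hne : ∀ l ∈ L, l ≠ i := fun l hl h => hiL (h ▸ hl)
    have hsub' : ∀ l, A l ⊆ A' l := fun l => by
      refine (hsub l).trans ?_
      by_cases hl : l ∈ L
      · rw [h1 l hl]; exact subset_insert _ _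
      · rw [h2 l hl]
    have hself : Function.update x i xi i = xi := Function.update_self ..
    have hother : ∀ l ∈ L, Function.update x i xi l = x l := fun l hl =>
      Function.update_of_ne (hne l hl) ..
    refine ⟨A', Function.update x i xi, hrun, ?_, ?_, ?_, ?_, ?_, ?_⟩
    · intro l hl
      rcases List.mem_cons.1 hl with rfl | hl
      · rw [h2 l hiL, hA1i, hself]
      · rw [hother l hl, h1 l hl, hA1l l (hne l hl)]
    · intro l hl
      rw [List.mem_cons, not_or] at hl
      rw [h2 l hl.2, hA1l l hl.1]
    · intro l hl
      rcases List.mem_cons.1 hl with rfl | hl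
      · rw [hself]
        exact ⟨hxZ, hxA⟩
      · rw [hother l hl]
        exact ⟨(h3 l hl).1, fun l' h => (h3 l hl).2 l' (hsub l' h)⟩
    · have hxne : ∀ l ∈ L, x l ≠ xi := fun l hl h => (h3 l hl).2 i (by
        rw [h, hA1i]; exact mem_insert_self _ _)
      intro l hl l' hl' heq
      rcases List.mem_cons.1 hl with h | h <;> rcases List.mem_cons.1 hl' with h' | h'
      · rw [h, h']
      · rw [h, hself, hother l' h'] at heq
        exact absurd heq.symm (hxne l' h')
      · rw [h', hself, hother l h] at heq
        exact absurd heq (hxne l h)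
      · rw [hother l h, hother l' h'] at heq
        exact h4 l h l' h' heq
    · intro l hl
      rcases List.mem_cons.1 hl with rfl | hl
      · rw [hself]
        exact (marg_dummy f (A l) d).symm.le.trans (hxmax _ hdav)
      · rw [hother l hl, ← hA1l l (hne l hl)]
        exact h5 l hl
    · intro l hl o hoZ hoA
      rcases List.mem_cons.1 hl with rfl | hl
      · rw [hself]
        exact hxmax o ((hav o).2 ⟨hoZ, fun l' h => hoA l' (hsub' l' h)⟩)
      · rw [hother l hl, ← hA1l l (hne l hl)]
        exact h6 l hl o hoZ hoA

/-- `R` is cut into batches of at most ℓ elements, so that what a round picks from `R` lies in the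
batches up to its own. Each batch is charged to the round before: its elements were then still
available to every set, so each gains at most as much as the element chosen there. The first batch
`D` has no earlier round and stays uncharged; hence m + 1 batches for m rounds. -/
theorem interlaceRounds_spec (hf : IsSubmodular f) (hmax : IsArgmax argmax) (m : ℕ)
    (A : Fin ℓ → Finset (Ext α k)) (hcard : Z.card + (univ.biUnion A).card + m * ℓ ≤ 3 * k) :
    ∃ A' : Fin ℓ → Finset (Ext α k), (interlaceRounds Z argmax m A).run f = A' ∧
      Grows Z m A A' ∧
      ∀ R : Finset (Ext α k), (∀ o ∈ R, o ∉ Z ∧ ∀ l, o ∉ A l) → R.card ≤ ℓ * (m + 1) →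
        ∃ D ⊆ R, D.card ≤ ℓ ∧ ∀ l, ∑ o ∈ R \ D, marg (dummyExt f) (A' l) o ≤
          ℓ * (dummyExt f (A' l) - dummyExt f (A l)) := by
  induction m generalizing A with
  | zero =>
    refine ⟨A, rfl, Grows.refl Z A, fun R _ hR => ⟨R, subset_rfl, by simpa using hR, fun l => ?_⟩⟩
    simp
  | succ m ih =>
    simp only [interlaceRounds, QueryProg.run_bind]
    obtain ⟨B, x, hrun, h1, -, h3, h4, h5, h6⟩ :=
      interlace_sweep f Z hmax (List.finRange ℓ) (List.nodup_finRange ℓ) A (by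
        rw [List.length_finRange]
        linarith [Nat.succ_mul m ℓ, Nat.zero_le (m * ℓ)])
    simp only [List.mem_finRange, forall_const] at h1 h3 h4 h5 h6
    rw [hrun]
    have hunion : univ.biUnion B = univ.biUnion A ∪ univ.image x := by
      ext o
      simp only [mem_biUnion, mem_univ, true_and, mem_union, mem_image, h1, mem_insert]
      constructor
      · rintro ⟨l, rfl | h⟩
        · exact Or.inr ⟨l, rfl⟩
        · exact Or.inl ⟨l, h⟩
      · rintro (⟨l, h⟩ | ⟨l, rfl⟩)
        · exact ⟨l, Or.inr h⟩
        · exact ⟨l, Or.inl rfl⟩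
    have hximg : (univ.image x).card ≤ ℓ := card_image_le.trans_eq (by simp)
    have hcB : (univ.biUnion B).card ≤ (univ.biUnion A).card + ℓ := by
      rw [hunion]
      exact (card_union_le _ _).trans (by omega)
    obtain ⟨A', hrun', hgrow, hR⟩ := ih B (by linarith [Nat.succ_mul m ℓ])
    have hgrow1 : Grows Z 1 A B := by
      refine ⟨fun l => {x l}, fun l => ?_, fun i j hij => ?_, fun l => ?_, fun l l' => ?_,
        fun l => card_singleton _⟩
      · rw [h1, insert_eq, union_comm]
      · rw [disjoint_singleton]
        exact fun h => hij (h4 i j h)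
      · exact disjoint_singleton_left.2 (h3 l).1
      · exact disjoint_singleton_left.2 ((h3 l).2 l')
    refine ⟨A', hrun', (Nat.add_comm 1 m) ▸ hgrow1.trans hgrow, fun R hRA hRc => ?_⟩
    have hBA' : ∀ l, A l ⊆ A' l := fun l => by
      obtain ⟨D, hD, -⟩ := hgrow1.trans hgrow
      rw [hD]
      exact subset_union_left
    have hT : (R ∩ univ.image x).card ≤ min ℓ R.card :=
      le_min ((card_le_card inter_subset_right).trans hximg) (card_le_card inter_subset_left)
    -- The batch contains all elements of `R` picked in this round, and is filled up to ℓ elements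
    -- where possible so that the rest fits into the remaining batches.
    obtain ⟨D, hTD, hDR, hDc⟩ :=
      exists_subsuperset_card_eq (inter_subset_left (s₁ := R)) hT (min_le_right _ _)
    have hR1 : ∀ o ∈ R \ D, o ∉ Z ∧ ∀ l, o ∉ B l := by
      intro o ho
      obtain ⟨hoR, hoD⟩ := mem_sdiff.1 ho
      refine ⟨(hRA o hoR).1, fun l hl => ?_⟩
      rw [h1] at hl
      rcases mem_insert.1 hl with rfl | hl
      · exact hoD (hTD (mem_inter.2 ⟨hoR, mem_image_of_mem _ (mem_univ _)⟩))
      · exact (hRA o hoR).2 l hl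
    have hc1 : (R \ D).card ≤ ℓ * (m + 1) := by
      rw [card_sdiff_of_subset hDR, hDc]
      have : ℓ * (m + 1 + 1) = ℓ * (m + 1) + ℓ := by ring
      omega
    obtain ⟨D1, hD1, hD1c, hsum⟩ := hR (R \ D) hR1 hc1
    refine ⟨D, hDR, hDc ▸ min_le_left _ _, fun l => ?_⟩
    rw [← sum_sdiff hD1]
    have hgain : dummyExt f (B l) - dummyExt f (A l) = marg (dummyExt f) (A l) (x l) := by
      rw [h1]; rfl
    -- The next batch avoids the sets after this round and is charged to it. Its elements may enter
    -- a set later; then their gain is 0, which the nonnegative gain of `x l` still covers.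
    have hD1sum : ∑ o ∈ D1, marg (dummyExt f) (A' l) o ≤ ℓ * marg (dummyExt f) (A l) (x l) := by
      have : ∀ o ∈ D1, marg (dummyExt f) (A' l) o ≤ marg (dummyExt f) (A l) (x l) := fun o ho =>
        hf.dummyExt.marg_le_of_nonneg (hBA' l) (h5 l)
          (h6 l o (hR1 o (hD1 ho)).1 (hR1 o (hD1 ho)).2)
      refine (sum_le_card_nsmul _ _ _ this).trans ?_
      rw [nsmul_eq_mul]
      exact mul_le_mul_of_nonneg_right (by exact_mod_cast hD1c) (h5 l)
    have := hsum l
    rw [← hgain] at hD1sum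
    linarith

variable {top : Finset (Ext α k) → (Ext α k → ℝ) → Fin ℓ → Ext α k}

theorem queries_guidedIGS_le (argmax : Finset (Ext α k) → (Ext α k → ℝ) → Ext α k)
    (top : Finset (Ext α k) → (Ext α k → ℝ) → Fin ℓ → Ext α k) (Z G : Finset (Ext α k))
    (c : Option (Fin ℓ) × Fin ℓ) :
    (guidedIGS k ℓ top argmax Z G c).queries f ≤ (k + 1) * (Fintype.card α + 1) := by
  simp only [guidedIGS, QueryProg.queries_bind, QueryProg.queries_pure, add_zero]
  have h1 := queries_gains_le f G
  have h2 := queries_interlaceRounds_le f Z argmax (k / ℓ - 1)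
    (fun l => insert (top (univ \ (G ∪ Z)) ((gains G).run f) (c.1.getD l)) G)
  have h3 : (k / ℓ - 1) * ℓ ≤ k := (Nat.mul_le_mul_right _ (Nat.sub_le _ _)).trans
    (Nat.div_mul_le_self k ℓ)
  have h4 := Nat.mul_le_mul_right (Fintype.card α + 1) h3
  have h5 : (k / ℓ - 1) * ℓ * (Fintype.card α + 1)
    = (k / ℓ - 1) * (ℓ * (Fintype.card α + 1)) := by ring
  linarith [Nat.succ_mul k (Fintype.card α + 1)]

/-- The top gains are nonnegative because |G ∪ Z| + ℓ - 1 < 3k. So some dummy lies outside `G ∪ Z`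
and the other top elements: it is either `a l` or beaten by `a l`. -/
theorem top_spec (hℓk : ℓ ≤ k) (htop : IsTop ℓ top) {G : Finset (Ext α k)}
    (hZ : Z.card ≤ k) (hG : G.card ≤ k) :
    ∃ a : Fin ℓ → Ext α k, top (univ \ (G ∪ Z)) (marg (dummyExt f) G) = a ∧
      Function.Injective a ∧ (∀ l, a l ∉ G ∪ Z) ∧ (∀ l, 0 ≤ marg (dummyExt f) G (a l)) ∧
      ∀ x, x ∉ G ∪ Z → (∀ l, a l ≠ x) →
        ∀ l, marg (dummyExt f) G x ≤ marg (dummyExt f) G (a l) := by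
  have hGZ : (G ∪ Z).card ≤ 2 * k := (card_union_le _ _).trans (by omega)
  obtain ⟨h1, h2, h3⟩ := htop (univ \ (G ∪ Z)) (marg (dummyExt f) G) (by
    rw [card_sdiff_of_subset (subset_univ _), card_univ]
    simp only [Fintype.card_sum, Fintype.card_fin]
    omega)
  have h2 : ∀ l, top (univ \ (G ∪ Z)) (marg (dummyExt f) G) l ∉ G ∪ Z := fun l =>
    (mem_sdiff.1 (h2 l)).2
  have h3 := fun x (hx : x ∉ G ∪ Z) => h3 x (mem_sdiff.2 ⟨mem_univ _, hx⟩)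
  refine ⟨_, rfl, h1, h2, fun l => ?_, h3⟩
  set a := top (univ \ (G ∪ Z)) (marg (dummyExt f) G) with ha
  -- a dummy that is `a l` itself or none of the top elements
  obtain ⟨d, hd⟩ := exists_dummy ((G ∪ Z) ∪ (univ.image a).erase (a l)) (by
    refine (card_union_le _ _).trans_lt ?_
    rw [card_erase_of_mem (mem_image_of_mem _ (mem_univ _))]
    have : (univ.image a).card ≤ ℓ := card_image_le.trans_eq (by simp)
    have := l.pos
    omega)
  rw [mem_union, not_or] at hd
  by_cases hdl : a l = Sum.inr d
  · rw [hdl, marg_dummy]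
  · rw [← marg_dummy f G d]
    refine h3 _ hd.1 (fun l' hl' => hd.2 (mem_erase.2 ⟨fun h => hdl h.symm, ?_⟩)) l
    exact mem_image.2 ⟨l', mem_univ _, hl'⟩

theorem guidedIGS_branch (hf : IsSubmodular f) (hk : 0 < k) (hℓ : 0 < ℓ) (hℓk : ℓ ∣ k)
    (hmax : IsArgmax argmax) {G : Finset (Ext α k)} (hZ : Z.card ≤ k) (hG : G.card ≤ k)
    (u : Option (Fin ℓ)) :
    ∃ (a b : Fin ℓ → Ext α k) (B : Fin ℓ → Finset (Ext α k)),
      top (univ \ (G ∪ Z)) (marg (dummyExt f) G) = a ∧ (∀ l, b l = a (u.getD l)) ∧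
      (∀ l, (guidedIGS k ℓ top argmax Z G (u, l)).run f = B l) ∧
      Grows Z (k / ℓ - 1) (fun l => insert (b l) G) B ∧
      ∀ R : Finset (Ext α k), (∀ o ∈ R, o ∉ G ∪ Z ∧ ∀ l, o ≠ b l) → R.card ≤ k →
        ∃ D ⊆ R, D.card ≤ ℓ ∧ ∀ l, ∑ o ∈ R \ D, marg (dummyExt f) (B l) o ≤
          ℓ * (dummyExt f (B l) - dummyExt f (insert (b l) G)) := by
  set a := top (univ \ (G ∪ Z)) (marg (dummyExt f) G) with ha
  -- The starting element counts as a round: k/ℓ batches of ℓ elements exhaust any set of at most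
  -- `k` elements.
  have hkl : (k / ℓ - 1 + 1) * ℓ = k := by
    rw [Nat.sub_add_cancel (Nat.div_pos (Nat.le_of_dvd hk hℓk) hℓ), Nat.div_mul_cancel hℓk]
  obtain ⟨B, hrun, hgrow, hR⟩ := interlaceRounds_spec f Z hf hmax (k / ℓ - 1)
    (fun l => insert (a (u.getD l)) G) (by
      have h1 : univ.biUnion (fun l => insert (a (u.getD l)) G)
          ⊆ G ∪ univ.image fun l => a (u.getD l) := by
        intro x hx
        obtain ⟨l, -, hxl⟩ := mem_biUnion.1 hx
        rcases mem_insert.1 hxl with rfl | h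
        · exact mem_union_right _ (mem_image.2 ⟨l, mem_univ _, rfl⟩)
        · exact mem_union_left _ h
      have h2 := (card_le_card h1).trans (card_union_le _ _)
      have h3 : (univ.image fun l : Fin ℓ => a (u.getD l)).card ≤ ℓ :=
        card_image_le.trans_eq (by simp)
      have h4 := Nat.succ_mul (k / ℓ - 1) ℓ
      simp only [Nat.succ_eq_add_one] at h4
      omega)
  refine ⟨a, fun l => a (u.getD l), B, rfl, fun _ => rfl, fun l => ?_, hgrow, fun R hRa hRc => ?_⟩
  · simp only [guidedIGS, QueryProg.run_bind, run_gains, QueryProg.run_pure]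
    rw [← ha, hrun]
  · refine hR R (fun o ho => ?_) (by rw [mul_comm, hkl]; exact hRc)
    obtain ⟨h1, h2⟩ := hRa o ho
    rw [mem_union, not_or] at h1
    exact ⟨h1.2, fun l hl => (mem_insert.1 hl).elim (h2 l) h1.1⟩

theorem guidedIGS_card_disjoint (hf : IsSubmodular f) (hk : 0 < k) (hℓ : 0 < ℓ) (hℓk : ℓ ∣ k)
    (htop : IsTop ℓ top) (hmax : IsArgmax argmax) {G : Finset (Ext α k)} (hZ : Z.card ≤ k)
    (hG : G.card ≤ k) (c : Option (Fin ℓ) × Fin ℓ) :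
    ((guidedIGS k ℓ top argmax Z G c).run f).card = G.card + k / ℓ ∧
      (Disjoint G Z → Disjoint ((guidedIGS k ℓ top argmax Z G c).run f) Z) := by
  obtain ⟨u, l⟩ := c
  obtain ⟨a, b, B, ha, hb, hrun, ⟨D, hD, -, hDZ, hDA, hDc⟩, -⟩ :=
    guidedIGS_branch (top := top) f Z hf hk hℓ hℓk hmax hZ hG u
  obtain ⟨a', ha', -, haGZ, -⟩ := top_spec f Z (Nat.le_of_dvd hk hℓk) htop hZ hG
  obtain rfl : a = a' := ha.symm.trans ha'
  have hbl : b l ∉ G ∪ Z := hb l ▸ haGZ _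
  rw [mem_union, not_or] at hbl
  rw [hrun, hD]
  constructor
  · rw [card_union_of_disjoint (hDA l l).symm, card_insert_of_notMem hbl.1, hDc]
    have := Nat.div_pos (Nat.le_of_dvd hk hℓk) hℓ
    omega
  · intro hGZ
    rw [disjoint_union_left, disjoint_insert_left]
    exact ⟨⟨hbl.2, hGZ⟩, hDZ l⟩

/-- In a suitable branch, the candidates of guided interlaced greedy gain on average enough to
account for adding `O \ Z`, and they spread well over the ground set outside of `O \ Z`. -/
theorem exists_guidedIGS_branch (hf0 : ∀ S, 0 ≤ f S) (hf : IsSubmodular f) (hk : 0 < k)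
    (hℓ : 0 < ℓ) (hℓk : ℓ ∣ k) (htop : IsTop ℓ top) (hmax : IsArgmax argmax)
    {G O : Finset (Ext α k)} (hZ : Z.card ≤ k) (hG : G.card ≤ k) (hO : O.card ≤ k) :
    ∃ u : Option (Fin ℓ), ∀ B : Fin ℓ → Finset (Ext α k),
      (∀ l, (guidedIGS k ℓ top argmax Z G (u, l)).run f = B l) →
      (∀ l, dummyExt f ((O \ Z) ∪ B l) - dummyExt f (B l) ≤
        ℓ * (dummyExt f (B l) - dummyExt f G)) ∧
      ∀ X, O \ Z ⊆ X → ((ℓ : ℝ) - 1) * dummyExt f (X ∪ G) ≤ ∑ l, dummyExt f (X ∪ B l) := by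
  obtain ⟨a, ha, hainj, haGZ, ha0, hamax⟩ :=
    top_spec f Z (Nat.le_of_dvd hk hℓk) htop hZ hG
  have hF := hf.dummyExt (k := k)
  set R₀ := O \ (G ∪ Z) with hR₀
  -- the choice of the branch
  have hu : ∃ u : Option (Fin ℓ),
      (∀ l, ∀ o ∈ R₀, marg (dummyExt f) G o ≤ marg (dummyExt f) G (a (u.getD l))) ∧
      (∀ o ∈ R₀, (∃ l : Fin ℓ, a (u.getD l) = o) → ∀ l : Fin ℓ, a (u.getD l) = o) ∧
      ∀ l l' : Fin ℓ, l ≠ l' → a (u.getD l) = a (u.getD l') → a (u.getD l) ∈ R₀ := by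
    by_cases hex : ∃ l, a l ∈ R₀
    -- Some top element lies in `R₀`: start all sets with the best one of these. It beats the other
    -- top elements in `R₀` by choice and the rest of `R₀` as a top element. The common start does
    -- not hurt the spreading, because it lies in O \ Z and thus in `X`.
    · obtain ⟨l₀, hl₀, hl₀max⟩ := exists_max_image (univ.filter fun l => a l ∈ R₀)
        (fun l => marg (dummyExt f) G (a l)) (hex.imp fun l hl => mem_filter.2 ⟨mem_univ _, hl⟩)
      rw [mem_filter] at hl₀
      refine ⟨some l₀, fun l o ho => ?_, ?_, fun l l' _ _ => hl₀.2⟩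
      · by_cases hoa : ∃ l, a l = o
        · obtain ⟨l', rfl⟩ := hoa
          exact hl₀max l' (mem_filter.2 ⟨mem_univ _, ho⟩)
        · push Not at hoa
          exact hamax o (mem_sdiff.1 ho).2 hoa l₀
      · rintro o - ⟨l, h⟩ l'
        exact h
    · push Not at hex
      -- No top element lies in `R₀`: the distinct starting elements all beat `R₀`.
      refine ⟨none, fun l o ho => ?_, ?_, fun l l' hll' h => absurd (hainj h) hll'⟩
      · exact hamax o (mem_sdiff.1 ho).2 (fun l' h => hex l' (h ▸ ho)) l
      · rintro o ho ⟨l, h⟩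
        exact absurd (h ▸ ho) (hex l)
  obtain ⟨u, hu1, hu2, hu3⟩ := hu
  refine ⟨u, fun B' hB' => ?_⟩
  obtain ⟨a', b, B, ha', hb, hrun, ⟨D, hD, hDD, hDZ, hDA, hDc⟩, hbound⟩ :=
    guidedIGS_branch (top := top) f Z hf hk hℓ hℓk hmax hZ hG u
  obtain rfl : a' = a := ha'.symm.trans ha
  obtain rfl : B = B' := funext fun l => (hrun l).symm.trans (hB' l)
  simp only [← hb] at hu1 hu2 hu3
  have hGB : ∀ l, insert (b l) G ⊆ B l := fun l => by
    rw [hD]; exact subset_union_left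
  constructor
  · set R := R₀.filter fun o => ∀ l, o ≠ b l with hR
    obtain ⟨C, hCR, hCc, hsum⟩ := hbound R
      (fun o ho => ⟨(mem_sdiff.1 (mem_filter.1 ho).1).2, (mem_filter.1 ho).2⟩)
      ((card_le_card ((filter_subset _ _).trans sdiff_subset)).trans hO)
    intro l
    have hset : (O \ Z) ∪ B l = R ∪ B l := by
      ext o
      simp only [mem_union]
      constructor
      · rintro (h | h)
        · by_cases hoG : o ∈ G
          · exact Or.inr (hGB l (mem_insert_of_mem hoG))
          · have hoR₀ : o ∈ R₀ := by
              obtain ⟨h1, h2⟩ := mem_sdiff.1 h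
              exact mem_sdiff.2 ⟨h1, by simp [hoG, h2]⟩
            by_cases hob : ∃ l, b l = o
            · refine Or.inr (hGB l ?_)
              rw [hu2 o hoR₀ hob l]
              exact mem_insert_self _ _
            · push Not at hob
              exact Or.inl (mem_filter.2 ⟨hoR₀, fun l h => hob l h.symm⟩)
        · exact Or.inr h
      · rintro (h | h)
        · obtain ⟨h1, h2⟩ := mem_sdiff.1 (mem_filter.1 h).1
          rw [mem_union, not_or] at h2
          exact Or.inl (mem_sdiff.2 ⟨h1, h2.2⟩)
        · exact Or.inr h
    rw [hset]
    refine (hF.sub_le_sum_marg (B l) R).trans ?_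
    rw [← sum_sdiff hCR]
    have h0 : 0 ≤ marg (dummyExt f) G (b l) := hb l ▸ ha0 _
    -- The batch left uncharged by the rounds is charged to the starting element.
    have hC : ∑ o ∈ C, marg (dummyExt f) (B l) o ≤ ℓ * marg (dummyExt f) G (b l) := by
      have : ∀ o ∈ C, marg (dummyExt f) (B l) o ≤ marg (dummyExt f) G (b l) := fun o ho =>
        hF.marg_le_of_nonneg ((subset_insert _ _).trans (hGB l)) h0
          (hu1 l o (mem_filter.1 (hCR ho)).1)
      refine (sum_le_card_nsmul _ _ _ this).trans ?_
      rw [nsmul_eq_mul]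
      exact mul_le_mul_of_nonneg_right (by exact_mod_cast hCc) h0
    have := hsum l
    rw [show marg (dummyExt f) G (b l) = dummyExt f (insert (b l) G) - dummyExt f G from rfl] at hC
    linarith
  · intro X hX
    have hset : ∀ l, X ∪ B l = (X ∪ G) ∪ insert (b l) (D l) := fun l => by
      rw [hD]
      ext o; simp only [mem_union, mem_insert]; tauto
    simp only [hset]
    -- The sets added to `G` overlap at most in a shared starting element; by `hu3` it then belongs
    -- to O \ Z ⊆ X.
    refine hF.sum_union_ge' (fun S => hf0 _) (X ∪ G) (fun l => insert (b l) (D l)) ?_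
    intro i j hij o ho
    obtain ⟨h1, h2⟩ := mem_inter.1 ho
    have hbD : ∀ i j, b i ∉ D j := fun i j h =>
      disjoint_left.1 (hDA j i) h (mem_insert_self _ _)
    rcases mem_insert.1 h1 with rfl | h1 <;> rcases mem_insert.1 h2 with h2 | h2
    · have := hu3 i j hij h2
      refine mem_union_left _ (hX ?_)
      obtain ⟨h3, h4⟩ := mem_sdiff.1 this
      rw [mem_union, not_or] at h4
      exact mem_sdiff.2 ⟨h3, h4.2⟩
    · exact absurd h2 (hbD i j)
    · exact absurd (h2 ▸ h1) (hbD j i)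
    · exact absurd h2 (disjoint_left.1 (hDD i j hij) h1)

end Interlace

/-! ### Guided interlaced greedy for a matroid constraint -/

section MatroidGreedy

variable {α : Type u} [Fintype α] [DecidableEq α] {k ℓ : ℕ}

theorem queries_matroidRounds_le (I : Finset α → Prop) (f : Finset α → ℝ)
    (argmax : Finset (Fin ℓ × Ext α k) → (Fin ℓ × Ext α k → ℝ) → Fin ℓ × Ext α k)
    (Z G : Finset (Ext α k)) (m : ℕ) (A : Finset (Ext α k)) (P : Fin ℓ → Finset (Ext α k))
    (T : Fin ℓ → Ext α k → ℝ) :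
    (matroidRounds I k ℓ argmax Z G m A P T).queries f ≤ m * (Fintype.card α + 1) := by
  induction m generalizing A P T with
  | zero => simp [matroidRounds]
  | succ m ih =>
    simp only [matroidRounds, QueryProg.queries_bind]
    have := Nat.succ_mul m (Fintype.card α + 1)
    refine (Nat.add_le_add (queries_gains_le f _) (ih _ _ _)).trans ?_
    linarith

theorem queries_guidedIGM_le (I : Finset α → Prop) (f : Finset α → ℝ)
    (argmax : Finset (Fin ℓ × Ext α k) → (Fin ℓ × Ext α k → ℝ) → Fin ℓ × Ext α k)
    (exch : Finset (Ext α k) → (Fin ℓ → Finset (Ext α k)) → Ext α k → Ext α k)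
    (Z G : Finset (Ext α k)) (c : Fin ℓ) :
    (guidedIGM I k ℓ argmax exch Z G c).queries f ≤ (k + 1) * (Fintype.card α + 1) := by
  simp only [guidedIGM, QueryProg.queries_bind, QueryProg.queries_pure, add_zero]
  have := Nat.succ_mul k (Fintype.card α + 1)
  refine (Nat.add_le_add (queries_gains_le f _)
    (queries_matroidRounds_le I f argmax Z G k _ _ _)).trans ?_
  linarith

/-- `R'` is the part of `R` that the remaining steps do not pay for. Going backwards, whenever it
has more elements than `A`, augmentation yields an `o` in it that could have been added to `A`. The
greedy choice maximizes over all parts at once, so each of the ℓ gains of `o` is at most the gain of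
this one step, which is therefore charged ℓ times. -/
theorem matroidRounds_spec {I : Finset α → Prop} (hI : IsIndepSystem I) {f : Finset α → ℝ}
    (hf : IsSubmodular f) (hℓ : 0 < ℓ)
    {argmax : Finset (Fin ℓ × Ext α k) → (Fin ℓ × Ext α k → ℝ) → Fin ℓ × Ext α k}
    (hmax : IsArgmax argmax) {Z G : Finset (Ext α k)} (hZ : Z.card ≤ k) (hG : G.card ≤ k) (m : ℕ)
    (A : Finset (Ext α k)) (P : Fin ℓ → Finset (Ext α k)) (T : Fin ℓ → Ext α k → ℝ)
    (hA : ExtFeasible I k A) (hm : A.card + m = k) (hPA : univ.biUnion P = A)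
    (hP : ∀ i j, i ≠ j → Disjoint (P i) (P j)) (hAGZ : Disjoint A (G ∪ Z))
    (hT : ∀ j, T j = marg (dummyExt f) (G ∪ P j)) :
    ∃ P' : Fin ℓ → Finset (Ext α k), (matroidRounds I k ℓ argmax Z G m A P T).run f = P' ∧
      ExtBasis I k (univ.biUnion P') ∧ (∀ i j, i ≠ j → Disjoint (P' i) (P' j)) ∧
      Disjoint (univ.biUnion P') (G ∪ Z) ∧ (∀ j, P j ⊆ P' j) ∧
      ∀ R : Finset (Ext α k), ExtFeasible I k R → Disjoint R (G ∪ Z) →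
        ∃ R' ⊆ R, R'.card ≤ A.card ∧ ∑ o ∈ R \ R', ∑ j, marg (dummyExt f) (G ∪ P' j) o ≤
          ℓ * (∑ j, dummyExt f (G ∪ P' j) - ∑ j, dummyExt f (G ∪ P j)) := by
  classical
  induction m generalizing A P T with
  | zero =>
    refine ⟨P, rfl, hPA ▸ ⟨hA.1, by omega⟩, hP, hPA ▸ hAGZ, fun _ => subset_rfl, fun R hR _ => ?_⟩
    exact ⟨R, subset_rfl, hR.2.trans (by omega), by simp⟩
  | succ m ih =>
    simp only [matroidRounds, QueryProg.run_bind, run_gains]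
    set X := univ.filter fun x => x ∉ G ∪ A ∪ Z ∧ ExtFeasible I k (insert x A) with hX
    have hmemX : ∀ x, x ∈ X ↔ x ∉ G ∪ A ∪ Z ∧ ExtFeasible I k (insert x A) := fun x => by
      simp [hX]
    -- Here |A| < k, so fewer than 3k elements are occupied. An available dummy makes the greedy
    -- gain nonnegative.
    obtain ⟨d, hd⟩ := exists_dummy (G ∪ A ∪ Z) (by
      have h1 := card_union_le (G ∪ A) Z
      have h2 := card_union_le G A
      omega)
    have hdX : Sum.inr d ∈ X := by
      rw [hmemX]
      exact ⟨hd, by simpa using hA.1, (card_insert_le _ _).trans (by omega)⟩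
    obtain ⟨hpX, hpmax⟩ := hmax (univ ×ˢ X) (fun q => T q.1 q.2)
      ⟨(⟨0, hℓ⟩, Sum.inr d), mem_product.2 ⟨mem_univ _, hdX⟩⟩
    rcases hp : argmax (univ ×ˢ X) (fun q => T q.1 q.2) with ⟨i, x⟩
    simp only [hp] at hpX hpmax ⊢
    have hxX : x ∈ X := (mem_product.1 hpX).2
    have hpmax : ∀ j, ∀ o ∈ X, marg (dummyExt f) (G ∪ P j) o ≤
        marg (dummyExt f) (G ∪ P i) x := fun j o ho => by
      have := hpmax (j, o) (mem_product.2 ⟨mem_univ _, ho⟩)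
      simpa only [hT] using this
    have h0 : 0 ≤ marg (dummyExt f) (G ∪ P i) x :=
      (marg_dummy f _ d).symm.le.trans (hpmax i _ hdX)
    obtain ⟨hx, hxA⟩ := (hmemX x).1 hxX
    simp only [mem_union, not_or] at hx
    obtain ⟨⟨hxG, hxnA⟩, hxZ⟩ := hx
    set Q := Function.update P i (insert x (P i)) with hQ
    have hQi : Q i = insert x (P i) := by simp [hQ]
    have hQj : ∀ j, j ≠ i → Q j = P j := fun j hj => by simp [hQ, hj]
    have hPsub : ∀ j, P j ⊆ A := fun j => hPA ▸ subset_biUnion_of_mem P (mem_univ j)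
    have hPQ : ∀ j, P j ⊆ Q j := fun j => by
      by_cases hj : j = i
      · subst hj; rw [hQi]; exact subset_insert _ _
      · rw [hQj j hj]
    obtain ⟨P', hrun, hbasis, hdisj, hdisj', hsub, hR⟩ := ih (insert x A) Q
      (Function.update T i (marg (dummyExt f) (G ∪ Q i))) hxA
      (by rw [card_insert_of_notMem hxnA]; omega)
      (by
        rw [← hPA]
        ext o
        simp only [mem_biUnion, mem_univ, true_and, mem_insert]
        constructor
        · rintro ⟨j, hj⟩
          by_cases hji : j = i
          · subst hji
            rw [hQi] at hj
            exact (mem_insert.1 hj).imp_right fun h => ⟨j, h⟩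
          · rw [hQj j hji] at hj
            exact Or.inr ⟨j, hj⟩
        · rintro (rfl | ⟨j, hj⟩)
          · exact ⟨i, by rw [hQi]; exact mem_insert_self _ _⟩
          · exact ⟨j, hPQ j hj⟩)
      (by
        intro a b hab
        by_cases ha : a = i
        · subst ha
          rw [hQi, hQj b hab.symm, disjoint_insert_left]
          exact ⟨fun h => hxnA (hPsub b h), hP a b hab⟩
        · by_cases hb : b = i
          · subst hb
            rw [hQi, hQj a ha, disjoint_insert_right]
            exact ⟨fun h => hxnA (hPsub a h), hP a b hab⟩
          · rw [hQj a ha, hQj b hb]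
            exact hP a b hab)
      (by
        rw [disjoint_insert_left]
        exact ⟨by simp [hxG, hxZ], hAGZ⟩)
      (by
        intro j
        by_cases hj : j = i
        · subst hj; simp
        · rw [Function.update_of_ne hj, hT, hQj j hj])
    refine ⟨P', hrun, hbasis, hdisj, hdisj', fun j => (hPQ j).trans (hsub j), fun R hRf hRd => ?_⟩
    obtain ⟨R₁, hR₁, hR₁c, hsum⟩ := hR R hRf hRd
    rw [card_insert_of_notMem hxnA] at hR₁c
    have hgain : ∑ j, dummyExt f (G ∪ Q j) - ∑ j, dummyExt f (G ∪ P j)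
        = marg (dummyExt f) (G ∪ P i) x := by
      rw [← sum_sub_distrib, sum_eq_single i]
      · rw [hQi, union_insert]; rfl
      · intro j _ hj
        rw [hQj j hj, sub_self]
      · simp
    have hℓ0 : (0 : ℝ) ≤ ℓ := Nat.cast_nonneg ℓ
    by_cases hc : R₁.card ≤ A.card
    · refine ⟨R₁, hR₁, hc, hsum.trans (mul_le_mul_of_nonneg_left ?_ hℓ0)⟩
      linarith
    · obtain ⟨o, hoR₁, hoA, hof⟩ := (hI.extFeasible k).augment hA
        ((hI.extFeasible k).subset hRf hR₁) (not_le.1 hc)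
      have hoGZ := disjoint_left.1 hRd (hR₁ hoR₁)
      rw [mem_union, not_or] at hoGZ
      have hoX : o ∈ X := (hmemX o).2 ⟨by simp [hoGZ.1, hoGZ.2, hoA], hof⟩
      refine ⟨R₁.erase o, (erase_subset _ _).trans hR₁, ?_, ?_⟩
      · rw [card_erase_of_mem hoR₁]
        omega
      · have hset : R \ R₁.erase o = insert o (R \ R₁) := by
          rw [sdiff_erase (hR₁ hoR₁)]
        rw [hset, sum_insert (by simp [hoR₁])]
        have hone : ∑ j, marg (dummyExt f) (G ∪ P' j) o ≤ ℓ * marg (dummyExt f) (G ∪ P i) x := by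
          have : ∀ j ∈ (univ : Finset (Fin ℓ)),
              marg (dummyExt f) (G ∪ P' j) o ≤ marg (dummyExt f) (G ∪ P i) x := fun j _ =>
            hf.dummyExt.marg_le_of_nonneg
              (union_subset_union_right ((hPQ j).trans (hsub j))) h0 (hpmax j o hoX)
          refine (sum_le_card_nsmul _ _ _ this).trans ?_
          simp
        rw [← hgain] at hone
        linarith

/-- The candidates of guided interlaced greedy for a matroid constraint are bases; before the
exchange they gain on average enough to account for adding `O \ Z`, the exchange is cheap on
average, and the candidates spread well over the ground set. -/
theorem guidedIGM_spec {I : Finset α → Prop} (hI : IsIndepSystem I) {f : Finset α → ℝ}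
    (hf0 : ∀ S, 0 ≤ f S) (hf : IsSubmodular f) (hℓ : 0 < ℓ)
    {argmax : Finset (Fin ℓ × Ext α k) → (Fin ℓ × Ext α k → ℝ) → Fin ℓ × Ext α k}
    (hmax : IsArgmax argmax)
    {exch : Finset (Ext α k) → (Fin ℓ → Finset (Ext α k)) → Ext α k → Ext α k}
    (hexch : SelectsExchange I k ℓ exch) {Z G O : Finset (Ext α k)} (hZ : Z.card ≤ k)
    (hG : ExtBasis I k G) (hO : ExtFeasible I k O) :
    ∃ P B : Fin ℓ → Finset (Ext α k),
      (∀ l, (guidedIGM I k ℓ argmax exch Z G l).run f = B l) ∧ (∀ l, ExtBasis I k (B l)) ∧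
      (∀ l, B l ⊆ G ∪ P l) ∧ (∀ l, Disjoint (P l) Z) ∧
      ∑ l, (dummyExt f ((O \ Z) ∪ (G ∪ P l)) - dummyExt f (G ∪ P l)) ≤
        ℓ * ∑ l, (dummyExt f (G ∪ P l) - dummyExt f G) ∧
      ∑ l, dummyExt f (G ∪ P l) - dummyExt f G ≤ ∑ l, dummyExt f (B l) ∧
      (∀ X, ((ℓ : ℝ) - 2) * dummyExt f (X ∪ G) + dummyExt f X ≤ ∑ l, dummyExt f (X ∪ B l)) ∧
      ∀ X, ((ℓ : ℝ) - 1) * dummyExt f (X ∪ G) ≤ ∑ l, dummyExt f (X ∪ (G ∪ P l)) := by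
  have hF := hf.dummyExt (k := k)
  have hF0 : ∀ S : Finset (Ext α k), 0 ≤ dummyExt f S := fun S => hf0 _
  obtain ⟨P, hrun, hbasis, hdisj, hdisj', -, hR⟩ := matroidRounds_spec hI hf hℓ hmax hZ hG.2.le k ∅
    (fun _ => ∅) (fun _ => marg (dummyExt f) G) (hI.extFeasible k).empty (by simp) (by ext; simp)
    (by simp) (by simp) (by simp)
  set A := univ.biUnion P with hA
  rw [disjoint_union_right] at hdisj'
  obtain ⟨hAG, hAZ⟩ := hdisj'
  have hPA : ∀ l, P l ⊆ A := fun l => subset_biUnion_of_mem P (mem_univ l)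
  have hPG : ∀ l, Disjoint (P l) G := fun l => disjoint_of_subset_left (hPA l) hAG
  have : Nonempty (Fin ℓ) := ⟨⟨0, hℓ⟩⟩
  obtain ⟨hbij, hex⟩ := hexch G P (by
    obtain ⟨τ, hτ, h⟩ := (hI.extFeasible k).exists_multiple_exchange (k := k) (fun S hS => hS.2)
      hG.feasible hbasis.feasible hG.2 hbasis.2 P hdisj (sdiff_eq_self_of_disjoint hAG).symm
    rw [sdiff_eq_self_of_disjoint hAG, sdiff_eq_self_of_disjoint hAG.symm] at hτ
    exact ⟨τ, hτ, fun j => ⟨(h j).1.1, (h j).2⟩⟩)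
  set τ := exch G P with hτ
  set C : Fin ℓ → Finset (Ext α k) := fun l => (P l).image τ with hC
  have hCG : ∀ l, C l ⊆ G := fun l => image_subset_iff.2 fun x hx => hbij.mapsTo (hPA l hx)
  have hCdisj : ∀ i j, i ≠ j → Disjoint (C i) (C j) := fun i j hij => by
    refine disjoint_left.2 fun y hy hy' => ?_
    obtain ⟨a, ha, rfl⟩ := mem_image.1 hy
    obtain ⟨b, hb, hab⟩ := mem_image.1 hy'
    obtain rfl := hbij.injOn (hPA j hb) (hPA i ha) hab
    exact disjoint_left.1 (hdisj i j hij) ha hb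
  have hPC : ∀ l, Disjoint (P l) (C l) := fun l => disjoint_of_subset_right (hCG l) (hPG l)
  refine ⟨P, fun l => (G ∪ P l) \ C l, fun l => ?_, hex, fun l => sdiff_subset, fun l => ?_, ?_, ?_⟩
  · simp only [guidedIGM, QueryProg.run_bind, run_gains, QueryProg.run_pure]
    rw [hrun]
  · exact disjoint_of_subset_left (hPA l) hAZ
  · obtain ⟨R', -, hR'c, hsum⟩ := hR (O \ (G ∪ Z)) ((hI.extFeasible k).subset hO sdiff_subset)
      sdiff_disjoint
    -- The greedy starts with `A = ∅`, so every element of O \ (G ∪ Z) has been charged.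
    obtain rfl : R' = ∅ := card_eq_zero.1 (by simpa using hR'c)
    rw [sdiff_empty, sum_comm] at hsum
    rw [sum_sub_distrib (s := univ) (f := fun l => dummyExt f (G ∪ P l))]
    simp only [union_empty] at hsum
    refine le_trans (sum_le_sum fun l _ => ?_) hsum
    have hset : (O \ Z) ∪ (G ∪ P l) = (O \ (G ∪ Z)) ∪ (G ∪ P l) := by
      ext o; simp only [mem_union, mem_sdiff]; tauto
    rw [hset]
    exact hF.sub_le_sum_marg _ _
  -- The cost of the exchanges: removing `C l` in the presence of `P l` loses at most what it loses
  -- from `X ∪ G`. As the sets `C l` partition `G`, these losses total at most f(X ∪ G) - f(X).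
  have hX : ∀ X, ∑ l, dummyExt f (X ∪ (G ∪ P l)) + dummyExt f X - dummyExt f (X ∪ G)
      ≤ ∑ l, dummyExt f (X ∪ (G ∪ P l) \ C l) := by
    intro X
    have h1 : ∀ l, dummyExt f (X ∪ (G ∪ P l)) + dummyExt f ((X ∪ G) \ (C l \ X))
        ≤ dummyExt f (X ∪ (G ∪ P l) \ C l) + dummyExt f (X ∪ G) := by
      intro l
      have h := hF (X ∪ (G ∪ P l) \ C l) (X ∪ G)
      have e1 : X ∪ (G ∪ P l) \ C l ∪ (X ∪ G) = X ∪ (G ∪ P l) := by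
        ext o
        have : o ∈ P l → o ∉ C l := fun h => disjoint_left.1 (hPC l) h
        simp only [mem_union, mem_sdiff]; tauto
      have e2 : (X ∪ (G ∪ P l) \ C l) ∩ (X ∪ G) = (X ∪ G) \ (C l \ X) := by
        ext o
        have : o ∈ P l → o ∉ G := fun h => disjoint_left.1 (hPG l) h
        simp only [mem_union, mem_sdiff, mem_inter]; tauto
      rwa [e1, e2] at h
    have h2 := sum_le_sum fun l (_ : l ∈ univ) => h1 l
    rw [sum_add_distrib, sum_add_distrib, sum_const, card_univ, Fintype.card_fin,
      nsmul_eq_mul] at h2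
    have h3 := hF.sum_sdiff_ge (X ∪ G) (fun l => C l \ X) fun i j hij =>
      disjoint_of_subset_left sdiff_subset (disjoint_of_subset_right sdiff_subset (hCdisj i j hij))
    have e3 : (X ∪ G) \ univ.biUnion (fun l => C l \ X) = X := by
      ext o
      simp only [mem_sdiff, mem_union, mem_biUnion, mem_univ, true_and, not_exists, not_and]
      constructor
      · rintro ⟨h | h, ho⟩
        · exact h
        · obtain ⟨a, ha, rfl⟩ := hbij.surjOn h
          obtain ⟨l, -, hal⟩ := mem_biUnion.1 ha
          by_contra hcon
          exact ho l (mem_image_of_mem _ hal) hcon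
      · exact fun h => ⟨Or.inl h, fun l _ hn => hn h⟩
    rw [e3] at h3
    linarith
  have hspread : ∀ X, ((ℓ : ℝ) - 1) * dummyExt f (X ∪ G) ≤ ∑ l, dummyExt f (X ∪ (G ∪ P l)) := by
    intro X
    simp only [← union_assoc]
    exact hF.sum_union_ge' hF0 (X ∪ G) P fun i j hij => by
      rw [disjoint_iff_inter_eq_empty.1 (hdisj i j hij)]
      exact empty_subset _
  refine ⟨?_, fun X => ?_, hspread⟩
  · have := hX ∅
    simp only [empty_union] at this
    linarith [hF0 ∅]
  · have h1 := hX X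
    have h2 := hspread X
    linarith

end MatroidGreedy

/-! ### Solution of the recurrences for the expected values -/

section Recurrences

/-- `q` is the number of guided iterations, and `a`, `w`, `x`, `y` stand for the means of f on A, O
∪ Z ∪ A, O ∪ A and (O \ Z') ∪ A', where Z' is the current guidance set and A' the next iterate. Up
to `q` the inflow `y` is bounded below through `w`, afterwards through `x`, which starts from `w q`.
-/
theorem size_recurrence_bound {ℓ q : ℕ} (hℓ : 0 < ℓ) (hq : q ≤ ℓ) {V I U : ℝ}
    {a w x y : ℕ → ℝ} (ha0 : ∀ n, 0 ≤ a n) (hy0 : ∀ n < ℓ, 0 ≤ y n)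
    (ha : ∀ n < ℓ, ℓ * a n + y n ≤ (ℓ + 1) * a (n + 1))
    (hw0 : U ≤ w 0) (hw : ∀ n < q, (1 - 1 / (ℓ : ℝ)) * w n ≤ w (n + 1))
    (hy : ∀ n < q, V - I - U + w (n + 1) ≤ y n) (hxq : V - U + w q ≤ x q)
    (hx : ∀ n, q ≤ n → n < ℓ → (1 - 1 / (ℓ : ℝ)) * x n ≤ x (n + 1))
    (hyx : ∀ n, q ≤ n → n < ℓ → x (n + 1) ≤ y n) :
    (1 - 1 / (ℓ : ℝ)) ^ (ℓ - q + 1) *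
      ((1 - (1 - 1 / (ℓ : ℝ)) ^ q) * (V - I - U) + q / ℓ * (1 - 1 / (ℓ : ℝ)) ^ q * U +
        (1 - q / ℓ) * (V - (1 - (1 - 1 / (ℓ : ℝ)) ^ q) * U)) ≤ a ℓ := by
  have hℓR : (0 : ℝ) < ℓ := by exact_mod_cast hℓ
  have hℓ1 : (1 : ℝ) ≤ ℓ := by exact_mod_cast hℓ
  set p : ℝ := 1 - 1 / (ℓ : ℝ) with hp
  have hp0 : 0 ≤ p := by
    rw [hp, sub_nonneg, div_le_one hℓR]; exact hℓ1
  have hpℓ : p = (ℓ - 1) / ℓ := by rw [hp]; field_simp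
  -- The weights ℓ/(ℓ+1) and 1/(ℓ+1) are lowered to p and p/ℓ. Then `a` decays at the same rate p as
  -- `w` and `x`; this resonance produces the terms linear in the number of steps.
  have hstep : ∀ n < ℓ, p * a n + p / ℓ * y n ≤ a (n + 1) := by
    intro n hn
    have h1 := ha n hn
    have h2 : (ℓ + 1) * (p * a n + p / ℓ * y n) ≤ ℓ * a n + y n := by
      have e : ℓ * a n + y n - (ℓ + 1) * (p * a n + p / ℓ * y n) =
          a n / ℓ + y n / (ℓ : ℝ) ^ 2 := by
        rw [hpℓ]; field_simp; ring
      have : 0 ≤ a n / ℓ + y n / (ℓ : ℝ) ^ 2 :=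
        add_nonneg (div_nonneg (ha0 n) hℓR.le) (div_nonneg (hy0 n hn) (by positivity))
      linarith
    have h3 : (0 : ℝ) < ℓ + 1 := by linarith
    exact le_of_mul_le_mul_left (h2.trans h1) h3
  have hwn : ∀ n ≤ q, p ^ n * U ≤ w n := by
    intro n
    induction n with
    | zero => intro _; simpa using hw0
    | succ n ih =>
      intro hn
      refine le_trans ?_ (hw n hn)
      rw [pow_succ', mul_assoc]
      exact mul_le_mul_of_nonneg_left (ih (by omega)) hp0
  have han : ∀ n ≤ q, p * (1 - p ^ n) * (V - I - U) + n / ℓ * p ^ (n + 1) * U ≤ a n := by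
    intro n
    induction n with
    | zero => intro _; simpa using ha0 0
    | succ n ih =>
      intro hn
      refine le_trans ?_ (hstep n (by omega))
      have h1 := mul_le_mul_of_nonneg_left (ih (by omega)) hp0
      have h2 : p / ℓ * (V - I - U + p ^ (n + 1) * U) ≤ p / ℓ * y n :=
        mul_le_mul_of_nonneg_left
          ((add_le_add_right (hwn (n + 1) hn) _).trans (hy n hn)) (div_nonneg hp0 hℓR.le)
      have e : p * (1 - p ^ (n + 1)) * (V - I - U) + ((n + 1 : ℕ) : ℝ) / ℓ * p ^ (n + 1 + 1) * U =
          p * (p * (1 - p ^ n) * (V - I - U) + n / ℓ * p ^ (n + 1) * U) +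
            p / ℓ * (V - I - U + p ^ (n + 1) * U) := by
        have : 1 / (ℓ : ℝ) = 1 - p := by rw [hp]; ring
        have e1 : ((n + 1 : ℕ) : ℝ) / ℓ = n * (1 - p) + (1 - p) := by
          rw [← this]; push_cast; ring
        have e2 : (n : ℝ) / ℓ = n * (1 - p) := by rw [← this]; ring
        have e3 : p / ℓ = p * (1 - p) := by rw [← this]; ring
        rw [e1, e2, e3]
        ring
      linarith
  set xq := V - (1 - p ^ q) * U with hxqdef
  have hxq' : xq ≤ x q := by
    have := hwn q le_rfl
    rw [hxqdef]; linarith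
  have hxj : ∀ j, q + j ≤ ℓ → p ^ j * xq ≤ x (q + j) := by
    intro j
    induction j with
    | zero => intro _; simpa using hxq'
    | succ j ih =>
      intro hj
      refine le_trans ?_ (hx (q + j) (by omega) (by omega))
      rw [pow_succ', mul_assoc]
      exact mul_le_mul_of_nonneg_left (ih (by omega)) hp0
  set aq := p * (1 - p ^ q) * (V - I - U) + q / ℓ * p ^ (q + 1) * U with haq
  have haj : ∀ j, q + j ≤ ℓ → p ^ j * aq + j / ℓ * p ^ (j + 1) * xq ≤ a (q + j) := by
    intro j
    induction j with
    | zero => intro _; simpa using han q le_rfl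
    | succ j ih =>
      intro hj
      refine le_trans ?_ (hstep (q + j) (by omega))
      have h1 := mul_le_mul_of_nonneg_left (ih (by omega)) hp0
      have h2 : p / ℓ * (p ^ (j + 1) * xq) ≤ p / ℓ * y (q + j) :=
        mul_le_mul_of_nonneg_left ((hxj (j + 1) hj).trans (hyx (q + j) (by omega) (by omega)))
          (div_nonneg hp0 hℓR.le)
      have e : p ^ (j + 1) * aq + ((j + 1 : ℕ) : ℝ) / ℓ * p ^ (j + 1 + 1) * xq =
          p * (p ^ j * aq + j / ℓ * p ^ (j + 1) * xq) + p / ℓ * (p ^ (j + 1) * xq) := by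
        push_cast; ring
      linarith
  have hfin := haj (ℓ - q) (by omega)
  rw [Nat.add_sub_cancel' hq, Nat.cast_sub hq] at hfin
  refine le_trans (le_of_eq ?_) hfin
  have : ((ℓ : ℝ) - q) / ℓ = 1 - q / ℓ := by field_simp
  rw [this, haq]
  ring

/-- The structure is that of the size constraint, with `φ` for the mean value before the exchange.
Now `w` and `x` decay at rate r = 1 - 2/ℓ towards the fixed points U/2 and V/2 that the returned
terms create, so the solution has constant parts besides the resonant ones. -/
theorem matroid_recurrence_bound {ℓ q : ℕ} (hℓ : 2 ≤ ℓ) (hq : q ≤ ℓ) {V I U : ℝ}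
    (hU0 : 0 ≤ U) (hUV : U ≤ V)
    {a w x y φ : ℕ → ℝ} (ha0 : ∀ n, 0 ≤ a n) (hy0 : ∀ n < ℓ, 0 ≤ y n)
    (hφ : ∀ n < ℓ, ℓ * a n + y n ≤ (ℓ + 1) * φ n)
    (ha : ∀ n < ℓ, φ n - a n / ℓ ≤ a (n + 1))
    (hw0 : U ≤ w 0) (hw : ∀ n < q, (1 - 2 / (ℓ : ℝ)) * w n + U / ℓ ≤ w (n + 1))
    (hy : ∀ n < q, V - I - U + (1 - 1 / (ℓ : ℝ)) * w n ≤ y n) (hxq : V - U + w q ≤ x q)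
    (hx : ∀ n, q ≤ n → n < ℓ → (1 - 2 / (ℓ : ℝ)) * x n + V / ℓ ≤ x (n + 1))
    (hyx : ∀ n, q ≤ n → n < ℓ → (1 - 1 / (ℓ : ℝ)) * x n ≤ y n) :
    (1 - 2 / (ℓ : ℝ)) ^ (ℓ - q) *
      ((1 - 1 / (ℓ : ℝ)) / 2 * (V - I - U * (1 - (1 - 1 / (ℓ : ℝ)) / 2)) *
          (1 - (1 - 2 / (ℓ : ℝ)) ^ q) +
        q / ℓ / 2 * (1 - 2 / (ℓ : ℝ)) ^ q * U +
        (1 - q / ℓ) * (V / 2 - (1 - (1 - 2 / (ℓ : ℝ)) ^ q) * U / 2)) +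
      (1 - 1 / (ℓ : ℝ)) ^ 2 / 4 * V * (1 - (1 - 2 / (ℓ : ℝ)) ^ (ℓ - q)) ≤ a ℓ := by
  have hℓ2 : (2 : ℝ) ≤ ℓ := by exact_mod_cast hℓ
  have hℓR : (0 : ℝ) < ℓ := by linarith
  obtain ⟨h, hh⟩ : ∃ h : ℝ, h = 1 / (ℓ : ℝ) := ⟨_, rfl⟩
  have hh0 : 0 ≤ h := by rw [hh]; positivity
  have hℓh : (ℓ : ℝ) * h = 1 := by rw [hh]; field_simp
  have hh2 : h ≤ 1 / 2 := by rw [hh]; exact one_div_le_one_div_of_le (by norm_num) hℓ2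
  have hdiv : ∀ t : ℝ, t / ℓ = t * h := fun t => by rw [hh]; ring
  simp only [hdiv, one_mul] at ha hw hy hx hyx ⊢
  set p : ℝ := 1 - h with hp
  set r : ℝ := 1 - 2 * h with hr
  have hp0 : 0 ≤ p := by linarith
  have hr0 : 0 ≤ r := by linarith
  have hr1 : r ≤ 1 := by linarith
  -- The resonant inflows carry the factor p², which is lowered to r to match the decay rate of `a`.
  have hpr : r ≤ p ^ 2 := by rw [hp, hr]; nlinarith
  have hstep : ∀ n < ℓ, r * a n + p * h * y n ≤ a (n + 1) := by
    intro n hn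
    have h1 := hφ n hn
    have h2 : p * a n + p * h * y n ≤ φ n := by
      have e : (ℓ + 1) * (p * a n + p * h * y n) = ℓ * a n + y n - h * (a n + h * y n) := by
        have : (ℓ + 1) * p = ℓ - h := by rw [hp]; linear_combination hℓh * (-1)
        calc (ℓ + 1) * (p * a n + p * h * y n) = ((ℓ + 1) * p) * (a n + h * y n) := by ring
          _ = _ := by rw [this]; linear_combination (y n) * hℓh
      have h3 : 0 ≤ h * (a n + h * y n) :=
        mul_nonneg hh0 (add_nonneg (ha0 n) (mul_nonneg hh0 (hy0 n hn)))
      have h4 : (0 : ℝ) < ℓ + 1 := by linarith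
      exact le_of_mul_le_mul_left ((by linarith : _ ≤ ℓ * a n + y n).trans h1) h4
    have h5 := ha n hn
    have h6 : r * a n = p * a n - a n * h := by rw [hp, hr]; ring
    linarith
  have hwn : ∀ n ≤ q, (1 + r ^ n) * U / 2 ≤ w n := by
    intro n
    induction n with
    | zero => intro _; linarith [pow_zero r]
    | succ n ih =>
      intro hn
      refine le_trans ?_ (hw n hn)
      have := mul_le_mul_of_nonneg_left (ih (by omega)) hr0
      have e : (1 + r ^ (n + 1)) * U / 2 = r * ((1 + r ^ n) * U / 2) + U * h := by
        rw [pow_succ, hr]; ring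
      linarith
  set K := V - I - U * (1 - p / 2) with hK
  have han : ∀ n ≤ q, p / 2 * K * (1 - r ^ n) + n * h / 2 * r ^ n * U ≤ a n := by
    intro n
    induction n with
    | zero => intro _; simpa using ha0 0
    | succ n ih =>
      intro hn
      refine le_trans ?_ (hstep n (by omega))
      have h1 := mul_le_mul_of_nonneg_left (ih (by omega)) hr0
      have h2 : p * h * (V - I - U + p * ((1 + r ^ n) * U / 2)) ≤ p * h * y n :=
        mul_le_mul_of_nonneg_left
          ((add_le_add_right (mul_le_mul_of_nonneg_left (hwn n (by omega)) hp0) _).trans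
            (hy n hn)) (mul_nonneg hp0 hh0)
      have h3 : r * (h / 2 * r ^ n * U) ≤ p ^ 2 * (h / 2 * r ^ n * U) :=
        mul_le_mul_of_nonneg_right hpr (by positivity)
      have e : r * (p / 2 * K * (1 - r ^ n) + n * h / 2 * r ^ n * U) +
          p * h * (V - I - U + p * ((1 + r ^ n) * U / 2)) -
          (p / 2 * K * (1 - r ^ (n + 1)) + ((n + 1 : ℕ) : ℝ) * h / 2 * r ^ (n + 1) * U) =
          p ^ 2 * (h / 2 * r ^ n * U) - r * (h / 2 * r ^ n * U) := by
        have : h = (1 - r) / 2 := by rw [hr]; ring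
        rw [hK, this]
        push_cast
        ring
      linarith
  set xq := V - (1 - r ^ q) * U / 2 with hxqdef
  have hxq' : xq ≤ x q := by
    have := hwn q le_rfl
    rw [hxqdef]; linarith
  have hrq0 : 0 ≤ r ^ q := pow_nonneg hr0 q
  -- The excess over the fixed point must be nonnegative for p² to be lowered to r in front of it;
  -- this is where `U ≤ V` enters.
  have hxqV : 0 ≤ xq - V / 2 := by
    rw [hxqdef]
    nlinarith [mul_nonneg hrq0 hU0]
  have hxj : ∀ j, q + j ≤ ℓ → V / 2 + r ^ j * (xq - V / 2) ≤ x (q + j) := by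
    intro j
    induction j with
    | zero => intro _; simpa using hxq'
    | succ j ih =>
      intro hj
      refine le_trans ?_ (hx (q + j) (by omega) (by omega))
      have := mul_le_mul_of_nonneg_left (ih (by omega)) hr0
      have e : V / 2 + r ^ (j + 1) * (xq - V / 2) =
          r * (V / 2 + r ^ j * (xq - V / 2)) + V * h := by
        rw [pow_succ, hr]; ring
      linarith
  set aq := p / 2 * K * (1 - r ^ q) + q * h / 2 * r ^ q * U with haq
  have haj : ∀ j, q + j ≤ ℓ →
      r ^ j * aq + p ^ 2 / 4 * V * (1 - r ^ j) + j * h * r ^ j * (xq - V / 2) ≤ a (q + j) := by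
    intro j
    induction j with
    | zero => intro _; simpa using han q le_rfl
    | succ j ih =>
      intro hj
      refine le_trans ?_ (hstep (q + j) (by omega))
      have h1 := mul_le_mul_of_nonneg_left (ih (by omega)) hr0
      have h2 : p * h * (p * (V / 2 + r ^ j * (xq - V / 2))) ≤ p * h * y (q + j) :=
        mul_le_mul_of_nonneg_left ((mul_le_mul_of_nonneg_left (hxj j (by omega)) hp0).trans
          (hyx (q + j) (by omega) (by omega))) (mul_nonneg hp0 hh0)
      have h3 : r * (h * r ^ j * (xq - V / 2)) ≤ p ^ 2 * (h * r ^ j * (xq - V / 2)) :=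
        mul_le_mul_of_nonneg_right hpr (mul_nonneg (by positivity) hxqV)
      have e : r * (r ^ j * aq + p ^ 2 / 4 * V * (1 - r ^ j) + j * h * r ^ j * (xq - V / 2)) +
          p * h * (p * (V / 2 + r ^ j * (xq - V / 2))) -
          (r ^ (j + 1) * aq + p ^ 2 / 4 * V * (1 - r ^ (j + 1)) +
            ((j + 1 : ℕ) : ℝ) * h * r ^ (j + 1) * (xq - V / 2)) =
          p ^ 2 * (h * r ^ j * (xq - V / 2)) - r * (h * r ^ j * (xq - V / 2)) := by
        have : h = (1 - r) / 2 := by rw [hr]; ring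
        rw [this]
        push_cast
        ring
      linarith
  have hfin := haj (ℓ - q) (by omega)
  rw [Nat.add_sub_cancel' hq, Nat.cast_sub hq] at hfin
  refine le_trans (le_of_eq ?_) hfin
  rw [haq, hxqdef]
  linear_combination (-(r ^ (ℓ - q) * (V / 2 - (1 - r ^ q) * U / 2))) * hℓh

end Recurrences

/-! ### Numerical estimates: exponentials, small ℓ and limit polynomials -/

section Numerics

/-- From 1/(1 - h) = 1 + h/(1 - h) ≤ exp(h/(1 - h)), raised to the `n`-th power. -/
theorem exp_neg_le_one_sub_pow {h : ℝ} (h1 : h < 1) (n : ℕ) :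
    Real.exp (-(n * h / (1 - h))) ≤ (1 - h) ^ n := by
  have hpos : 0 < 1 - h := by linarith
  have h2 : Real.exp (-(h / (1 - h))) ≤ 1 - h := by
    rw [Real.exp_neg]
    refine inv_le_of_inv_le₀ hpos ?_
    have := Real.add_one_le_exp (h / (1 - h))
    refine le_trans (le_of_eq ?_) this
    field_simp
    ring
  calc Real.exp (-(n * h / (1 - h))) = Real.exp (-(h / (1 - h))) ^ n := by
        rw [← Real.exp_nat_mul]; congr 1; ring
    _ ≤ (1 - h) ^ n := pow_le_pow_left₀ (Real.exp_pos _).le h2 n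

theorem one_sub_pow_le_exp_neg {h : ℝ} (h1 : h ≤ 1) (n : ℕ) :
    (1 - h) ^ n ≤ Real.exp (-(n * h)) := by
  calc (1 - h) ^ n ≤ Real.exp (-h) ^ n :=
        pow_le_pow_left₀ (by linarith) (Real.one_sub_le_exp_neg h) n
    _ = _ := by rw [← Real.exp_nat_mul]; congr 1; ring

theorem exp_tangent {c y : ℝ} : Real.exp c * (1 + (y - c)) ≤ Real.exp y := by
  have h := Real.add_one_le_exp (y - c)
  have : Real.exp y = Real.exp c * Real.exp (y - c) := by rw [← Real.exp_add]; congr 1; ring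
  rw [this]
  exact mul_le_mul_of_nonneg_left (by linarith) (Real.exp_pos _).le

theorem exp_neg_one_ge : (0.3678 : ℝ) ≤ Real.exp (-1) := by
  have := Real.exp_neg_one_gt_d9
  linarith

/-- The exponent is -(1 - 0.372) = -1 + 93/250: the known value of exp(-1) times five terms of the
exponential series. -/
theorem exp_neg_size_ge : (0.5336 : ℝ) ≤ Real.exp (-0.628) := by
  have h1 := Real.exp_neg_one_gt_d9
  have h2 := Real.sum_le_exp_of_nonneg (x := 93 / 250) (by norm_num) 5
  have h3 : Real.exp (-0.628) = Real.exp (-1) * Real.exp (93 / 250) := by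
    rw [← Real.exp_add]; norm_num
  norm_num [Finset.sum_range_succ, Nat.factorial] at h2
  rw [h3]
  have := mul_le_mul h1.le h2 (by norm_num) (Real.exp_pos _).le
  refine le_trans ?_ this
  norm_num

/-- The exponent is -2(1 - 0.559) = -1 + 59/500. -/
theorem exp_neg_matroid_ge : (0.4139 : ℝ) ≤ Real.exp (-0.882) := by
  have h1 := Real.exp_neg_one_gt_d9
  have h2 := Real.sum_le_exp_of_nonneg (x := 59 / 500) (by norm_num) 5
  have h3 : Real.exp (-0.882) = Real.exp (-1) * Real.exp (59 / 500) := by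
    rw [← Real.exp_add]; norm_num
  norm_num [Finset.sum_range_succ, Nat.factorial] at h2
  rw [h3]
  have := mul_le_mul h1.le h2 (by norm_num) (Real.exp_pos _).le
  refine le_trans ?_ this
  norm_num

theorem exp_neg_two_le : Real.exp (-2) ≤ 0.13534 := by
  have h1 := Real.exp_neg_one_lt_d9
  have h3 : Real.exp (-2) = Real.exp (-1) * Real.exp (-1) := by
    rw [← Real.exp_add]; norm_num
  rw [h3]
  have := mul_le_mul h1.le h1.le (Real.exp_pos _).le (by norm_num)
  refine this.trans ?_
  norm_num

/-- For each fixed ℓ the claim is a linear inequality in V, I and U. -/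
theorem size_numeric_small {ℓ q : ℕ} (hℓ : 3 ≤ ℓ) (hℓ' : ℓ < 20) (hq : q = 372 * ℓ / 1000)
    {V I U : ℝ} (hV : 0 ≤ V)
    (hI : I ≤ (1 + 10 / (9 * (ℓ : ℝ))) * (0.385 - 10 / (9 * ℓ)) * V)
    (hIU : I + U ≤ (2 + 10 / (9 * (ℓ : ℝ))) * (0.385 - 10 / (9 * ℓ)) * V) :
    (0.385 - 10 / (9 * (ℓ : ℝ))) * V ≤ (1 - 1 / (ℓ : ℝ)) ^ (ℓ - q + 1) *
      ((1 - (1 - 1 / (ℓ : ℝ)) ^ q) * (V - I - U) + q / ℓ * (1 - 1 / (ℓ : ℝ)) ^ q * U +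
        (1 - q / ℓ) * (V - (1 - (1 - 1 / (ℓ : ℝ)) ^ q) * U)) := by
  subst hq
  interval_cases ℓ <;> norm_num at hI hIU ⊢ <;> linarith

/-- Again linear for each ℓ. In terms of I and I + U, the coefficient of I can change sign for small
ℓ, for example at ℓ = 4, so here `0 ≤ I` is needed besides the upper bounds. -/
theorem matroid_numeric_small {ℓ q : ℕ} (hℓ : 4 ≤ ℓ) (hℓ' : ℓ < 20) (hq : q = 559 * ℓ / 1000)
    {V I U : ℝ} (hV : 0 ≤ V) (hI0 : 0 ≤ I)
    (hI : I ≤ (1 + 10 / (9 * (ℓ : ℝ))) * (0.305 - 10 / (9 * ℓ)) * V)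
    (hIU : I + U ≤ (2 + 10 / (9 * (ℓ : ℝ))) * (0.305 - 10 / (9 * ℓ)) * V) :
    (0.305 - 10 / (9 * (ℓ : ℝ))) * V ≤ (1 - 2 / (ℓ : ℝ)) ^ (ℓ - q) *
      ((1 - 1 / (ℓ : ℝ)) / 2 * (V - I - U * (1 - (1 - 1 / (ℓ : ℝ)) / 2)) *
          (1 - (1 - 2 / (ℓ : ℝ)) ^ q) +
        q / ℓ / 2 * (1 - 2 / (ℓ : ℝ)) ^ q * U +
        (1 - q / ℓ) * (V / 2 - (1 - (1 - 2 / (ℓ : ℝ)) ^ q) * U / 2)) +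
      (1 - 1 / (ℓ : ℝ)) ^ 2 / 4 * V * (1 - (1 - 2 / (ℓ : ℝ)) ^ (ℓ - q)) := by
  subst hq
  interval_cases ℓ <;> norm_num at hI hIU ⊢ <;> linarith

/-- The case of large ℓ at the extreme values of I and U (with V = 1), after the powers are replaced
by tangent bounds. Here h = 1/ℓ, and d is the loss 0.372 - q/ℓ from rounding the switch time. -/
theorem size_polynomial {h d U I : ℝ} (hh0 : 0 ≤ h) (hh : h ≤ 1 / 20) (hd0 : 0 ≤ d) (hd : d ≤ h)
    (hU : U = 0.385 - 10 / 9 * h) (hI : I = (1 + 10 / 9 * h) * U) :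
    U * (1 - h) ≤ 0.5336 * (1 - 2.628 * h - d) * ((1.628 + d) * (1 - U) - I) +
      0.3678 * (1 - 3 * h) * (2 * U + I - 1) := by
  subst hI
  subst hU
  have e1 : 0 ≤ h - d := by linarith
  have e2 : 0 ≤ 1 / 20 - h := by linarith
  nlinarith [mul_nonneg hh0 hd0, mul_nonneg hh0 e1, mul_nonneg hh0 e2, mul_nonneg hd0 e1,
    mul_nonneg hd0 e2, mul_nonneg (mul_nonneg hh0 hh0) e2, mul_nonneg (mul_nonneg hh0 hd0) e2,
    mul_nonneg (mul_nonneg hh0 hd0) e1]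

/-- The matroid counterpart, with h = 1/ℓ and d = 0.559 - q/ℓ. The constant 0.13534 bounds exp(-2)
from above, because it multiplies a negative term. -/
theorem matroid_polynomial {h d U I p : ℝ} (hh0 : 0 ≤ h) (hh : h ≤ 1 / 20) (hd0 : 0 ≤ d)
    (hd : d ≤ h) (hU : U = 0.305 - 10 / 9 * h) (hI : I = (1 + 10 / 9 * h) * U) (hp : p = 1 - h) :
    U * (1 - 2 * h) ≤
      0.4139 * (1 - 3.764 * h - 2 * d) *
        (p / 2 * (1 - I - U * (1 - p / 2)) - p ^ 2 / 4 + (0.441 + d) * (1 - U) / 2) +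
      (1 - 2 * h) * (0.13534 * (U / 2 - p / 2 * (1 - I - U * (1 - p / 2))) + p ^ 2 / 4) := by
  subst hI
  subst hU
  subst hp
  have e1 : 0 ≤ h - d := by linarith
  have e2 : 0 ≤ 1 / 20 - h := by linarith
  nlinarith [mul_nonneg hh0 hd0, mul_nonneg hh0 e1, mul_nonneg hh0 e2, mul_nonneg hd0 e1,
    mul_nonneg hd0 e2, mul_nonneg (mul_nonneg hh0 hh0) e2, mul_nonneg (mul_nonneg hh0 hd0) e2,
    mul_nonneg (mul_nonneg hh0 hd0) e1]

end Numerics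

/-! ### Numerical estimates for ℓ ≥ 20 -/

section NumericsLarge

/-- Here s = q/ℓ, P = (1 - h)^q and M = (1 - h)^(ℓ - q + 1). Written in I and I + U, the bound has
nonpositive coefficients, by `hP1` and `hP2`, so the worst case is at the upper bounds for these
two, which `size_polynomial` treats. -/
theorem size_combine {h s M P U0 I0 V I U : ℝ} (hV : 0 ≤ V) (hh0 : 0 ≤ h) (hh20 : h ≤ 1 / 20)
    (hU0 : U0 = 0.385 - 10 / 9 * h) (hI0 : I0 = (1 + 10 / 9 * h) * U0)
    (hs1 : s ≤ 0.372) (hs2 : 0.372 - h ≤ s) (hM0 : 0 ≤ M) (hP1 : 1 - s ≤ P) (hP2 : P ≤ 1 - s / 2)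
    (hMlb : 0.5336 * (1 - 2.628 * h - (0.372 - s)) ≤ M * (1 - h))
    (hNlb : 0.3678 * (1 - 3 * h) ≤ M * P * (1 - h))
    (hI : I ≤ I0 * V) (hIU : I + U ≤ (I0 + U0) * V) :
    U0 * V ≤ M * ((1 - P) * (V - I - U) + s * P * U + (1 - s) * (V - (1 - P) * U)) := by
  have hden : 0 < 1 - h := by linarith
  have hpoly := size_polynomial (d := 0.372 - s) hh0 hh20 (by linarith) (by linarith) hU0 hI0
  have hA : 0 ≤ (1.628 + (0.372 - s)) * (1 - U0) - I0 := by
    rw [hI0, hU0]; nlinarith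
  have hB : 0 ≤ 2 * U0 + I0 - 1 := by
    rw [hI0, hU0]; nlinarith
  have hmain : U0 ≤ M * ((2 - s) * (1 - U0) - I0) + M * P * (2 * U0 + I0 - 1) := by
    have h1 := mul_le_mul_of_nonneg_right hMlb hA
    have h2 := mul_le_mul_of_nonneg_right hNlb hB
    have h3 : U0 * (1 - h) ≤
        (M * ((2 - s) * (1 - U0) - I0) + M * P * (2 * U0 + I0 - 1)) * (1 - h) := by
      have e : (1.628 + (0.372 - s)) = 2 - s := by ring
      rw [e] at h1 hpoly
      linarith
    exact le_of_mul_le_mul_right h3 hden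
  have hcI : 0 ≤ M * (P - (1 - s)) := mul_nonneg hM0 (by linarith)
  have hcU : 0 ≤ M * (2 - s - 2 * P) := mul_nonneg hM0 (by linarith)
  have h1 := mul_le_mul_of_nonneg_left hI hcI
  have h2 := mul_le_mul_of_nonneg_left hIU hcU
  have h3 := mul_le_mul_of_nonneg_right hmain hV
  linarith

theorem size_numeric_large {ℓ q : ℕ} (hℓ : 20 ≤ ℓ) (hq : q = 372 * ℓ / 1000)
    {V I U : ℝ} (hV : 0 ≤ V)
    (hI : I ≤ (1 + 10 / (9 * (ℓ : ℝ))) * (0.385 - 10 / (9 * ℓ)) * V)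
    (hIU : I + U ≤ (2 + 10 / (9 * (ℓ : ℝ))) * (0.385 - 10 / (9 * ℓ)) * V) :
    (0.385 - 10 / (9 * (ℓ : ℝ))) * V ≤ (1 - 1 / (ℓ : ℝ)) ^ (ℓ - q + 1) *
      ((1 - (1 - 1 / (ℓ : ℝ)) ^ q) * (V - I - U) + q / ℓ * (1 - 1 / (ℓ : ℝ)) ^ q * U +
        (1 - q / ℓ) * (V - (1 - (1 - 1 / (ℓ : ℝ)) ^ q) * U)) := by
  have hℓ20 : (20 : ℝ) ≤ ℓ := by exact_mod_cast hℓ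
  have hℓ0 : (0 : ℝ) < ℓ := by linarith
  have hqℓ : q ≤ ℓ := by omega
  have hq1 : 1000 * (q : ℝ) ≤ 372 * ℓ := by exact_mod_cast (by omega : 1000 * q ≤ 372 * ℓ)
  have hq2 : 372 * (ℓ : ℝ) ≤ 1000 * (q + 1) := by
    exact_mod_cast (by omega : 372 * ℓ ≤ 1000 * (q + 1))
  obtain ⟨h, hh⟩ : ∃ h : ℝ, h = 1 / (ℓ : ℝ) := ⟨_, rfl⟩
  have hℓh : (ℓ : ℝ) * h = 1 := by rw [hh]; field_simp
  have hh0 : 0 ≤ h := by rw [hh]; positivity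
  have hh20 : h ≤ 1 / 20 := by rw [hh]; exact one_div_le_one_div_of_le (by norm_num) hℓ20
  have hE : 10 / (9 * (ℓ : ℝ)) = 10 / 9 * h := by rw [hh]; field_simp
  have hqh : (q : ℝ) / ℓ = q * h := by rw [hh]; ring
  rw [hE] at hI hIU ⊢
  rw [hqh, ← hh]
  set U0 := 0.385 - 10 / 9 * h with hU0
  set I0 := (1 + 10 / 9 * h) * U0 with hI0
  have hIU' : I + U ≤ (I0 + U0) * V := by rw [hI0]; linarith
  set P := (1 - h) ^ q with hP
  set M := (1 - h) ^ (ℓ - q + 1) with hM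
  have hM0 : 0 ≤ M := pow_nonneg (by linarith) _
  have hMP : M * P = (1 - h) ^ (ℓ + 1) := by
    rw [hM, hP, ← pow_add]; congr 1; omega
  set s := (q : ℝ) * h with hs
  have hs1 : s ≤ 0.372 := by nlinarith
  have hs2 : 0.372 - h ≤ s := by nlinarith
  have hs0 : 0 ≤ s := by positivity
  have hP1 : 1 - s ≤ P := by
    have := one_add_mul_le_pow (a := -h) (by linarith) q
    rw [hP, sub_eq_add_neg (1 : ℝ) h]
    linarith
  -- Via exp(-s) ≤ 1/(1 + s) ≤ 1 - s/2, valid for 0 ≤ s ≤ 1.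
  have hP2 : P ≤ 1 - s / 2 := by
    refine (one_sub_pow_le_exp_neg (by linarith) q).trans ?_
    rw [Real.exp_neg]
    refine inv_le_of_inv_le₀ (by linarith) ?_
    refine le_trans ?_ (Real.add_one_le_exp (q * h))
    rw [inv_le_iff_one_le_mul₀ (by linarith)]
    nlinarith
  have hden : 0 < 1 - h := by linarith
  have hMlb : 0.5336 * (1 - 2.628 * h - (0.372 - s)) ≤ M * (1 - h) := by
    have h1 := exp_neg_le_one_sub_pow (h := h) (by linarith) (ℓ - q + 1)
    -- The tangent is taken at the limit of the exponent for ℓ → ∞; multiplied by 1 - h, the bound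
    -- becomes a polynomial in h and s.
    have h2 := exp_tangent (c := -0.628) (y := -(((ℓ - q + 1 : ℕ) : ℝ) * h / (1 - h)))
    have e : ((ℓ - q + 1 : ℕ) : ℝ) * h = 1 - s + h := by
      push_cast [Nat.cast_sub hqℓ]
      rw [hs]; linear_combination hℓh
    rw [e] at h1 h2
    have h3 : 0 ≤ 1 + (-((1 - s + h) / (1 - h)) - -0.628) := by
      have : (1 - s + h) / (1 - h) ≤ 1 := by rw [div_le_one hden]; linarith
      linarith
    have h4 := (mul_le_mul_of_nonneg_right exp_neg_size_ge h3).trans (h2.trans h1)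
    have h5 := mul_le_mul_of_nonneg_right h4 hden.le
    refine le_trans (le_of_eq ?_) h5
    field_simp
    ring
  have hNlb : 0.3678 * (1 - 3 * h) ≤ M * P * (1 - h) := by
    rw [hMP]
    have h1 := exp_neg_le_one_sub_pow (h := h) (by linarith) (ℓ + 1)
    have h2 := exp_tangent (c := -1) (y := -(((ℓ + 1 : ℕ) : ℝ) * h / (1 - h)))
    have e : ((ℓ + 1 : ℕ) : ℝ) * h = 1 + h := by
      push_cast
      linear_combination hℓh
    rw [e] at h1 h2
    have h3 : 0 ≤ 1 + (-((1 + h) / (1 - h)) - -1) := by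
      have : (1 + h) / (1 - h) ≤ 2 := by rw [div_le_iff₀ hden]; linarith
      linarith
    have h4 := (mul_le_mul_of_nonneg_right exp_neg_one_ge h3).trans (h2.trans h1)
    have h5 := mul_le_mul_of_nonneg_right h4 hden.le
    refine le_trans (le_of_eq ?_) h5
    field_simp
    ring
  exact size_combine hV hh0 hh20 hU0 hI0 hs1 hs2 hM0 hP1 hP2 hMlb hNlb hI hIU'

/-- Here s = q/ℓ, P = (1 - 2h)^q and R = (1 - 2h)^(ℓ - q). For h ≤ 1/20, I and I + U again have
nonpositive coefficients, which reduces the claim to their extreme values and `matroid_polynomial`.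
-/
theorem matroid_combine {h s p R P U0 I0 V I U : ℝ} (hV : 0 ≤ V) (hh0 : 0 ≤ h)
    (hh20 : h ≤ 1 / 20) (hU0 : U0 = 0.305 - 10 / 9 * h) (hI0 : I0 = (1 + 10 / 9 * h) * U0)
    (hp : p = 1 - h) (hs1 : s ≤ 0.559) (hs2 : 0.559 - h ≤ s) (hR0 : 0 ≤ R) (hP1 : 0.1 ≤ P)
    (hP2 : P ≤ 0.3679)
    (hRlb : 0.4139 * (1 - 3.764 * h - 2 * (0.559 - s)) ≤ R * (1 - 2 * h))
    (hTub : R * P ≤ 0.13534) (hI : I ≤ I0 * V) (hIU : I + U ≤ (I0 + U0) * V) :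
    U0 * V ≤ R * (p / 2 * (V - I - U * (1 - p / 2)) * (1 - P) + s / 2 * P * U +
      (1 - s) * (V / 2 - (1 - P) * U / 2)) + p ^ 2 / 4 * V * (1 - R) := by
  have hden : 0 < 1 - 2 * h := by linarith
  have hpoly := matroid_polynomial (d := 0.559 - s) hh0 hh20 (by linarith) (by linarith) hU0 hI0 hp
  have hU1 : U0 ≤ 0.305 := by rw [hU0]; linarith
  have hI1 : I0 ≤ 0.305 := by rw [hI0, hU0]; nlinarith
  have hU2 : 0 ≤ U0 := by rw [hU0]; linarith
  have hp1 : 0.95 ≤ p := by rw [hp]; linarith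
  have hp2 : p ≤ 1 := by rw [hp]; linarith
  obtain ⟨K, hK⟩ : ∃ K, K = p / 2 * (1 - I0 - U0 * (1 - p / 2)) := ⟨_, rfl⟩
  rw [← hK] at hpoly
  have hK1 : 0.24 ≤ K := by
    have h1 : U0 * (1 - p / 2) ≤ 0.305 * 0.525 :=
      mul_le_mul hU1 (by linarith) (by linarith) (by norm_num)
    have h2 : 0.475 * 0.53 ≤ p / 2 * (1 - I0 - U0 * (1 - p / 2)) :=
      mul_le_mul (by linarith) (by linarith) (by norm_num) (by linarith)
    rw [hK]
    linarith
  have hp3 : p ^ 2 ≤ 1 := by nlinarith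
  have hA : 0 ≤ K - p ^ 2 / 4 + (0.441 + (0.559 - s)) * (1 - U0) / 2 := by
    have : 0.441 * 0.695 ≤ (0.441 + (0.559 - s)) * (1 - U0) :=
      mul_le_mul (by linarith) (by linarith) (by norm_num) (by linarith)
    linarith
  have hB : U0 / 2 - K ≤ 0 := by linarith
  have hmain : U0 ≤ R * (K - p ^ 2 / 4 + (1 - s) * (1 - U0) / 2) + R * P * (U0 / 2 - K) +
      p ^ 2 / 4 := by
    have h1 := mul_le_mul_of_nonneg_right hRlb hA
    have h2 := mul_le_mul_of_nonneg_right (mul_le_mul_of_nonpos_right hTub hB) hden.le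
    have h3 : U0 * (1 - 2 * h) ≤ (R * (K - p ^ 2 / 4 + (1 - s) * (1 - U0) / 2) +
        R * P * (U0 / 2 - K) + p ^ 2 / 4) * (1 - 2 * h) := by
      have e : (0.441 + (0.559 - s)) = 1 - s := by ring
      rw [e] at h1 hpoly
      linear_combination h1 + h2 + hpoly
    exact le_of_mul_le_mul_right h3 hden
  have hcI : 0 ≤ R * (p ^ 2 / 4 * (1 - P) + P / 2 - (1 - s) / 2) := by
    refine mul_nonneg hR0 ?_
    have h1 : 0.9 ≤ p ^ 2 := by nlinarith
    have h2 : 0.9 * (1 - P) ≤ p ^ 2 * (1 - P) := mul_le_mul_of_nonneg_right h1 (by linarith)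
    linarith
  have hcU : 0 ≤ R * (p / 2 * (1 - p / 2) * (1 - P) - P / 2 + (1 - s) / 2) := by
    refine mul_nonneg hR0 ?_
    have h1 : 0 ≤ p / 2 * (1 - p / 2) * (1 - P) :=
      mul_nonneg (mul_nonneg (by linarith) (by linarith)) (by linarith)
    linarith
  have h1 := mul_le_mul_of_nonneg_left hI hcI
  have h2 := mul_le_mul_of_nonneg_left hIU hcU
  have h3 := mul_le_mul_of_nonneg_right hmain hV
  rw [hK] at h3
  linear_combination h1 + h2 + h3

theorem matroid_numeric_large {ℓ q : ℕ} (hℓ : 20 ≤ ℓ) (hq : q = 559 * ℓ / 1000)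
    {V I U : ℝ} (hV : 0 ≤ V)
    (hI : I ≤ (1 + 10 / (9 * (ℓ : ℝ))) * (0.305 - 10 / (9 * ℓ)) * V)
    (hIU : I + U ≤ (2 + 10 / (9 * (ℓ : ℝ))) * (0.305 - 10 / (9 * ℓ)) * V) :
    (0.305 - 10 / (9 * (ℓ : ℝ))) * V ≤ (1 - 2 / (ℓ : ℝ)) ^ (ℓ - q) *
      ((1 - 1 / (ℓ : ℝ)) / 2 * (V - I - U * (1 - (1 - 1 / (ℓ : ℝ)) / 2)) *
          (1 - (1 - 2 / (ℓ : ℝ)) ^ q) +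
        q / ℓ / 2 * (1 - 2 / (ℓ : ℝ)) ^ q * U +
        (1 - q / ℓ) * (V / 2 - (1 - (1 - 2 / (ℓ : ℝ)) ^ q) * U / 2)) +
      (1 - 1 / (ℓ : ℝ)) ^ 2 / 4 * V * (1 - (1 - 2 / (ℓ : ℝ)) ^ (ℓ - q)) := by
  have hℓ20 : (20 : ℝ) ≤ ℓ := by exact_mod_cast hℓ
  have hℓ0 : (0 : ℝ) < ℓ := by linarith
  have hqℓ : q ≤ ℓ := by omega
  have hq1 : 1000 * (q : ℝ) ≤ 559 * ℓ := by exact_mod_cast (by omega : 1000 * q ≤ 559 * ℓ)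
  have hq2 : 559 * (ℓ : ℝ) ≤ 1000 * (q + 1) := by
    exact_mod_cast (by omega : 559 * ℓ ≤ 1000 * (q + 1))
  obtain ⟨h, hh⟩ : ∃ h : ℝ, h = 1 / (ℓ : ℝ) := ⟨_, rfl⟩
  have hℓh : (ℓ : ℝ) * h = 1 := by rw [hh]; field_simp
  have hh0 : 0 ≤ h := by rw [hh]; positivity
  have hh20 : h ≤ 1 / 20 := by rw [hh]; exact one_div_le_one_div_of_le (by norm_num) hℓ20
  have hE : 10 / (9 * (ℓ : ℝ)) = 10 / 9 * h := by rw [hh]; field_simp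
  have hqh : (q : ℝ) / ℓ = q * h := by rw [hh]; ring
  have h2h : 2 / (ℓ : ℝ) = 2 * h := by rw [hh]; ring
  rw [hE] at hI hIU ⊢
  rw [hqh, h2h, ← hh]
  set U0 := 0.305 - 10 / 9 * h with hU0
  set I0 := (1 + 10 / 9 * h) * U0 with hI0
  have hIU' : I + U ≤ (I0 + U0) * V := by rw [hI0]; linarith
  set p := 1 - h with hp
  set P := (1 - 2 * h) ^ q with hP
  set R := (1 - 2 * h) ^ (ℓ - q) with hR
  have hR0 : 0 ≤ R := pow_nonneg (by linarith) _
  have hRP : R * P = (1 - 2 * h) ^ ℓ := by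
    rw [hR, hP, ← pow_add]; congr 1; omega
  set s := (q : ℝ) * h with hs
  have hs1 : s ≤ 0.559 := by nlinarith
  have hs2 : 0.559 - h ≤ s := by nlinarith
  have hden : 0 < 1 - 2 * h := by linarith
  have hP1 : 0.1 ≤ P := by
    have h1 := exp_neg_le_one_sub_pow (h := 2 * h) (by linarith) q
    have h2 := exp_tangent (c := -1) (y := -((q : ℝ) * (2 * h) / (1 - 2 * h)))
    have h3 : (q : ℝ) * (2 * h) / (1 - 2 * h) ≤ 1.25 := by
      rw [div_le_iff₀ hden]; linarith
    have h4 : (0.75 : ℝ) ≤ 1 + (-((q : ℝ) * (2 * h) / (1 - 2 * h)) - -1) := by linarith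
    have h5 := mul_le_mul exp_neg_one_ge h4 (by norm_num) (Real.exp_pos _).le
    exact le_trans (by norm_num) (h5.trans (h2.trans h1))
  have hP2 : P ≤ 0.3679 := by
    refine (one_sub_pow_le_exp_neg (by linarith) q).trans ?_
    have h1 : Real.exp (-((q : ℝ) * (2 * h))) ≤ Real.exp (-1) := Real.exp_le_exp.2 (by linarith)
    have := Real.exp_neg_one_lt_d9
    linarith
  have hRlb : 0.4139 * (1 - 3.764 * h - 2 * (0.559 - s)) ≤ R * (1 - 2 * h) := by
    have h1 := exp_neg_le_one_sub_pow (h := 2 * h) (by linarith) (ℓ - q)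
    have h2 := exp_tangent (c := -0.882) (y := -(((ℓ - q : ℕ) : ℝ) * (2 * h) / (1 - 2 * h)))
    have e : ((ℓ - q : ℕ) : ℝ) * (2 * h) = 2 * (1 - s) := by
      rw [Nat.cast_sub hqℓ, hs]; linear_combination 2 * hℓh
    rw [e] at h1 h2
    have h3 : 0 ≤ 1 + (-(2 * (1 - s) / (1 - 2 * h)) - -0.882) := by
      have : 2 * (1 - s) / (1 - 2 * h) ≤ 1.5 := by rw [div_le_iff₀ hden]; linarith
      linarith
    have h4 := (mul_le_mul_of_nonneg_right exp_neg_matroid_ge h3).trans (h2.trans h1)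
    have h5 := mul_le_mul_of_nonneg_right h4 hden.le
    refine le_trans (le_of_eq ?_) h5
    have h6 : 2 * (1 - s) / (1 - 2 * h) * (1 - 2 * h) = 2 * (1 - s) := div_mul_cancel₀ _ hden.ne'
    linear_combination 0.4139 * h6
  have hTub : R * P ≤ 0.13534 := by
    rw [hRP]
    refine (one_sub_pow_le_exp_neg (by linarith) ℓ).trans ?_
    rw [show -((ℓ : ℝ) * (2 * h)) = -2 by linear_combination (-2) * hℓh]
    exact exp_neg_two_le
  exact matroid_combine hV hh0 hh20 hU0 hI0 hp hs1 hs2 hR0 hP1 hP2 hRlb hTub hI hIU'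

end NumericsLarge

/-! ### Random processes with uniform choices -/

section Processes

variable {σ C : Type*} {ℓ : ℕ}

/-- The state after `n` steps of a process with choices `ω`. -/
def trajectory (step : ℕ → σ → C → σ) (s : σ) (n : ℕ) (ω : Fin n → C) : σ :=
  (List.finRange n).foldl (fun s (i : Fin n) => step i s (ω i)) s

theorem trajectory_succ (step : ℕ → σ → C → σ) (s : σ) (n : ℕ) (ω : Fin (n + 1) → C) :
    trajectory step s (n + 1) ω =
      step n (trajectory step s n fun i => ω i.castSucc) (ω (Fin.last n)) := by
  simp [trajectory, List.finRange_succ_last, List.foldl_append, List.foldl_map]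

theorem trajectory_invariant {step : ℕ → σ → C → σ} {Inv : ℕ → σ → Prop} {N : ℕ} {s : σ}
    (h0 : Inv 0 s) (hstep : ∀ n < N, ∀ s, Inv n s → ∀ c, Inv (n + 1) (step n s c)) :
    ∀ n ≤ N, ∀ ω, Inv n (trajectory step s n ω) := by
  intro n
  induction n with
  | zero => intro _ _; exact h0
  | succ n ih =>
    intro hn ω
    rw [trajectory_succ]
    exact hstep n (by omega) _ (ih (by omega) _) _

/-- `e n s` embeds the ℓ good choices, which may depend on time and state, into all choices. A
sequence of good choices determines the history and hence the actual choices, and it can be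
recovered from them step by step; so the restricted process lives on an equally large set of runs of
the full one. -/
theorem exists_coupling (step : ℕ → σ → C → σ) (e : ℕ → σ → Fin ℓ → C)
    (he : ∀ n s, Function.Injective (e n s)) (s : σ) (n : ℕ) :
    ∃ Φ : (Fin n → Fin ℓ) → Fin n → C, Function.Injective Φ ∧
      ∀ ω, trajectory step s n (Φ ω) = trajectory (fun n s l => step n s (e n s l)) s n ω := by
  induction n with
  | zero => exact ⟨fun _ i => i.elim0, fun a b _ => Subsingleton.elim _ _, fun _ => rfl⟩
  | succ n ih =>
    obtain ⟨Φ, hΦ, htraj⟩ := ih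
    refine ⟨fun ω => Fin.snoc (α := fun _ => C) (Φ fun i => ω i.castSucc)
      (e n (trajectory step s n (Φ fun i => ω i.castSucc)) (ω (Fin.last n))), ?_, fun ω => ?_⟩
    · intro a b hab
      have h1 : (fun i : Fin n => a i.castSucc) = fun i => b i.castSucc := by
        apply hΦ
        funext i
        have := congrFun hab i.castSucc
        simpa using this
      have h2 : a (Fin.last n) = b (Fin.last n) := by
        have := congrFun hab (Fin.last n)
        simp only [Fin.snoc_last] at this
        rw [h1] at this
        exact he _ _ this
      funext i
      refine Fin.lastCases h2 (fun i => ?_) i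
      exact congrFun h1 i
    · rw [trajectory_succ, trajectory_succ]
      simp only [Fin.snoc_last, Fin.snoc_castSucc]
      rw [htraj]

/-- The expected value of `g` after `n` steps with independent uniform choices. -/
noncomputable def meanAfter (step : ℕ → σ → Fin ℓ → σ) (s : σ) (n : ℕ) (g : σ → ℝ) : ℝ :=
  𝔼 ω : Fin n → Fin ℓ, g (trajectory step s n ω)

variable (step : ℕ → σ → Fin ℓ → σ) (s : σ)

theorem meanAfter_zero (g : σ → ℝ) : meanAfter step s 0 g = g s := by
  simp [meanAfter, trajectory]

theorem meanAfter_succ (n : ℕ) (g : σ → ℝ) :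
    meanAfter step s (n + 1) g = meanAfter step s n fun s => 𝔼 l, g (step n s l) := by
  unfold meanAfter
  rw [← Fintype.expect_equiv (Fin.snocEquiv fun _ : Fin (n + 1) => Fin ℓ)
    (fun q : Fin ℓ × (Fin n → Fin ℓ) => g (step n (trajectory step s n q.2) q.1)) _ (by
      rintro ⟨l, ω⟩
      rw [trajectory_succ]
      simp [Fin.snocEquiv])]
  rw [← univ_product_univ, expect_product, expect_comm]

variable {step s}

theorem meanAfter_le {n : ℕ} {Inv : σ → Prop} (hInv : ∀ ω, Inv (trajectory step s n ω))
    {g g' : σ → ℝ} (h : ∀ s, Inv s → g s ≤ g' s) : meanAfter step s n g ≤ meanAfter step s n g' :=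
  expect_le_expect fun ω _ => h _ (hInv ω)

theorem meanAfter_nonneg {n : ℕ} {g : σ → ℝ} (h : ∀ s, 0 ≤ g s) : 0 ≤ meanAfter step s n g :=
  expect_nonneg fun _ _ => h _

theorem meanAfter_add {n : ℕ} (g g' : σ → ℝ) :
    meanAfter step s n (fun s => g s + g' s) = meanAfter step s n g + meanAfter step s n g' :=
  expect_add_distrib _ _ _

theorem meanAfter_sub {n : ℕ} (g g' : σ → ℝ) :
    meanAfter step s n (fun s => g s - g' s) = meanAfter step s n g - meanAfter step s n g' :=
  expect_sub_distrib _ _ _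

theorem meanAfter_mul {n : ℕ} (c : ℝ) (g : σ → ℝ) :
    meanAfter step s n (fun s => c * g s) = c * meanAfter step s n g :=
  (mul_expect _ _ _).symm

theorem meanAfter_const [Nonempty (Fin ℓ)] {n : ℕ} (c : ℝ) :
    meanAfter step s n (fun _ => c) = c :=
  Fintype.expect_const c

end Processes

/-! ### From the local search bounds to the approximation guarantee -/

section Guarantees

/-- Since c ≤ 1, the products (1 + ε)(c - ε) and (2 + ε)(c - ε) decrease in ε. So ε may be replaced
by the smaller E = 10/(9ℓ), which leaves ℓ as the only parameter of the numerical claims. -/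
theorem guarantee_transfer {c ε E z V I U : ℝ} (hc : c ≤ 1) (hE0 : 0 ≤ E) (hE : E ≤ ε)
    (hV : 0 ≤ V) (hz : z ≤ (c - ε) * V) (hI : I ≤ (1 + ε) * z) (hIU : I + U ≤ (2 + ε) * z) :
    I ≤ (1 + E) * (c - E) * V ∧ I + U ≤ (2 + E) * (c - E) * V ∧ (c - ε) * V ≤ (c - E) * V := by
  have h1 : (1 + ε) * z ≤ (1 + ε) * ((c - ε) * V) := mul_le_mul_of_nonneg_left hz (by linarith)
  have h2 : (2 + ε) * z ≤ (2 + ε) * ((c - ε) * V) := mul_le_mul_of_nonneg_left hz (by linarith)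
  have h3 : 0 ≤ (ε - E) * V := mul_nonneg (by linarith) hV
  have h4 : 0 ≤ (ε - E) * V * (1 - c + ε + E) := mul_nonneg h3 (by linarith)
  have h5 : 0 ≤ (ε - E) * V * (2 - c + ε + E) := mul_nonneg h3 (by linarith)
  refine ⟨?_, ?_, ?_⟩ <;> linarith

theorem ceil_bounds {ε : ℝ} {ℓ : ℕ} (hε : 0 < ε) (hℓ : ℓ = ⌈10 / (9 * ε)⌉₊) :
    0 < ℓ ∧ 10 / (9 * (ℓ : ℝ)) ≤ ε ∧ (ℓ : ℝ) < 10 / (9 * ε) + 1 := by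
  have hpos : 0 < 10 / (9 * ε) := by positivity
  have h1 : 10 / (9 * ε) ≤ ℓ := hℓ ▸ Nat.le_ceil _
  have h2 : (ℓ : ℝ) < 10 / (9 * ε) + 1 := hℓ ▸ Nat.ceil_lt_add_one hpos.le
  have h3 : (0 : ℝ) < ℓ := hpos.trans_le h1
  refine ⟨by exact_mod_cast h3, ?_, h2⟩
  rw [div_le_iff₀ (by positivity)] at h1 ⊢
  linarith

theorem size_guarantee {ε z V I U : ℝ} {ℓ : ℕ} (hε : 0 < ε) (hℓ : ℓ = ⌈10 / (9 * ε)⌉₊)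
    (hV : 0 < V) (hz0 : 0 ≤ z) (hz : z < (0.385 - ε) * V) (hI : I ≤ (1 + ε) * z)
    (hIU : I + U ≤ (2 + ε) * z) {q : ℕ} (hq : q = 372 * ℓ / 1000) :
    (0.385 - ε) * V ≤ (1 - 1 / (ℓ : ℝ)) ^ (ℓ - q + 1) *
      ((1 - (1 - 1 / (ℓ : ℝ)) ^ q) * (V - I - U) + q / ℓ * (1 - 1 / (ℓ : ℝ)) ^ q * U +
        (1 - q / ℓ) * (V - (1 - (1 - 1 / (ℓ : ℝ)) ^ q) * U)) := by
  obtain ⟨hℓ0, hE, -⟩ := ceil_bounds hε hℓ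
  have hℓR : (0 : ℝ) < ℓ := by exact_mod_cast hℓ0
  have hε' : 0 < 0.385 - ε := pos_of_mul_pos_left (hz0.trans_lt hz) hV.le
  -- If ℓ ≤ 2 then ε ≥ 5/9 > 0.385, and the value z would be negative.
  have hℓ3 : 3 ≤ ℓ := by
    by_contra hcon
    have : (ℓ : ℝ) ≤ 2 := by exact_mod_cast (by omega : ℓ ≤ 2)
    rw [div_le_iff₀ (by positivity)] at hE
    nlinarith
  obtain ⟨h1, h2, h3⟩ := guarantee_transfer (c := 0.385) (by norm_num)
    (by positivity : 0 ≤ 10 / (9 * (ℓ : ℝ))) hE hV.le hz.le hI hIU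
  refine h3.trans ?_
  rcases lt_or_ge ℓ 20 with h | h
  · exact size_numeric_small hℓ3 h hq hV.le h1 h2
  · exact size_numeric_large h hq hV.le h1 h2

theorem matroid_guarantee {ε z V I U : ℝ} {ℓ : ℕ} (hε : 0 < ε) (hℓ : ℓ = ⌈10 / (9 * ε)⌉₊)
    (hV : 0 < V) (hz0 : 0 ≤ z) (hz : z < (0.305 - ε) * V) (hI0 : 0 ≤ I) (hI : I ≤ (1 + ε) * z)
    (hIU : I + U ≤ (2 + ε) * z) {q : ℕ} (hq : q = 559 * ℓ / 1000) :
    2 ≤ ℓ ∧ U ≤ V ∧ (0.305 - ε) * V ≤ (1 - 2 / (ℓ : ℝ)) ^ (ℓ - q) *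
      ((1 - 1 / (ℓ : ℝ)) / 2 * (V - I - U * (1 - (1 - 1 / (ℓ : ℝ)) / 2)) *
          (1 - (1 - 2 / (ℓ : ℝ)) ^ q) +
        q / ℓ / 2 * (1 - 2 / (ℓ : ℝ)) ^ q * U +
        (1 - q / ℓ) * (V / 2 - (1 - (1 - 2 / (ℓ : ℝ)) ^ q) * U / 2)) +
      (1 - 1 / (ℓ : ℝ)) ^ 2 / 4 * V * (1 - (1 - 2 / (ℓ : ℝ)) ^ (ℓ - q)) := by
  obtain ⟨hℓ0, hE, -⟩ := ceil_bounds hε hℓ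
  have hℓR : (0 : ℝ) < ℓ := by exact_mod_cast hℓ0
  have hε' : 0 < 0.305 - ε := pos_of_mul_pos_left (hz0.trans_lt hz) hV.le
  -- If ℓ ≤ 3 then ε ≥ 10/27 > 0.305.
  have hℓ4 : 4 ≤ ℓ := by
    by_contra hcon
    have : (ℓ : ℝ) ≤ 3 := by exact_mod_cast (by omega : ℓ ≤ 3)
    rw [div_le_iff₀ (by positivity)] at hE
    nlinarith
  obtain ⟨h1, h2, h3⟩ := guarantee_transfer (c := 0.305) (by norm_num)
    (by positivity : 0 ≤ 10 / (9 * (ℓ : ℝ))) hE hV.le hz.le hI hIU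
  refine ⟨by omega, ?_, h3.trans ?_⟩
  · have : (2 + ε) * z ≤ 2.305 * z := mul_le_mul_of_nonneg_right (by linarith) hz0
    nlinarith
  · rcases lt_or_ge ℓ 20 with h | h
    · exact matroid_numeric_small hℓ4 h hq hV.le hI0 h1 h2
    · exact matroid_numeric_large h hq hV.le h1 h2

end Guarantees

/-! ### Analysis under the size constraint -/

section Analysis

variable {α : Type u} {k : ℕ}

open Classical in
/-- The guidance set in the iteration number `n + 1`. -/
noncomputable def guidanceAt (t : ℝ) (ℓ : ℕ) (Z : Finset (Ext α k)) (n : ℕ) : Finset (Ext α k) :=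
  if (n : ℝ) + 1 ≤ t * ℓ then Z else ∅

/-- The switch times have three decimals, so the real comparison becomes one with the natural number
⌊mℓ/1000⌋ of guided iterations. -/
theorem guidanceAt_eq {t : ℝ} {m ℓ : ℕ} (ht : t = m / 1000) (Z : Finset (Ext α k)) (n : ℕ) :
    guidanceAt t ℓ Z n = if n < m * ℓ / 1000 then Z else ∅ := by
  have : (n : ℝ) + 1 ≤ t * ℓ ↔ n < m * ℓ / 1000 := by
    rw [ht, Nat.lt_iff_add_one_le, Nat.le_div_iff_mul_le (by norm_num), div_mul_eq_mul_div,
      le_div_iff₀ (by norm_num)]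
    exact_mod_cast Iff.rfl
  simp only [guidanceAt, this]

theorem guidanceAt_card_le {t : ℝ} {ℓ : ℕ} {Z : Finset (Ext α k)} (hZ : Z.card ≤ k) (n : ℕ) :
    (guidanceAt t ℓ Z n).card ≤ k := by
  unfold guidanceAt
  split_ifs
  · exact hZ
  · simp

/-- The better one of two sets, without its dummy elements. -/
noncomputable def bestOf (f : Finset α → ℝ) (Z A : Finset (Ext α k)) : Finset α :=
  open Classical in if f A.toLeft ≤ f Z.toLeft then Z.toLeft else A.toLeft

theorem left_le_bestOf (f : Finset α → ℝ) (Z A : Finset (Ext α k)) :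
    f Z.toLeft ≤ f (bestOf f Z A) := by
  unfold bestOf
  split_ifs with h
  · exact le_rfl
  · exact (not_le.1 h).le

theorem right_le_bestOf (f : Finset α → ℝ) (Z A : Finset (Ext α k)) :
    dummyExt f A ≤ f (bestOf f Z A) := by
  unfold bestOf
  split_ifs with h
  · exact h
  · exact le_rfl

theorem bestOf_feasible {I : Finset α → Prop} {f : Finset α → ℝ} {Z A : Finset (Ext α k)}
    (hZ : I Z.toLeft) (hA : I A.toLeft) : I (bestOf f Z A) := by
  unfold bestOf
  split_ifs
  · exact hZ
  · exact hA

section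

variable [DecidableEq α]

theorem run_better (f : Finset α → ℝ) (Z A : Finset (Ext α k)) :
    (better Z A).run f = some (bestOf f Z A) := by
  simp only [better, QueryProg.run_ask, QueryProg.run_ret, bestOf]
  rw [QueryProg.answers_of_mem f (by simp), QueryProg.answers_of_mem f (by simp)]

theorem queries_better_le (f : Finset α → ℝ) (Z A : Finset (Ext α k)) :
    (better Z A).queries f ≤ 2 := by
  simp only [better, QueryProg.queries_ask, QueryProg.queries_ret, add_zero]
  exact card_le_two

/-- Submodularity for O ∪ A and O ∪ Z, which meet exactly in O. Only the proper elements need to be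
disjoint. -/
theorem dummyExt_union_of_disjoint {f : Finset α → ℝ} (hf : IsSubmodular f)
    (O : Finset (Ext α k)) {Z A : Finset (Ext α k)} (h : Disjoint A.toLeft Z.toLeft) :
    dummyExt f O + dummyExt f (O ∪ Z ∪ A) ≤ dummyExt f (O ∪ A) + dummyExt f (O ∪ Z) := by
  simp only [dummyExt, toLeft_union]
  have := hf (O.toLeft ∪ A.toLeft) (O.toLeft ∪ Z.toLeft)
  have e1 : O.toLeft ∪ A.toLeft ∪ (O.toLeft ∪ Z.toLeft) = O.toLeft ∪ Z.toLeft ∪ A.toLeft := by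
    ext; simp only [mem_union]; tauto
  rw [e1, ← union_inter_distrib_left, disjoint_iff_inter_eq_empty.1 h, union_empty] at this
  linarith

/-- Two applications of submodularity: (O \ Z) ∪ A and O ∪ Z meet in O \ Z as A avoids Z, and f(O \
Z) ≥ f(O) - f(O ∩ Z) by nonnegativity. -/
theorem dummyExt_sdiff_union_of_disjoint {f : Finset α → ℝ} (hf : IsSubmodular f)
    (h0 : ∀ S, 0 ≤ f S) (O : Finset (Ext α k)) {Z A : Finset (Ext α k)}
    (h : Disjoint A.toLeft Z.toLeft) :
    dummyExt f O - dummyExt f (O ∩ Z) - dummyExt f (O ∪ Z) + dummyExt f (O ∪ Z ∪ A) ≤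
      dummyExt f ((O \ Z) ∪ A) := by
  simp only [dummyExt, toLeft_union, toLeft_inter, toLeft_sdiff]
  generalize O.toLeft = O, Z.toLeft = Z, A.toLeft = A at h ⊢
  have h1 := hf ((O \ Z) ∪ A) (O ∪ Z)
  have e1 : (O \ Z) ∪ A ∪ (O ∪ Z) = O ∪ Z ∪ A := by
    ext; simp only [mem_union, mem_sdiff]; tauto
  have e2 : ((O \ Z) ∪ A) ∩ (O ∪ Z) = (O \ Z) ∪ (A ∩ O) := by
    ext x
    have : x ∈ A → x ∉ Z := fun hx => disjoint_left.1 h hx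
    simp only [mem_union, mem_sdiff, mem_inter]; tauto
  have e3 : (O \ Z) ∪ (A ∩ O) = O \ Z := by
    ext x
    have : x ∈ A → x ∉ Z := fun hx => disjoint_left.1 h hx
    simp only [mem_union, mem_sdiff, mem_inter]; tauto
  have h2 := hf (O \ Z) (O ∩ Z)
  rw [e1, e2, e3] at h1
  rw [sdiff_union_inter] at h2
  linarith [h0 (O \ Z ∩ (O ∩ Z))]

end

theorem disjoint_toLeft {β γ : Type*} {S T : Finset (β ⊕ γ)} (h : Disjoint S T) :
    Disjoint S.toLeft T.toLeft := by
  rw [disjoint_left] at h ⊢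
  intro x hx hx'
  exact h (mem_toLeft.1 hx) (mem_toLeft.1 hx')

theorem le_expect_of_mul_le_sum {ℓ : ℕ} (hℓ : 0 < ℓ) {c : ℝ} {X : Fin ℓ → ℝ}
    (h : ℓ * c ≤ ∑ l, X l) : c ≤ 𝔼 l, X l := by
  have hℓR : (0 : ℝ) < ℓ := by exact_mod_cast hℓ
  rw [Fintype.expect_eq_sum_div_card, Fintype.card_fin, le_div_iff₀ hℓR]
  linarith

variable [Fintype α] [DecidableEq α] {ℓ : ℕ}

/-- The state of the algorithm for the size constraint after one more step. -/
noncomputable def sizeStep (f : Finset α → ℝ) (t : ℝ)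
    (top : Finset (Ext α k) → (Ext α k → ℝ) → Fin ℓ → Ext α k)
    (argmax : Finset (Ext α k) → (Ext α k → ℝ) → Ext α k) (Z : Finset (Ext α k)) (n : ℕ)
    (A : Finset (Ext α k)) (c : Option (Fin ℓ) × Fin ℓ) : Finset (Ext α k) :=
  (guidedIGS k ℓ top argmax (guidanceAt t ℓ Z n) A c).run f

theorem size_invariant {f : Finset α → ℝ} (hf : IsSubmodular f) (hk : 0 < k) (hℓ : 0 < ℓ)
    (hℓk : ℓ ∣ k) {top : Finset (Ext α k) → (Ext α k → ℝ) → Fin ℓ → Ext α k} (htop : IsTop ℓ top)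
    {argmax : Finset (Ext α k) → (Ext α k → ℝ) → Ext α k} (hmax : IsArgmax argmax)
    {Z : Finset (Ext α k)} (hZ : Z.card ≤ k) {t : ℝ} {m : ℕ} (ht : t = m / 1000) :
    ∀ n ≤ ℓ, ∀ ω, (trajectory (sizeStep f t top argmax Z) ∅ n ω).card = n * (k / ℓ) ∧
      (n ≤ m * ℓ / 1000 → Disjoint (trajectory (sizeStep f t top argmax Z) ∅ n ω) Z) := by
  refine trajectory_invariant
    (Inv := fun n A => A.card = n * (k / ℓ) ∧ (n ≤ m * ℓ / 1000 → Disjoint A Z))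
    (s := ∅) (by simp) ?_
  rintro n hn A ⟨hA, hAZ⟩ c
  have hAk : A.card ≤ k := by
    rw [hA]
    calc n * (k / ℓ) ≤ ℓ * (k / ℓ) := Nat.mul_le_mul_right _ hn.le
      _ = k := Nat.mul_div_cancel' hℓk
  obtain ⟨h1, h2⟩ := guidedIGS_card_disjoint f (guidanceAt t ℓ Z n) hf hk hℓ hℓk htop hmax
    (guidanceAt_card_le hZ n) hAk c
  refine ⟨by rw [sizeStep, h1, hA]; ring, fun hq => ?_⟩
  rw [guidanceAt_eq ht, if_pos (by omega)] at h2
  rw [sizeStep, guidanceAt_eq ht, if_pos (by omega)]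
  exact h2 (hAZ (by omega))

/-- The event consists of the runs that always take the good branch for the current iterate. It is
fixed by `u` before any candidate within the branch is drawn, so the conditioned process is again
one with ℓ uniform independent choices per step. -/
theorem exists_size_event {f : Finset α → ℝ} (hf0 : ∀ S, 0 ≤ f S) (hf : IsSubmodular f)
    (hk : 0 < k) {ε : ℝ} (hε : 0 < ε) (hℓε : ℓ = ⌈10 / (9 * ε)⌉₊) (hℓk : ℓ ∣ k)
    {top : Finset (Ext α k) → (Ext α k → ℝ) → Fin ℓ → Ext α k} (htop : IsTop ℓ top)
    {argmax : Finset (Ext α k) → (Ext α k → ℝ) → Ext α k} (hmax : IsArgmax argmax)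
    {O : Finset α} (hO : O.card ≤ k) (hV : 0 < f O)
    {Z : Finset (Ext α k)} (hZ : IsLocalOpt (SizeFeasible k) k ε f Z) :
    ∃ S : Finset (Fin ℓ → Option (Fin ℓ) × Fin ℓ), (S.dens : ℝ) = ((ℓ + 1 : ℝ) ^ ℓ)⁻¹ ∧
      (0.385 - ε) * f O ≤
        𝔼 ω ∈ S, f (bestOf f Z (trajectory (sizeStep f 0.372 top argmax Z) ∅ ℓ ω)) := by
  obtain ⟨hℓ, -, -⟩ := ceil_bounds hε hℓε
  have hℓR : (0 : ℝ) < ℓ := by exact_mod_cast hℓ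
  have hne : Nonempty (Fin ℓ) := ⟨⟨0, hℓ⟩⟩
  have hF := hf.dummyExt (k := k)
  have hF0 : ∀ S : Finset (Ext α k), 0 ≤ dummyExt f S := fun S => hf0 _
  have ht : (0.372 : ℝ) = (372 : ℕ) / 1000 := by norm_num
  set q := 372 * ℓ / 1000 with hq
  have hqℓ : q ≤ ℓ := by omega
  set W : Finset (Ext α k) := O.disjSum ∅ with hW
  have hWO : W.toLeft = O := by ext; simp [hW, -disjSum_empty]
  have hWk : W.card ≤ k := by simpa [hW] using hO
  have hbranch : ∀ (n : ℕ) (A : Finset (Ext α k)), ∃ u : Option (Fin ℓ), A.card ≤ k →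
      (∀ l, dummyExt f ((W \ guidanceAt 0.372 ℓ Z n) ∪ sizeStep f 0.372 top argmax Z n A (u, l)) -
          dummyExt f (sizeStep f 0.372 top argmax Z n A (u, l)) ≤
        ℓ * (dummyExt f (sizeStep f 0.372 top argmax Z n A (u, l)) - dummyExt f A)) ∧
      ∀ X, W \ guidanceAt 0.372 ℓ Z n ⊆ X → ((ℓ : ℝ) - 1) * dummyExt f (X ∪ A) ≤
        ∑ l, dummyExt f (X ∪ sizeStep f 0.372 top argmax Z n A (u, l)) := by
    intro n A
    by_cases hA : A.card ≤ k
    · obtain ⟨u, hu⟩ := exists_guidedIGS_branch f (guidanceAt 0.372 ℓ Z n) hf0 hf hk hℓ hℓk htop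
        hmax (guidanceAt_card_le hZ.1.2.le n) hA hWk
      exact ⟨u, fun _ => hu _ fun _ => rfl⟩
    · exact ⟨none, fun h => absurd h hA⟩
  choose u hu using hbranch
  obtain ⟨Φ, hΦ, htraj⟩ := exists_coupling (sizeStep f 0.372 top argmax Z)
    (fun n A l => (u n A, l)) (fun n A l l' h => (Prod.ext_iff.1 h).2) ∅ ℓ
  refine ⟨univ.image Φ, ?_, ?_⟩
  -- The event has ℓ^ℓ of the ((ℓ + 1)ℓ)^ℓ runs.
  · rw [nnratCast_dens, card_image_of_injective _ hΦ]
    simp only [card_univ, Fintype.card_fun, Fintype.card_fin, Fintype.card_prod,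
      Fintype.card_option]
    push_cast
    rw [mul_pow]
    field_simp
  rw [expect_image hΦ.injOn]
  simp only [htraj]
  set step : ℕ → Finset (Ext α k) → Fin ℓ → Finset (Ext α k) :=
    fun n A l => sizeStep f 0.372 top argmax Z n A (u n A, l) with hstep
  by_cases hz : (0.385 - ε) * f O ≤ f Z.toLeft
  · exact le_expect univ_nonempty fun ω _ => hz.trans (left_le_bestOf f Z _)
  rw [not_le] at hz
  refine le_trans ?_ (expect_le_expect fun ω _ => right_le_bestOf f Z _)
  change _ ≤ meanAfter step ∅ ℓ (dummyExt f)
  have hI := isIndepSystem_sizeFeasible (α := α) k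
  have hIU := hZ.value_union_add_inter_le hI hk (fun _ h => h) hε.le hf0 hf (X := O) hO
  have hIb := hZ.value_inter_le hI hk (fun _ h => h) hε.le hf0 hf O
  have hinv : ∀ n ≤ ℓ, ∀ ω, (trajectory step ∅ n ω).card ≤ k ∧
      (n ≤ q → Disjoint (trajectory step ∅ n ω) Z) := by
    refine fun n hn ω => ?_
    -- States of the good-branch process are states of the full process, so its invariant carries
    -- over.
    obtain ⟨Ψ, -, hΨ⟩ := exists_coupling (sizeStep f 0.372 top argmax Z)
      (fun n A l => (u n A, l)) (fun n A l l' h => (Prod.ext_iff.1 h).2) ∅ n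
    have h := size_invariant hf hk hℓ hℓk htop hmax hZ.1.2.le ht n hn (Ψ ω)
    rw [hΨ ω] at h
    refine ⟨?_, h.2⟩
    rw [h.1]
    calc n * (k / ℓ) ≤ ℓ * (k / ℓ) := Nat.mul_le_mul_right _ hn
      _ = k := Nat.mul_div_cancel' hℓk
  have hUdef : f (Z.toLeft ∪ O) = dummyExt f (W ∪ Z) := by
    rw [dummyExt, toLeft_union, hWO, union_comm]
  have hIdef : f (Z.toLeft ∩ O) = dummyExt f (W ∩ Z) := by
    rw [dummyExt, toLeft_inter, hWO, inter_comm]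
  have hVdef : f O = dummyExt f W := by rw [dummyExt, hWO]
  rw [hUdef, hIdef] at hIU
  rw [hIdef] at hIb
  have hspread : ∀ n < ℓ, ∀ X, W \ guidanceAt 0.372 ℓ Z n ⊆ X →
      (1 - 1 / (ℓ : ℝ)) * meanAfter step ∅ n (fun A => dummyExt f (X ∪ A)) ≤
        meanAfter step ∅ (n + 1) fun A => dummyExt f (X ∪ A) := by
    intro n hn X hX
    rw [meanAfter_succ, ← meanAfter_mul]
    refine meanAfter_le (Inv := fun A => A.card ≤ k ∧ (n ≤ q → Disjoint A Z)) (hinv n hn.le)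
      fun A hA => le_expect_of_mul_le_sum hℓ ?_
    refine le_trans (le_of_eq ?_) ((hu n A hA.1).2 X hX)
    field_simp
  have hguid : ∀ n < q, guidanceAt 0.372 ℓ Z n = Z := fun n hn => by
    rw [guidanceAt_eq ht, if_pos hn]
  have hguid' : ∀ n, q ≤ n → guidanceAt 0.372 ℓ Z n = ∅ := fun n hn => by
    rw [guidanceAt_eq ht, if_neg (not_lt.2 hn)]
  refine (size_guarantee (I := dummyExt f (W ∩ Z)) (U := dummyExt f (W ∪ Z)) hε hℓε hV
    (hf0 _) hz hIb (by linarith) hq).trans ?_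
  refine size_recurrence_bound hℓ hqℓ (a := fun n => meanAfter step ∅ n (dummyExt f))
    (w := fun n => meanAfter step ∅ n fun A => dummyExt f (W ∪ Z ∪ A))
    (x := fun n => meanAfter step ∅ n fun A => dummyExt f (W ∪ A))
    (y := fun n => meanAfter step ∅ (n + 1) fun A => dummyExt f ((W \ guidanceAt 0.372 ℓ Z n) ∪ A))
    (fun n => meanAfter_nonneg hF0) (fun n _ => meanAfter_nonneg fun _ => hF0 _)
    ?_ ?_ ?_ ?_ ?_ ?_ ?_
  · intro n hn
    rw [← meanAfter_mul, ← meanAfter_mul, ← le_sub_iff_add_le, ← meanAfter_sub, meanAfter_succ]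
    refine meanAfter_le (Inv := fun A => A.card ≤ k ∧ (n ≤ q → Disjoint A Z)) (hinv n hn.le)
      fun A hA => le_expect univ_nonempty fun l _ => ?_
    have := (hu n A hA.1).1 l
    simp only [hstep]
    linarith
  · simp [meanAfter_zero]
  · intro n hn
    exact hspread n (by omega) (W ∪ Z) (sdiff_subset.trans subset_union_left)
  · intro n hn
    rw [hguid n hn, hVdef, ← meanAfter_const (step := step) (s := ∅) (n := n + 1)
      (dummyExt f W - dummyExt f (W ∩ Z) - dummyExt f (W ∪ Z)), ← meanAfter_add]
    exact meanAfter_le (Inv := fun A => A.card ≤ k ∧ (n + 1 ≤ q → Disjoint A Z))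
      (hinv (n + 1) (by omega)) fun A hA =>
      dummyExt_sdiff_union_of_disjoint hf hf0 W (disjoint_toLeft (hA.2 (by omega)))
  · rw [hVdef, ← meanAfter_const (step := step) (s := ∅) (n := q)
      (dummyExt f W - dummyExt f (W ∪ Z)), ← meanAfter_add]
    refine meanAfter_le (Inv := fun A => A.card ≤ k ∧ (q ≤ q → Disjoint A Z)) (hinv q hqℓ)
      fun A hA => ?_
    have := dummyExt_union_of_disjoint hf W (disjoint_toLeft (hA.2 le_rfl))
    linarith
  · intro n _ hn
    exact hspread n hn W sdiff_subset
  · intro n hqn _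
    rw [hguid' n hqn, sdiff_empty]

/-- The state of the algorithm for a matroid constraint after one more step. -/
noncomputable def matroidStep (I : Finset α → Prop) (f : Finset α → ℝ) (t : ℝ)
    (argmax : Finset (Fin ℓ × Ext α k) → (Fin ℓ × Ext α k → ℝ) → Fin ℓ × Ext α k)
    (exch : Finset (Ext α k) → (Fin ℓ → Finset (Ext α k)) → Ext α k → Ext α k)
    (Z : Finset (Ext α k)) (n : ℕ) (A : Finset (Ext α k)) (c : Fin ℓ) : Finset (Ext α k) :=
  (guidedIGM I k ℓ argmax exch (guidanceAt t ℓ Z n) A c).run f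

end Analysis

/-! ### Analysis under a matroid constraint -/

section MatroidAnalysis

variable {α : Type u} {k ℓ : ℕ}

theorem toLeft_pad (S : Finset α) : (pad k S).toLeft = S := by
  ext; simp [pad, -disjSum_empty]

variable [Fintype α] [DecidableEq α]

theorem exists_matroidStep_spec {I : Finset α → Prop} (hI : IsIndepSystem I) {f : Finset α → ℝ}
    (hf0 : ∀ S, 0 ≤ f S) (hf : IsSubmodular f) (hℓ : 0 < ℓ)
    {argmax : Finset (Fin ℓ × Ext α k) → (Fin ℓ × Ext α k → ℝ) → Fin ℓ × Ext α k}
    (hmax : IsArgmax argmax)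
    {exch : Finset (Ext α k) → (Fin ℓ → Finset (Ext α k)) → Ext α k → Ext α k}
    (hexch : SelectsExchange I k ℓ exch) {Z W : Finset (Ext α k)} (hZ : Z.card ≤ k)
    (hW : ExtFeasible I k W) (t : ℝ) (n : ℕ) (A : Finset (Ext α k)) :
    ∃ P : Fin ℓ → Finset (Ext α k), ExtBasis I k A →
      (∀ l, ExtBasis I k (matroidStep I f t argmax exch Z n A l)) ∧
      (∀ l, matroidStep I f t argmax exch Z n A l ⊆ A ∪ P l) ∧
      (∀ l, Disjoint (P l) (guidanceAt t ℓ Z n)) ∧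
      ℓ * dummyExt f A + 𝔼 l, dummyExt f ((W \ guidanceAt t ℓ Z n) ∪ (A ∪ P l)) ≤
        (ℓ + 1) * 𝔼 l, dummyExt f (A ∪ P l) ∧
      𝔼 l, dummyExt f (A ∪ P l) - dummyExt f A / ℓ ≤
        𝔼 l, dummyExt f (matroidStep I f t argmax exch Z n A l) ∧
      (∀ X, (1 - 2 / (ℓ : ℝ)) * dummyExt f (X ∪ A) + dummyExt f X / ℓ ≤
        𝔼 l, dummyExt f (X ∪ matroidStep I f t argmax exch Z n A l)) ∧
      ∀ X, (1 - 1 / (ℓ : ℝ)) * dummyExt f (X ∪ A) ≤ 𝔼 l, dummyExt f (X ∪ (A ∪ P l)) := by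
  by_cases hA : ExtBasis I k A
  · have hℓR : (0 : ℝ) < ℓ := by exact_mod_cast hℓ
    obtain ⟨P, B, hrun, hB, hBP, hPZ, h1, h2, h3, h4⟩ := guidedIGM_spec hI hf0 hf hℓ hmax hexch
      (guidanceAt_card_le (t := t) (ℓ := ℓ) hZ n) hA hW
    refine ⟨P, fun _ => ?_⟩
    simp only [matroidStep, hrun, Fintype.expect_eq_sum_div_card, Fintype.card_fin]
    refine ⟨hB, hBP, hPZ, ?_, ?_, fun X => ?_, fun X => ?_⟩
    · rw [sum_sub_distrib, sum_sub_distrib, sum_const, card_univ, Fintype.card_fin,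
        nsmul_eq_mul] at h1
      rw [← sub_nonneg]
      have : 0 ≤ ((ℓ + 1) * ∑ l, dummyExt f (A ∪ P l) - ℓ * (ℓ * dummyExt f A) -
          ∑ l, dummyExt f ((W \ guidanceAt t ℓ Z n) ∪ (A ∪ P l))) / ℓ :=
        div_nonneg (by linarith) hℓR.le
      refine this.trans_eq ?_
      field_simp
      ring
    · rw [← sub_div]
      exact div_le_div_of_nonneg_right h2 hℓR.le
    · rw [le_div_iff₀ hℓR]
      refine le_trans (le_of_eq ?_) (h3 X)
      field_simp
    · rw [le_div_iff₀ hℓR]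
      refine le_trans (le_of_eq ?_) (h4 X)
      field_simp
  · exact ⟨fun _ => ∅, fun h => absurd h hA⟩

/-- Disjointness is claimed for the proper elements only: the initial basis consists of dummies and
may share some with `Z`. -/
theorem matroid_invariant {I : Finset α → Prop} (hI : IsIndepSystem I) {f : Finset α → ℝ}
    (hf0 : ∀ S, 0 ≤ f S) (hf : IsSubmodular f) (hℓ : 0 < ℓ)
    {argmax : Finset (Fin ℓ × Ext α k) → (Fin ℓ × Ext α k → ℝ) → Fin ℓ × Ext α k}
    (hmax : IsArgmax argmax)
    {exch : Finset (Ext α k) → (Fin ℓ → Finset (Ext α k)) → Ext α k → Ext α k}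
    (hexch : SelectsExchange I k ℓ exch) {Z : Finset (Ext α k)} (hZ : Z.card ≤ k) {t : ℝ} {m : ℕ}
    (ht : t = m / 1000) (n : ℕ) (ω : Fin n → Fin ℓ) :
    ExtBasis I k (trajectory (matroidStep I f t argmax exch Z) (pad k ∅) n ω) ∧
      (n ≤ m * ℓ / 1000 → Disjoint
        (trajectory (matroidStep I f t argmax exch Z) (pad k ∅) n ω).toLeft Z.toLeft) := by
  refine trajectory_invariant (N := n)
    (Inv := fun n A => ExtBasis I k A ∧ (n ≤ m * ℓ / 1000 → Disjoint A.toLeft Z.toLeft))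
    ⟨extBasis_pad hI.empty (by simp), fun _ => by simp [toLeft_pad]⟩ ?_ n le_rfl ω
  rintro n - A ⟨hA, hAZ⟩ c
  obtain ⟨P, hP⟩ := exists_matroidStep_spec hI hf0 hf hℓ hmax hexch hZ
    (hI.extFeasible k).empty t n A
  obtain ⟨hB, hBP, hPZ, -⟩ := hP hA
  refine ⟨hB c, fun hq => disjoint_of_subset_left (toLeft_subset_toLeft (hBP c)) ?_⟩
  have h := hPZ c
  rw [guidanceAt_eq ht, if_pos (by omega)] at h
  rw [toLeft_union]
  exact disjoint_union_left.2 ⟨hAZ (by omega), disjoint_toLeft h⟩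

theorem le_expect_matroid {I : Finset α → Prop} (hI : IsIndepSystem I)
    (hIk : ∀ S, I S → S.card ≤ k) {f : Finset α → ℝ}
    (hf0 : ∀ S, 0 ≤ f S) (hf : IsSubmodular f) (hk : 0 < k) {ε : ℝ} (hε : 0 < ε)
    (hℓε : ℓ = ⌈10 / (9 * ε)⌉₊)
    {argmax : Finset (Fin ℓ × Ext α k) → (Fin ℓ × Ext α k → ℝ) → Fin ℓ × Ext α k}
    (hmax : IsArgmax argmax)
    {exch : Finset (Ext α k) → (Fin ℓ → Finset (Ext α k)) → Ext α k → Ext α k}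
    (hexch : SelectsExchange I k ℓ exch) {O : Finset α} (hO : I O) (hV : 0 < f O)
    {Z : Finset (Ext α k)} (hZ : IsLocalOpt I k ε f Z) :
    (0.305 - ε) * f O ≤
      𝔼 ω, f (bestOf f Z (trajectory (matroidStep I f 0.559 argmax exch Z) (pad k ∅) ℓ ω)) := by
  obtain ⟨hℓ, -, -⟩ := ceil_bounds hε hℓε
  have hne : Nonempty (Fin ℓ) := ⟨⟨0, hℓ⟩⟩
  have hF0 : ∀ S : Finset (Ext α k), 0 ≤ dummyExt f S := fun S => hf0 _
  have ht : (0.559 : ℝ) = (559 : ℕ) / 1000 := by norm_num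
  by_cases hz : (0.305 - ε) * f O ≤ f Z.toLeft
  · exact le_expect univ_nonempty fun ω _ => hz.trans (left_le_bestOf f Z _)
  rw [not_le] at hz
  set q := 559 * ℓ / 1000 with hq
  have hqℓ : q ≤ ℓ := by omega
  set W : Finset (Ext α k) := O.disjSum ∅ with hW
  have hWO : W.toLeft = O := by ext; simp [hW, -disjSum_empty]
  have hWk : ExtFeasible I k W := ⟨hWO ▸ hO, by simpa [hW] using hIk O hO⟩
  -- `P n A l` is the part that the `l`-th candidate adds before the exchange. Gain and disjointness
  -- from `Z` are known for A ∪ P, whereas the next iterate is the exchanged set.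
  choose P hP using exists_matroidStep_spec hI hf0 hf hℓ hmax hexch hZ.1.2.le hWk 0.559
  set step := matroidStep I f 0.559 argmax exch Z with hstep
  refine le_trans ?_ (expect_le_expect fun ω _ => right_le_bestOf f Z _)
  change _ ≤ meanAfter step (pad k ∅) ℓ (dummyExt f)
  have hIU := hZ.value_union_add_inter_le hI hk hIk hε.le hf0 hf (X := O) hO
  have hIb := hZ.value_inter_le hI hk hIk hε.le hf0 hf O
  have hinv : ∀ n ω, ExtBasis I k (trajectory step (pad k ∅) n ω) ∧ (n ≤ q →
      Disjoint (trajectory step (pad k ∅) n ω).toLeft Z.toLeft) :=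
    matroid_invariant hI hf0 hf hℓ hmax hexch hZ.1.2.le ht
  have hmono : ∀ (n : ℕ) (g g' : Finset (Ext α k) → ℝ),
      (∀ A, ExtBasis I k A → (n ≤ q → Disjoint A.toLeft Z.toLeft) → g A ≤ g' A) →
        meanAfter step (pad k ∅) n g ≤ meanAfter step (pad k ∅) n g' := fun n g g' h =>
    meanAfter_le
      (Inv := fun A => ExtBasis I k A ∧ (n ≤ q → Disjoint A.toLeft Z.toLeft)) (hinv n)
      fun A hA => h A hA.1 hA.2
  have hUdef : f (Z.toLeft ∪ O) = dummyExt f (W ∪ Z) := by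
    rw [dummyExt, toLeft_union, hWO, union_comm]
  have hIdef : f (Z.toLeft ∩ O) = dummyExt f (W ∩ Z) := by
    rw [dummyExt, toLeft_inter, hWO, inter_comm]
  have hVdef : f O = dummyExt f W := by rw [dummyExt, hWO]
  rw [hUdef, hIdef] at hIU
  rw [hIdef] at hIb
  have hspread : ∀ n X, (1 - 2 / (ℓ : ℝ)) * meanAfter step (pad k ∅) n
      (fun A => dummyExt f (X ∪ A)) + dummyExt f X / ℓ ≤
        meanAfter step (pad k ∅) (n + 1) fun A => dummyExt f (X ∪ A) := by
    intro n X
    rw [meanAfter_succ, ← meanAfter_mul, ← meanAfter_const (step := step) (s := pad k ∅) (n := n)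
      (dummyExt f X / ℓ), ← meanAfter_add]
    exact hmono _ _ _ fun A hA _ => (hP n A hA).2.2.2.2.2.1 X
  have hguid : ∀ n < q, guidanceAt 0.559 ℓ Z n = Z := fun n hn => by
    rw [guidanceAt_eq ht, if_pos hn]
  have hguid' : ∀ n, q ≤ n → guidanceAt 0.559 ℓ Z n = ∅ := fun n hn => by
    rw [guidanceAt_eq ht, if_neg (not_lt.2 hn)]
  obtain ⟨hℓ2, hUV, hbound⟩ := matroid_guarantee (I := dummyExt f (W ∩ Z))
    (U := dummyExt f (W ∪ Z)) hε hℓε hV (hf0 _) hz (hF0 _) hIb (by linarith) hq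
  refine hbound.trans ?_
  refine matroid_recurrence_bound hℓ2 hqℓ (a := fun n => meanAfter step (pad k ∅) n (dummyExt f))
    (w := fun n => meanAfter step (pad k ∅) n fun A => dummyExt f (W ∪ Z ∪ A))
    (x := fun n => meanAfter step (pad k ∅) n fun A => dummyExt f (W ∪ A))
    (φ := fun n => meanAfter step (pad k ∅) n fun A => 𝔼 l, dummyExt f (A ∪ P n A l))
    (y := fun n => meanAfter step (pad k ∅) n fun A =>
      𝔼 l, dummyExt f ((W \ guidanceAt 0.559 ℓ Z n) ∪ (A ∪ P n A l)))
    (hF0 _) hUV ?_ ?_ ?_ ?_ ?_ ?_ ?_ ?_ ?_ ?_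
  · exact fun _ => meanAfter_nonneg hF0
  · exact fun n _ => meanAfter_nonneg fun _ => expect_nonneg fun _ _ => hF0 _
  · intro n hn
    rw [← meanAfter_mul, ← meanAfter_mul, ← meanAfter_add]
    exact hmono _ _ _ fun A hA _ => (hP n A hA).2.2.2.1
  · intro n hn
    simp only [div_eq_inv_mul]
    rw [← meanAfter_mul, ← meanAfter_sub, meanAfter_succ]
    simp only [← div_eq_inv_mul]
    exact hmono _ _ _ fun A hA _ => (hP n A hA).2.2.2.2.1
  · rw [meanAfter_zero]
    simp only [dummyExt, toLeft_union, toLeft_pad, union_empty, le_rfl]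
  · exact fun n _ => hspread n (W ∪ Z)
  · intro n hn
    rw [hguid n hn, hVdef, ← meanAfter_mul, ← meanAfter_const (step := step) (s := pad k ∅) (n := n)
      (dummyExt f W - dummyExt f (W ∩ Z) - dummyExt f (W ∪ Z)), ← meanAfter_add]
    refine hmono _ _ _ fun A hA hAZ => ?_
    refine (add_le_add_right ((hP n A hA).2.2.2.2.2.2 (W ∪ Z)) _).trans ?_
    rw [← Fintype.expect_const (ι := Fin ℓ)
      (dummyExt f W - dummyExt f (W ∩ Z) - dummyExt f (W ∪ Z)), ← expect_add_distrib]
    refine expect_le_expect fun l _ => dummyExt_sdiff_union_of_disjoint hf hf0 W ?_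
    have h := (hP n A hA).2.2.1 l
    rw [hguid n hn] at h
    rw [toLeft_union]
    exact disjoint_union_left.2 ⟨hAZ hn.le, disjoint_toLeft h⟩
  · rw [hVdef, ← meanAfter_const (step := step) (s := pad k ∅) (n := q)
      (dummyExt f W - dummyExt f (W ∪ Z)), ← meanAfter_add]
    refine hmono _ _ _ fun A _ hAZ => ?_
    have := dummyExt_union_of_disjoint hf W (hAZ le_rfl)
    linarith
  · intro n _ _
    rw [hVdef]
    exact hspread n W
  · intro n hqn _
    rw [hguid' n hqn, sdiff_empty, ← meanAfter_mul]
    exact hmono _ _ _ fun A hA _ => (hP n A hA).2.2.2.2.2.2 W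

end MatroidAnalysis

/-! ### Runs and query counts of the complete algorithms -/

section Implementation

variable {α : Type u} [Fintype α] [DecidableEq α] {k ℓ N c : ℕ}

theorem card_toLeft_le_card {β γ : Type*} (S : Finset (β ⊕ γ)) : S.toLeft.card ≤ S.card := by
  rw [← card_toLeft_add_card_toRight (u := S)]
  exact Nat.le_add_right _ _

theorem run_sizeAlg {f : Finset α → ℝ} {t ε : ℝ}
    {swap : Finset (Ext α k × Ext α k) → Ext α k × Ext α k}
    {top : Finset (Ext α k) → (Ext α k → ℝ) → Fin ℓ → Ext α k}
    {argmax : Finset (Ext α k) → (Ext α k → ℝ) → Ext α k} {Z₀ : Finset α} {Z : Finset (Ext α k)}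
    (hZ : (fastLS (SizeFeasible k) k ε swap N (pad k Z₀)).run f = some Z)
    (ω : Fin ℓ → Option (Fin ℓ) × Fin ℓ) :
    (sizeAlg k t ε ℓ swap top argmax Z₀ N ω).run f =
      some (bestOf f Z (trajectory (sizeStep f t top argmax Z) ∅ ℓ ω)) := by
  rw [sizeAlg, QueryProg.run_bind, hZ]
  simp only [QueryProg.run_bind, QueryProg.run_foldlM, run_better]
  rfl

theorem queries_sizeAlg_le {f : Finset α → ℝ} {t ε : ℝ}
    {swap : Finset (Ext α k × Ext α k) → Ext α k × Ext α k}
    {top : Finset (Ext α k) → (Ext α k → ℝ) → Fin ℓ → Ext α k}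
    {argmax : Finset (Ext α k) → (Ext α k → ℝ) → Ext α k} {Z₀ : Finset α} {Z : Finset (Ext α k)}
    (hZ : (fastLS (SizeFeasible k) k ε swap N (pad k Z₀)).run f = some Z)
    (hc : (fastLS (SizeFeasible k) k ε swap N (pad k Z₀)).queries f ≤ c)
    (ω : Fin ℓ → Option (Fin ℓ) × Fin ℓ) :
    (sizeAlg k t ε ℓ swap top argmax Z₀ N ω).queries f ≤
      c + (ℓ * ((k + 1) * (Fintype.card α + 1)) + 2) := by
  rw [sizeAlg, QueryProg.queries_bind, hZ]
  simp only [QueryProg.queries_bind]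
  refine add_le_add hc (add_le_add ?_ (queries_better_le _ _ _))
  refine (QueryProg.queries_foldlM_le f _ ((k + 1) * (Fintype.card α + 1)) ?_ _ _).trans_eq ?_
  · exact fun _ _ => queries_guidedIGS_le _ _ _ _ _ _
  · rw [List.length_finRange]

theorem run_matroidAlg {f : Finset α → ℝ} {t ε : ℝ} {M : Matroid α}
    {swap : Finset (Ext α k × Ext α k) → Ext α k × Ext α k}
    {argmax : Finset (Fin ℓ × Ext α k) → (Fin ℓ × Ext α k → ℝ) → Fin ℓ × Ext α k}
    {exch : Finset (Ext α k) → (Fin ℓ → Finset (Ext α k)) → Ext α k → Ext α k}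
    {Z₀ : Finset α} {Z : Finset (Ext α k)}
    (hZ : (fastLS (MatroidFeasible M) k ε swap N (pad k Z₀)).run f = some Z)
    (ω : Fin ℓ → Fin ℓ) :
    (matroidAlg M k t ε ℓ swap argmax exch Z₀ N ω).run f = some (bestOf f Z
      (trajectory (matroidStep (MatroidFeasible M) f t argmax exch Z) (pad k ∅) ℓ ω)) := by
  rw [matroidAlg, QueryProg.run_bind, hZ]
  simp only [QueryProg.run_bind, QueryProg.run_foldlM, run_better]
  rfl

theorem queries_matroidAlg_le {f : Finset α → ℝ} {t ε : ℝ} {M : Matroid α}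
    {swap : Finset (Ext α k × Ext α k) → Ext α k × Ext α k}
    {argmax : Finset (Fin ℓ × Ext α k) → (Fin ℓ × Ext α k → ℝ) → Fin ℓ × Ext α k}
    {exch : Finset (Ext α k) → (Fin ℓ → Finset (Ext α k)) → Ext α k → Ext α k}
    {Z₀ : Finset α} {Z : Finset (Ext α k)}
    (hZ : (fastLS (MatroidFeasible M) k ε swap N (pad k Z₀)).run f = some Z)
    (hc : (fastLS (MatroidFeasible M) k ε swap N (pad k Z₀)).queries f ≤ c)
    (ω : Fin ℓ → Fin ℓ) :
    (matroidAlg M k t ε ℓ swap argmax exch Z₀ N ω).queries f ≤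
      c + (ℓ * ((k + 1) * (Fintype.card α + 1)) + 2) := by
  rw [matroidAlg, QueryProg.queries_bind, hZ]
  simp only [QueryProg.queries_bind]
  refine add_le_add hc (add_le_add ?_ (queries_better_le _ _ _))
  refine (QueryProg.queries_foldlM_le f _ ((k + 1) * (Fintype.card α + 1)) ?_ _ _).trans_eq ?_
  · exact fun _ _ => queries_guidedIGM_le _ _ _ _ _ _ _
  · rw [List.length_finRange]

/-- Bernoulli's inequality: ⌈k/(ε α₀)⌉ improvements multiply the value by at least 1 + 1/α₀, which
takes a value of at least α₀ V beyond V. -/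
theorem lt_pow_mul_of_fraction {ε α₀ V v : ℝ} (hk : 0 < k) (hε : 0 < ε) (hα₀ : 0 < α₀)
    (hV : 0 < V) (hv : α₀ * V ≤ v) :
    V < (1 + ε / k) ^ ⌈k / (ε * α₀)⌉₊ * v := by
  have hkR : (0 : ℝ) < k := by exact_mod_cast hk
  have h1 := one_add_mul_le_pow (a := ε / k) (by linarith [div_nonneg hε.le hkR.le] : -2 ≤ ε / k)
    ⌈k / (ε * α₀)⌉₊
  have h2 : 1 / α₀ ≤ ⌈k / (ε * α₀)⌉₊ * (ε / k) := by
    refine le_trans (le_of_eq ?_) (mul_le_mul_of_nonneg_right (Nat.le_ceil _) (by positivity))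
    field_simp
  calc V < (1 + 1 / α₀) * (α₀ * V) := by
        field_simp
        nlinarith
    _ ≤ _ := mul_le_mul (by linarith) hv (by positivity) (by positivity)

/-- All lower-order terms are absorbed using k, n ≥ 1 and 1/ε ≥ 9/10. The local search then costs at
most 3/α₀ + 10/3, the greedy calls 80/9 and the final comparison 20/9, in units of kn/ε. -/
theorem query_bound {ε α₀ : ℝ} {n : ℕ} (hk : 0 < k) (hn : 0 < n) (hε : 0 < ε) (hε' : ε ≤ 10 / 9)
    (hα₀ : 0 < α₀) (hℓ : ℓ = ⌈10 / (9 * ε)⌉₊) :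
    ((⌈k / (ε * α₀)⌉₊ * (2 * n + 1) + (ℓ * ((k + 1) * (n + 1)) + 2) : ℕ) : ℝ) ≤
      (3 / α₀ + 15) * (k * n / ε) := by
  obtain ⟨-, -, hℓε⟩ := ceil_bounds hε hℓ
  have hk1 : (1 : ℝ) ≤ k := by exact_mod_cast hk
  have hn1 : (1 : ℝ) ≤ n := by exact_mod_cast hn
  have hε1 : 9 / 10 ≤ 1 / ε := by
    rw [le_div_iff₀ hε]; linarith
  have hN : (⌈k / (ε * α₀)⌉₊ : ℝ) ≤ k / (ε * α₀) + 1 := (Nat.ceil_lt_add_one (by positivity)).le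
  have e1 : (k : ℝ) / (ε * α₀) = 1 / α₀ * (k * (1 / ε)) := by field_simp
  have e2 : 10 / (9 * ε) = 10 / 9 * (1 / ε) := by field_simp
  have e3 : (k : ℝ) * n / ε = k * n * (1 / ε) := by ring
  rw [e1] at hN
  rw [e2] at hℓε
  have e4 : (3 : ℝ) / α₀ = 3 * (1 / α₀) := by ring
  have hα1 : 0 < 1 / α₀ := by positivity
  push_cast
  rw [e1, e3, e4]
  generalize 1 / ε = δ at *
  generalize 1 / α₀ = β at *
  generalize (⌈β * (k * δ)⌉₊ : ℝ) = m at *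
  have hkn : (1 : ℝ) ≤ k * n := one_le_mul_of_one_le_of_one_le hk1 hn1
  have h1 : m * (2 * n + 1) ≤ (β * (k * δ) + 1) * (3 * n) :=
    mul_le_mul hN (by linarith) (by positivity) (by positivity)
  have h2 : ((k : ℝ) + 1) * (n + 1) ≤ 4 * (k * n) := by nlinarith
  have h3 : (ℓ : ℝ) * ((k + 1) * (n + 1)) ≤ (20 / 9 * δ) * (4 * (k * n)) :=
    mul_le_mul (by linarith) h2 (by positivity) (by positivity)
  have h4 : 9 / 10 * (k * n) ≤ δ * (k * n : ℝ) := by gcongr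
  have h5 : (n : ℝ) ≤ k * n := by nlinarith
  nlinarith

end Implementation

end SubmodMax

/-! ### The main theorem -/

theorem mainTheorem7 (α₀ : ℝ) (hα₀ : 0 < α₀) :
    ∃ C : ℝ, 0 < C ∧
      -- the size constraint
      (∀ (α : Type u) [Fintype α] [DecidableEq α] [Nonempty α] (f : Finset α → ℝ) (k : ℕ) (ε : ℝ)
        (ℓ : ℕ) (O Z₀ : Finset α)
        (swap : Finset (SubmodMax.Ext α k × SubmodMax.Ext α k) →
          SubmodMax.Ext α k × SubmodMax.Ext α k)
        (top : Finset (SubmodMax.Ext α k) → (SubmodMax.Ext α k → ℝ) → Fin ℓ → SubmodMax.Ext α k)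
        (argmax : Finset (SubmodMax.Ext α k) → (SubmodMax.Ext α k → ℝ) → SubmodMax.Ext α k),
        (∀ S, 0 ≤ f S) → SubmodMax.IsSubmodular f →
        0 < k → 0 < ε → ε ≤ 10 / 9 → ℓ = ⌈10 / (9 * ε)⌉₊ → ℓ ∣ k →
        SubmodMax.IsOptimal f (SubmodMax.SizeFeasible k) O → 0 < f O →
        SubmodMax.SizeFeasible k Z₀ → α₀ * f O ≤ f Z₀ →
        SubmodMax.IsChoice swap → SubmodMax.IsTop ℓ top → SubmodMax.IsArgmax argmax →
        ∃ (N : ℕ) (out : (Fin ℓ → Option (Fin ℓ) × Fin ℓ) → Finset α),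
          (∀ ω, (SubmodMax.sizeAlg k 0.372 ε ℓ swap top argmax Z₀ N ω).run f = some (out ω) ∧
            ((SubmodMax.sizeAlg k 0.372 ε ℓ swap top argmax Z₀ N ω).queries f : ℝ) ≤
              C * (k * Fintype.card α / ε)) ∧
          (∀ ω, SubmodMax.SizeFeasible k (out ω)) ∧
          ∃ E : Finset (Fin ℓ → Option (Fin ℓ) × Fin ℓ),
            (E.dens : ℝ) = ((ℓ + 1 : ℝ) ^ ℓ)⁻¹ ∧
            (0.385 - ε) * f O ≤ 𝔼 ω ∈ E, f (out ω)) ∧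
      -- the matroid constraint
      (∀ (α : Type u) [Fintype α] [DecidableEq α] (M : Matroid α) (f : Finset α → ℝ) (k : ℕ) (ε : ℝ)
        (ℓ : ℕ) (O Z₀ : Finset α)
        (swap : Finset (SubmodMax.Ext α k × SubmodMax.Ext α k) →
          SubmodMax.Ext α k × SubmodMax.Ext α k)
        (argmax : Finset (Fin ℓ × SubmodMax.Ext α k) → (Fin ℓ × SubmodMax.Ext α k → ℝ) →
          Fin ℓ × SubmodMax.Ext α k)
        (exch : Finset (SubmodMax.Ext α k) → (Fin ℓ → Finset (SubmodMax.Ext α k)) →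
          SubmodMax.Ext α k → SubmodMax.Ext α k),
        (∀ S, 0 ≤ f S) → SubmodMax.IsSubmodular f →
        M.E = Set.univ → M.eRank = k → 0 < k → 0 < ε → ε ≤ 10 / 9 → ℓ = ⌈10 / (9 * ε)⌉₊ →
        SubmodMax.IsOptimal f (SubmodMax.MatroidFeasible M) O → 0 < f O →
        SubmodMax.MatroidFeasible M Z₀ → α₀ * f O ≤ f Z₀ →
        SubmodMax.IsChoice swap → SubmodMax.IsArgmax argmax →
        SubmodMax.SelectsExchange (SubmodMax.MatroidFeasible M) k ℓ exch →
        ∃ (N : ℕ) (out : (Fin ℓ → Fin ℓ) → Finset α),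
          (∀ ω, (SubmodMax.matroidAlg M k 0.559 ε ℓ swap argmax exch Z₀ N ω).run f =
              some (out ω) ∧
            ((SubmodMax.matroidAlg M k 0.559 ε ℓ swap argmax exch Z₀ N ω).queries f : ℝ) ≤
              C * (k * Fintype.card α / ε)) ∧
          (∀ ω, SubmodMax.MatroidFeasible M (out ω)) ∧
          (0.305 - ε) * f O ≤ 𝔼 ω, f (out ω)) := by
  refine ⟨3 / α₀ + 15, by positivity, ?_, ?_⟩
  · intro α _ _ _ f k ε ℓ O Z₀ swap top argmax hf0 hf hk hε hε' hℓ hℓk hO hV hZ₀ hα hswap htop hmax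
    have hI := SubmodMax.isIndepSystem_sizeFeasible (α := α) k
    have hpad := SubmodMax.extBasis_pad (k := k) hZ₀ hZ₀
    obtain ⟨Z, hrun, hZ, hq⟩ := SubmodMax.fastLS_terminates hf hε.le hswap hO.2
      ⌈k / (ε * α₀)⌉₊ _ hpad (by
        rw [SubmodMax.dummyExt, SubmodMax.toLeft_pad]
        exact SubmodMax.lt_pow_mul_of_fraction hk hε hα₀ hV hα)
    obtain ⟨E, hE, hbound⟩ :=
      SubmodMax.exists_size_event hf0 hf hk hε hℓ hℓk htop hmax hO.1 hV hZ
    refine ⟨_, _, fun ω => ⟨SubmodMax.run_sizeAlg hrun ω, ?_⟩, fun ω => ?_, E, hE, hbound⟩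
    · exact (Nat.cast_le.2 (SubmodMax.queries_sizeAlg_le hrun hq ω)).trans
        (SubmodMax.query_bound hk Fintype.card_pos hε hε' hα₀ hℓ)
    · refine SubmodMax.bestOf_feasible hZ.1.1 ((SubmodMax.card_toLeft_le_card _).trans ?_)
      have h := (SubmodMax.size_invariant hf hk (SubmodMax.ceil_bounds hε hℓ).1 hℓk htop hmax
        hZ.1.2.le (t := 0.372) (m := 372) (by norm_num) ℓ le_rfl ω).1
      rw [h, Nat.mul_div_cancel' hℓk]
  · intro α _ _ M f k ε ℓ O Z₀ swap argmax exch hf0 hf _ hM hk hε hε' hℓ hO hV hZ₀ hα hswap hmax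
      hexch
    have hI := SubmodMax.isIndepSystem_matroidFeasible M
    have hIk : ∀ S, SubmodMax.MatroidFeasible M S → S.card ≤ k := fun S hS =>
      SubmodMax.MatroidFeasible.card_le hM hS
    -- Positive rank forces a nonempty ground set, which the query bound needs as n ≥ 1.
    have hne : Nonempty α := by
      by_contra hα'
      rw [not_nonempty_iff] at hα'
      have h0 : M.eRank = 0 := by
        rw [← M.eRk_ground, M.E.eq_empty_of_isEmpty, M.eRk_empty]
      rw [h0] at hM
      exact hk.ne (by exact_mod_cast hM)
    obtain ⟨Z, hrun, hZ, hq⟩ := SubmodMax.fastLS_terminates hf hε.le hswap hO.2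
      ⌈k / (ε * α₀)⌉₊ _ (SubmodMax.extBasis_pad hZ₀ (hIk _ hZ₀)) (by
        rw [SubmodMax.dummyExt, SubmodMax.toLeft_pad]
        exact SubmodMax.lt_pow_mul_of_fraction hk hε hα₀ hV hα)
    refine ⟨_, _, fun ω => ⟨SubmodMax.run_matroidAlg hrun ω, ?_⟩, fun ω => ?_,
      SubmodMax.le_expect_matroid hI hIk hf0 hf hk hε hℓ hmax hexch hO.1 hV hZ⟩
    · exact (Nat.cast_le.2 (SubmodMax.queries_matroidAlg_le hrun hq ω)).trans
        (SubmodMax.query_bound hk Fintype.card_pos hε hε' hα₀ hℓ)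
    · exact SubmodMax.bestOf_feasible hZ.1.1 (SubmodMax.matroid_invariant hI hf0 hf
        (SubmodMax.ceil_bounds hε hℓ).1 hmax hexch hZ.1.2.le (t := 0.559) (m := 559)
        (by norm_num) ℓ ω).1.1
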